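/- Let $X_1,X_2,\dots$ be i.i.d. real random variables with a bounded density $p$ which vanishes on $(-\infty,0)$ and satisfies $p(x)=c\exp(-(g(x)-q(x)))$ for $x>0$, where $c>0$, $g>0$ is differentiable on $(0,\infty)$ with $g(x)/x\to\infty$ as $x\to\infty$, and, with $h:=g'$, there is $\vartheta>0$ such that for all large $x$ $$\sup_{v>0,\ |v-x|<\vartheta x}|q(v)|\le \frac1{\sqrt{x\,h(x)}} .$$ Let $R_0$ be the class of functions $l$ with $l(x)=\exp\big(\int_1^x \frac{\epsilon(u)}{u}\,du\big)$ for $x\ge 1$, where $\epsilon$ is twice differentiable and $\epsilon(x)\to0$ as $x\to\infty$. Put $\psi(u):=\inf\{x>0: h(x)\ge u\}$. Assume that one of the following holds. (a) $h\in R_\beta$ for some $\beta>0$: for all large $x$, $h(x)=x^\beta l(x)$ with $l\in R_0$ whose $\epsilon$ satisfies $\limsup_{x\to\infty}x|\epsilon'(x)|<\infty$ and $\limsup_{x\to\infty}x^2|\epsilon''(x)|<\infty$. (b) $h\in R_\infty$: $h$ is strictly increasing on $(0,\infty)$ and $\psi\in R_0$, with $\psi(x)\to\infty$, $x\epsilon'(x)/\epsilon(x)\to0$,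 $x^2\epsilon''(x)/\epsilon(x)\to0$ as $x\to\infty$, and $\liminf_{x\to\infty}x^\eta\epsilon(x)>0$ for some $\eta\in(0,1/4)$. Let $\phi(t)=E\,e^{tX_1}$, $m(t)=\frac{d}{dt}\log\phi(t)$, $s^2(t)=\frac{d^2}{dt^2}\log\phi(t)$ with $s(t)\ge 0$, $I(x)=x\,m^{-1}(x)-\log\phi(m^{-1}(x))$, and $S_1^n=X_1+\dots+X_n$. Let $a_n\to\infty$, let $t_n$ be defined (for large $n$) by $m(t_n)=a_n$, and suppose that $$\frac{\psi(t_n)^2}{\sqrt n\,\psi'(t_n)}\longrightarrow 0\qquad(n\to\infty).$$ Then, as $n\to\infty$, $$P(S_1^n\ge n a_n)=\frac{\exp(-nI(a_n))}{\sqrt{2\pi}\,\sqrt n\;t_n\,s(t_n)}\Big(1+o\big(\tfrac1{\sqrt n}\big)\Big).$$ -/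

import Mathlib

open MeasureTheory ProbabilityTheory Filter Topology Asymptotics Set

noncomputable section

/-- `l(x) = exp (∫₁ˣ ε(u)/u du)` for `x ≥ 1`, where `ε` is twice differentiable and tends to `0`
at infinity: the representation that defines the subclass `R₀` of slowly varying functions. -/
structure IsR0Rep (l ε : ℝ → ℝ) : Prop where
  cont : ContinuousOn ε (Ici 1)
  diff : ∀ x, 1 < x → DifferentiableAt ℝ ε x
  diff_two : ∀ x, 1 < x → DifferentiableAt ℝ (deriv ε) x
  tendsto_zero : Tendsto ε atTop (𝓝 0)
  repr : ∀ x, 1 ≤ x → l x = Real.exp (∫ u in (1 : ℝ)..x, ε u / u)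

/-- The class `R_β`: for large `x`, `h(x) = x^β l(x)` with `l ∈ R₀`,
`limsup x |ε'(x)| < ∞` and `limsup x² |ε''(x)| < ∞`. -/
def MemRBeta (β : ℝ) (h : ℝ → ℝ) : Prop :=
  0 < β ∧ ∃ l ε : ℝ → ℝ, IsR0Rep l ε ∧
    IsBoundedUnder (· ≤ ·) atTop (fun x : ℝ => x * |deriv ε x|) ∧
    IsBoundedUnder (· ≤ ·) atTop (fun x : ℝ => x ^ 2 * |deriv (deriv ε) x|) ∧
    ∀ᶠ x in atTop, h x = x ^ β * l x

/-- The class of those `l ∈ R₀` with `l → ∞`, `x ε'(x)/ε(x) → 0`, `x² ε''(x)/ε(x) → 0` and,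
for some `η ∈ (0, 1/4)`, `liminf x^η ε(x) > 0`. -/
def MemR0Tilde (l : ℝ → ℝ) : Prop :=
  ∃ ε : ℝ → ℝ, IsR0Rep l ε ∧
    Tendsto l atTop atTop ∧
    Tendsto (fun x : ℝ => x * deriv ε x / ε x) atTop (𝓝 0) ∧
    Tendsto (fun x : ℝ => x ^ 2 * deriv (deriv ε) x / ε x) atTop (𝓝 0) ∧
    ∃ η ∈ Ioo (0 : ℝ) (1 / 4), ∃ δ > (0 : ℝ), ∀ᶠ x in atTop, δ ≤ x ^ η * ε x

/-- The generalized inverse `u ↦ inf {x : h(x) ≥ u}` of a function `h` on `(0, ∞)`. -/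
def leftInv (h : ℝ → ℝ) (u : ℝ) : ℝ := sInf {x : ℝ | 0 < x ∧ u ≤ h x}

/-- The class `R_∞`: `h` is strictly increasing on `(0, ∞)` and its inverse is in the class
described by `MemR0Tilde`. -/
def MemRInfty (h : ℝ → ℝ) : Prop :=
  StrictMonoOn h (Ioi 0) ∧ MemR0Tilde (leftInv h)

variable {Ω : Type*} [MeasurableSpace Ω]

/-- `m(t) = (d/dt) log φ(t)`, where `φ(t) = E exp(tX)` (Mathlib's `cgf X P` is `log φ`). -/
def tiltMean (X : Ω → ℝ) (P : Measure Ω) (t : ℝ) : ℝ := deriv (cgf X P) t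

/-- `s(t)`, the nonnegative square root of `s²(t) = m'(t) = (d²/dt²) log φ(t)`. -/
def tiltSd (X : Ω → ℝ) (P : Measure Ω) (t : ℝ) : ℝ := Real.sqrt (deriv (tiltMean X P) t)

/-- `I(x) = x m⁻¹(x) - log φ(m⁻¹(x))`. -/
def rateFun (X : Ω → ℝ) (P : Measure Ω) (x : ℝ) : ℝ :=
  x * Function.invFun (tiltMean X P) x - cgf X P (Function.invFun (tiltMean X P) x)

end

/-!
The tail probability is computed by exponential tilting. Under the tilt by `t` with `m(t) = a`, the
sum `S₁ⁿ` has mean `n a` and standard deviation `s √n`, and `P(S₁ⁿ ≥ n a)` is `exp (-n I(a))` times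
the one-sided Laplace transform, at `l = t s √n`, of the normalized tilted law of the sum
(`measureReal_le_eq_laplace`). For the Gaussian law this transform is `(1 + O(l⁻²)) / (√(2π) l)`. If
the characteristic function of the normalized sum is within `J` of the Gaussian one in `L¹`, then
the densities differ by at most `J / (2π)`, so that the transform is perturbed by a relative error
`O(J)` (`abs_laplace_sub_one_le`, `abs_tail_ratio_sub_one_le`). It remains to prove that
`√n J → 0` and that `t s → ∞`.

The first point is an Edgeworth expansion for triangular arrays
(`tendsto_sqrt_mul_integral_charFun_pow_sub_gaussian`). Its `1/√n` term is proportional to the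
skewness of the summands, which tends to `0` here because the standardized tilted law of a single
variable is itself asymptotically Gaussian as the tilt grows.

That asymptotic normality is a Laplace method. Both classes of functions `h` give `h' = h / r` with
`r` positive and Lipschitz near infinity (`MemRBeta.regularExponent`, `MemRInfty.regularExponent`):
`r(x) = x / (β + ε(x))` in the regularly varying case, and `r(x) = x ε(h(x))` in the rapidly varying
one. Write `t = h(x)`. The tilted density `exp (t y) p(y)` has its mode near `y = x`, and its width
`(h')^{-1/2} = (r / h)^{1/2}` is negligible with respect to `r` and to `x`. Hence `h'` is
asymptotically constant across the peak, whose shape becomes Gaussian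
(`RegularExponent.tendsto_drop`), and convexity of `g` provides an exponential envelope
(`exists_peakWeight_le`). Dominated convergence yields the convergence of all moments
(`LightTailDensity.tendsto_moment`) and the uniform convergence of the characteristic functions
(`LightTailDensity.exists_charFun_sub_gaussian_le`), while boundedness of the densities controls the
characteristic functions in `L²` (`integrable_charFun_sq_of_le_smul_volume`). Finally `s` is
asymptotic to the width, so that `t s` is asymptotic to `√(h r)`, which tends to infinity
(`LightTailDensity.tendsto_mul_tiltSd`).
-/

/-! ### Comparison of laws through their characteristic functions -/

open scoped FourierTransform ContDiff Manifold in
/-- Testing against smooth bump functions detects the order between Borel measures on the line. -/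
theorem measure_le_of_forall_integral_le {μ ν : Measure ℝ} [IsFiniteMeasure μ]
    [IsLocallyFiniteMeasure ν]
    (H : ∀ k : ℝ → ℝ, ContDiff ℝ ∞ k → HasCompactSupport k → (∀ x, 0 ≤ k x) →
      ∫ x, k x ∂μ ≤ ∫ x, k x ∂ν) : μ ≤ ν := by
  have hK : ∀ K : Set ℝ, IsCompact K → μ K ≤ ν K := by
    intro K hK
    rw [K.measure_eq_iInf_isOpen ν]
    refine le_iInf₂ fun U hKU => le_iInf fun hU => ?_
    obtain ⟨V, hVo, hKV, hVU, hVc⟩ := exists_open_between_and_isCompact_closure hK hU hKU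
    obtain ⟨k, hk, hrange, hsupp, hone⟩ := exists_contMDiff_support_eq_eq_one_iff
      (modelWithCornersSelf ℝ ℝ) hVo hK.isClosed hKV
    have hk' : ContDiff ℝ ∞ k := hk.contDiff
    have hcs : HasCompactSupport k :=
      HasCompactSupport.of_support_subset_isCompact hVc (hsupp ▸ subset_closure)
    have h01 : ∀ x, 0 ≤ k x ∧ k x ≤ 1 := fun x => hrange (mem_range_self x)
    have h1 := H k hk' hcs (fun x => (h01 x).1)
    have hi1 : Integrable k μ := hk'.continuous.integrable_of_hasCompactSupport hcs
    have hi2 : Integrable k ν := hk'.continuous.integrable_of_hasCompactSupport hcs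
    have h2 : ∫⁻ x, ENNReal.ofReal (k x) ∂μ ≤ ∫⁻ x, ENNReal.ofReal (k x) ∂ν := by
      rw [← ofReal_integral_eq_lintegral_ofReal hi1 (ae_of_all _ fun x => (h01 x).1),
        ← ofReal_integral_eq_lintegral_ofReal hi2 (ae_of_all _ fun x => (h01 x).1)]
      exact ENNReal.ofReal_le_ofReal h1
    calc μ K = ∫⁻ x, K.indicator 1 x ∂μ := by rw [lintegral_indicator_one hK.measurableSet]
      _ ≤ ∫⁻ x, ENNReal.ofReal (k x) ∂μ := by
          refine lintegral_mono fun x => ?_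
          by_cases hx : x ∈ K
          · simp [hx, (hone x).1 hx]
          · simp [hx]
      _ ≤ ∫⁻ x, ENNReal.ofReal (k x) ∂ν := h2
      _ ≤ ∫⁻ x, U.indicator 1 x ∂ν := by
          refine lintegral_mono fun x => ?_
          by_cases hx : x ∈ U
          · simpa [hx] using (h01 x).2
          · have : k x = 0 := by
              by_contra hne
              exact hx (hVU (subset_closure (hsupp ▸ hne)))
            simp [this]
      _ = ν U := by rw [lintegral_indicator_one hU.measurableSet]
  refine Measure.le_iff.2 fun s hs => ?_
  rw [hs.measure_eq_iSup_isCompact]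
  refine iSup₂_le fun K hKs => iSup_le fun hc => (hK K hc).trans (measure_mono hKs)

open scoped FourierTransform ContDiff in
/-- Parseval's formula for a Schwartz function and a finite measure. -/
theorem integral_eq_integral_fourier_mul_charFun (μ : Measure ℝ) [IsFiniteMeasure μ]
    (k : SchwartzMap ℝ ℂ) :
    ∫ x, k x ∂μ = ∫ w, (𝓕 k : SchwartzMap ℝ ℂ) w * charFun μ (2 * Real.pi * w) := by
  have hinv : ∀ x, k x = ∫ w, Complex.exp ((2 * Real.pi * w : ℝ) * x * Complex.I) *
      (𝓕 k : SchwartzMap ℝ ℂ) w := by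
    intro x
    have h1 : 𝓕⁻ (𝓕 (k : ℝ → ℂ)) = k :=
      k.continuous.fourierInv_fourier_eq k.integrable (by
        have := (𝓕 k).integrable (μ := volume)
        rwa [SchwartzMap.fourier_coe] at this)
    have h2 := congrFun h1 x
    rw [Real.fourierInv_eq'] at h2
    rw [← h2]
    congr 1
    ext w
    simp only [smul_eq_mul, SchwartzMap.fourier_coe]
    congr 2
    simp
    ring
  have hint : Integrable (𝓕 k : SchwartzMap ℝ ℂ) volume := (𝓕 k).integrable
  calc ∫ x, k x ∂μ
      = ∫ x, (∫ w, Complex.exp ((2 * Real.pi * w : ℝ) * x * Complex.I) *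
          (𝓕 k : SchwartzMap ℝ ℂ) w) ∂μ := by
        exact integral_congr_ae (ae_of_all _ hinv)
    _ = ∫ w, (∫ x, Complex.exp ((2 * Real.pi * w : ℝ) * x * Complex.I) *
          (𝓕 k : SchwartzMap ℝ ℂ) w ∂μ) := by
        rw [integral_integral_swap]
        have h3 : Integrable (fun z : ℝ × ℝ => (𝓕 k : SchwartzMap ℝ ℂ) z.2) (μ.prod volume) :=
          hint.comp_snd μ
        refine h3.bdd_mul (c := 1) (by fun_prop) (ae_of_all _ fun z => ?_)
        rw [← Complex.ofReal_mul, Complex.norm_exp_ofReal_mul_I]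
    _ = _ := by
        congr 1
        ext w
        rw [integral_mul_const, charFun_apply_real, mul_comm]

open scoped FourierTransform ContDiff in
/-- Two laws whose characteristic functions are close in `L¹` are close setwise, up to a multiple of
Lebesgue measure: formally, the densities differ by at most `(2π)⁻¹ ‖χ_μ - χ_ν‖₁`. -/
theorem measure_le_add_of_charFun (μ ν : Measure ℝ) [IsFiniteMeasure μ] [IsFiniteMeasure ν]
    (hint : Integrable (fun u => charFun μ u - charFun ν u)) :
    μ ≤ ν + ENNReal.ofReal ((2 * Real.pi)⁻¹ * ∫ u, ‖charFun μ u - charFun ν u‖) • volume := by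
  set Δ := (2 * Real.pi)⁻¹ * ∫ u, ‖charFun μ u - charFun ν u‖ with hΔ
  have hΔ0 : 0 ≤ Δ := by positivity
  have : IsFiniteMeasureOnCompacts (ν + ENNReal.ofReal Δ • (volume : Measure ℝ)) :=
    ⟨fun K hK => by
      rw [Measure.add_apply, Measure.smul_apply, smul_eq_mul]
      exact ENNReal.add_lt_top.2
        ⟨measure_lt_top ν K, ENNReal.mul_lt_top ENNReal.ofReal_lt_top hK.measure_lt_top⟩⟩
  have : IsLocallyFiniteMeasure (ν + ENNReal.ofReal Δ • (volume : Measure ℝ)) :=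
    isLocallyFiniteMeasure_of_isFiniteMeasureOnCompacts
  refine measure_le_of_forall_integral_le fun k hk hc h0 => ?_
  let kc : SchwartzMap ℝ ℂ := HasCompactSupport.toSchwartzMap (f := fun x => (k x : ℂ))
    (hc.comp_left (g := fun x : ℝ => (x : ℂ)) (by simp))
    (Complex.ofRealCLM.contDiff.comp hk)
  have hkc : ∀ x, kc x = k x := fun x => rfl
  have hμ : ∫ x, kc x ∂μ = ((∫ x, k x ∂μ : ℝ) : ℂ) := by
    simp_rw [hkc]; exact integral_ofReal
  have hν : ∫ x, kc x ∂ν = ((∫ x, k x ∂ν : ℝ) : ℂ) := by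
    simp_rw [hkc]; exact integral_ofReal
  have hki : Integrable (𝓕 kc : SchwartzMap ℝ ℂ) volume := (𝓕 kc).integrable
  have hbdd : ∀ (m : Measure ℝ) [IsFiniteMeasure m],
      Integrable (fun w => (𝓕 kc : SchwartzMap ℝ ℂ) w * charFun m (2 * Real.pi * w)) := by
    intro m _
    refine hki.mul_bdd (c := m.real univ) ?_ (ae_of_all _ fun w => norm_charFun_le _)
    exact ((measurable_charFun (μ := m)).comp (by fun_prop)).aestronglyMeasurable
  have hsub : ((∫ x, k x ∂μ - ∫ x, k x ∂ν : ℝ) : ℂ)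
      = ∫ w, (𝓕 kc : SchwartzMap ℝ ℂ) w *
        (charFun μ (2 * Real.pi * w) - charFun ν (2 * Real.pi * w)) := by
    push_cast
    rw [← hμ, ← hν, integral_eq_integral_fourier_mul_charFun,
      integral_eq_integral_fourier_mul_charFun, ← integral_sub (hbdd μ) (hbdd ν)]
    congr 1; ext w; ring
  -- `k` is nonnegative, so its `L¹` norm, which bounds `𝓕 k`, is its Lebesgue integral
  have hF : ∀ w, ‖(𝓕 kc : SchwartzMap ℝ ℂ) w‖ ≤ ∫ x, k x := by
    intro w
    rw [SchwartzMap.fourier_coe]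
    refine (VectorFourier.norm_fourierIntegral_le_integral_norm _ _ _ _ _).trans (le_of_eq ?_)
    congr 1; ext x
    simp [hkc, abs_of_nonneg (h0 x)]
  have hI : ∫ w, ‖charFun μ (2 * Real.pi * w) - charFun ν (2 * Real.pi * w)‖ = Δ := by
    rw [Measure.integral_comp_mul_left (fun u => ‖charFun μ u - charFun ν u‖) (2 * Real.pi), hΔ,
      abs_of_pos (by positivity), smul_eq_mul]
  have hdiff : ∫ x, k x ∂μ - ∫ x, k x ∂ν ≤ (∫ x, k x) * Δ := by
    calc ∫ x, k x ∂μ - ∫ x, k x ∂ν ≤ ‖((∫ x, k x ∂μ - ∫ x, k x ∂ν : ℝ) : ℂ)‖ := by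
          rw [Complex.norm_real]; exact le_abs_self _
      _ ≤ ∫ w, (∫ x, k x) * ‖charFun μ (2 * Real.pi * w) - charFun ν (2 * Real.pi * w)‖ := by
          rw [hsub]
          refine norm_integral_le_of_norm_le ?_ (ae_of_all _ fun w => ?_)
          · exact ((hint.comp_mul_left' (by positivity : 2 * Real.pi ≠ 0)).norm).const_mul _
          · rw [norm_mul]
            gcongr
            exact hF w
      _ = (∫ x, k x) * Δ := by rw [integral_const_mul, hI]
  have hi2 : Integrable k ν := hk.continuous.integrable_of_hasCompactSupport hc
  have hi3 : Integrable k volume := hk.continuous.integrable_of_hasCompactSupport hc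
  rw [integral_add_measure hi2 (hi3.smul_measure (by simp)), integral_smul_measure,
    ENNReal.toReal_ofReal hΔ0, smul_eq_mul]
  linarith

/-- Fourier transform of a centred Gaussian function, in the form `∫ exp (iux - εu²/2) du`. -/
theorem integral_cexp_mul_I_sub_sq {ε : ℝ} (hε : 0 < ε) (x : ℝ) :
    ∫ u : ℝ, Complex.exp (u * x * Complex.I) * (Real.exp (-(ε / 2) * u ^ 2) : ℂ)
      = ((Real.sqrt (2 * Real.pi / ε) * Real.exp (-(1 / (2 * ε)) * x ^ 2) : ℝ) : ℂ) := by
  have h := fourierIntegral_gaussian (b := ((ε / 2 : ℝ) : ℂ)) (by simpa using hε) (x : ℂ)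
  have h1 : ((Real.pi : ℂ) / ((ε / 2 : ℝ) : ℂ)) ^ (1 / 2 : ℂ)
      = ((Real.sqrt (2 * Real.pi / ε) : ℝ) : ℂ) := by
    rw [Real.sqrt_eq_rpow, Complex.ofReal_cpow (by positivity)]
    push_cast
    congr 1
    field_simp
  rw [h1] at h
  push_cast at h ⊢
  rw [show -(1 / (2 * (ε : ℂ))) * (x : ℂ) ^ 2 = -(x : ℂ) ^ 2 / (4 * (ε / 2)) by
    field_simp; ring]
  rw [← h]
  congr 1
  ext u
  congr 2
  ring

/-- One half of Plancherel's formula: the characteristic function of a law with density bounded by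
`D` has square integral at most `2πD`. The bound on the density is stated as a bound of the law by
a multiple of Lebesgue measure. -/
theorem integrable_charFun_sq_of_le_smul_volume {ρ : Measure ℝ} [IsProbabilityMeasure ρ] {D : ℝ}
    (hD : 0 ≤ D) (hρ : ρ ≤ ENNReal.ofReal D • volume) :
    Integrable (fun u => ‖charFun ρ u‖ ^ 2) ∧ ∫ u, ‖charFun ρ u‖ ^ 2 ≤ 2 * Real.pi * D := by
  have hmeas : Measurable (fun u => ‖charFun ρ u‖ ^ 2) := (measurable_charFun.norm.pow_const 2)
  -- the damped square integral, computed by interchanging integrals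
  have key : ∀ ε : ℝ, 0 < ε →
      ∫ u, ‖charFun ρ u‖ ^ 2 * Real.exp (-(ε / 2) * u ^ 2) ≤ 2 * Real.pi * D := by
    intro ε hε
    have hsq : ∀ u, ((‖charFun ρ u‖ ^ 2 : ℝ) : ℂ)
        = ∫ z : ℝ × ℝ, Complex.exp (u * ((z.1 - z.2 : ℝ) : ℂ) * Complex.I) ∂(ρ.prod ρ) := by
      intro u
      have : ((‖charFun ρ u‖ ^ 2 : ℝ) : ℂ) = charFun ρ u * charFun ρ (-u) := by
        rw [charFun_neg, Complex.mul_conj, Complex.normSq_eq_norm_sq]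
      rw [this, charFun_apply_real, charFun_apply_real, ← integral_prod_mul]
      congr 1
      ext z
      rw [← Complex.exp_add]
      congr 1
      push_cast
      ring
    have hg : Integrable (fun u : ℝ => Real.exp (-(ε / 2) * u ^ 2)) :=
      integrable_exp_neg_mul_sq (by positivity)
    have hC : ((∫ u, ‖charFun ρ u‖ ^ 2 * Real.exp (-(ε / 2) * u ^ 2) : ℝ) : ℂ)
        = ((∫ z : ℝ × ℝ, Real.sqrt (2 * Real.pi / ε) *
            Real.exp (-(1 / (2 * ε)) * (z.1 - z.2) ^ 2) ∂(ρ.prod ρ) : ℝ) : ℂ) := by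
      rw [← integral_complex_ofReal, ← integral_complex_ofReal]
      have hz : ∀ z : ℝ × ℝ, ((Real.sqrt (2 * Real.pi / ε) *
          Real.exp (-(1 / (2 * ε)) * (z.1 - z.2) ^ 2) : ℝ) : ℂ)
          = ∫ u : ℝ, Complex.exp (u * ((z.1 - z.2 : ℝ) : ℂ) * Complex.I) *
            (Real.exp (-(ε / 2) * u ^ 2) : ℂ) := fun z =>
        (integral_cexp_mul_I_sub_sq hε (z.1 - z.2)).symm
      simp_rw [hz]
      rw [integral_integral_swap]
      · congr 1
        ext u
        rw [integral_mul_const, ← hsq]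
        push_cast
        rfl
      · have h3 : Integrable (fun z : (ℝ × ℝ) × ℝ => (Real.exp (-(ε / 2) * z.2 ^ 2) : ℂ))
            ((ρ.prod ρ).prod volume) := (hg.ofReal (𝕜 := ℂ)).comp_snd (ρ.prod ρ)
        refine h3.bdd_mul (c := 1) (by fun_prop) (ae_of_all _ fun z => ?_)
        rw [← Complex.ofReal_mul, Complex.norm_exp_ofReal_mul_I]
    rw [Complex.ofReal_inj.1 hC]
    -- bound the inner integral using the density bound
    have hb : 0 < 1 / (2 * ε) := by positivity
    have hgi : Integrable (fun u : ℝ => Real.exp (-(1 / (2 * ε)) * u ^ 2)) :=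
      integrable_exp_neg_mul_sq hb
    have hinner : ∀ y, ∫ x, Real.exp (-(1 / (2 * ε)) * (x - y) ^ 2) ∂ρ
        ≤ D * Real.sqrt (2 * Real.pi * ε) := by
      intro y
      have hi : Integrable (fun x : ℝ => Real.exp (-(1 / (2 * ε)) * (x - y) ^ 2)) :=
        hgi.comp_sub_right y
      calc ∫ x, Real.exp (-(1 / (2 * ε)) * (x - y) ^ 2) ∂ρ
          ≤ ∫ x, Real.exp (-(1 / (2 * ε)) * (x - y) ^ 2) ∂(ENNReal.ofReal D • volume) :=
            integral_mono_measure hρ (ae_of_all _ fun x => (Real.exp_pos _).le)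
              (hi.smul_measure (by simp))
        _ = D * Real.sqrt (2 * Real.pi * ε) := by
            rw [integral_smul_measure, ENNReal.toReal_ofReal hD, smul_eq_mul,
              integral_sub_right_eq_self (fun x => Real.exp (-(1 / (2 * ε)) * x ^ 2)) y,
              integral_gaussian]
            congr 2
            field_simp
    rw [integral_prod_symm _ (by
      refine Integrable.const_mul ?_ _
      refine Integrable.of_bound (by fun_prop) 1 (ae_of_all _ fun z => ?_)
      rw [Real.norm_of_nonneg (Real.exp_pos _).le, Real.exp_le_one_iff]
      have := mul_nonneg hb.le (sq_nonneg (z.1 - z.2))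
      linarith)]
    calc ∫ y, ∫ x, Real.sqrt (2 * Real.pi / ε) * Real.exp (-(1 / (2 * ε)) * (x - y) ^ 2) ∂ρ ∂ρ
        ≤ ∫ y, Real.sqrt (2 * Real.pi / ε) * (D * Real.sqrt (2 * Real.pi * ε)) ∂ρ := by
          refine integral_mono_of_nonneg (ae_of_all _ fun y => ?_) (integrable_const _)
            (ae_of_all _ fun y => ?_)
          · exact integral_nonneg fun x => by positivity
          · dsimp only
            rw [integral_const_mul]
            exact mul_le_mul_of_nonneg_left (hinner y) (by positivity)
      _ = 2 * Real.pi * D := by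
          rw [integral_const, probReal_univ, one_smul, mul_left_comm,
            ← Real.sqrt_mul (by positivity),
            show 2 * Real.pi / ε * (2 * Real.pi * ε) = (2 * Real.pi) ^ 2 by field_simp,
            Real.sqrt_sq (by positivity)]
          ring
  -- remove the damping by Fatou's lemma
  have hfatou : ∫⁻ u, ENNReal.ofReal (‖charFun ρ u‖ ^ 2) ≤ ENNReal.ofReal (2 * Real.pi * D) := by
    have hlim : ∀ u : ℝ, Tendsto (fun n : ℕ => ENNReal.ofReal
        (‖charFun ρ u‖ ^ 2 * Real.exp (-(1 / ((n : ℝ) + 1) / 2) * u ^ 2))) atTop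
        (𝓝 (ENNReal.ofReal (‖charFun ρ u‖ ^ 2))) := by
      intro u
      refine ENNReal.tendsto_ofReal ?_
      have h1 : Tendsto (fun n : ℕ => -(1 / ((n : ℝ) + 1) / 2) * u ^ 2) atTop (𝓝 0) := by
        simpa using ((tendsto_one_div_add_atTop_nhds_zero_nat (𝕜 := ℝ)).div_const 2).neg.mul_const
          (u ^ 2)
      simpa using ((Real.continuous_exp.tendsto 0).comp h1).const_mul (‖charFun ρ u‖ ^ 2)
    calc ∫⁻ u, ENNReal.ofReal (‖charFun ρ u‖ ^ 2)
        = ∫⁻ u, liminf (fun n : ℕ => ENNReal.ofReal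
            (‖charFun ρ u‖ ^ 2 * Real.exp (-(1 / ((n : ℝ) + 1) / 2) * u ^ 2))) atTop :=
          lintegral_congr fun u => (hlim u).liminf_eq.symm
      _ ≤ liminf (fun n : ℕ => ∫⁻ u, ENNReal.ofReal
            (‖charFun ρ u‖ ^ 2 * Real.exp (-(1 / ((n : ℝ) + 1) / 2) * u ^ 2))) atTop :=
          lintegral_liminf_le fun n => by fun_prop
      _ ≤ ENNReal.ofReal (2 * Real.pi * D) := by
          refine liminf_le_of_frequently_le' (Eventually.frequently (Eventually.of_forall ?_))
          intro n
          have hε : (0 : ℝ) < 1 / ((n : ℝ) + 1) := by positivity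
          rw [← ofReal_integral_eq_lintegral_ofReal]
          · exact ENNReal.ofReal_le_ofReal (key _ hε)
          · refine (integrable_exp_neg_mul_sq (b := 1 / ((n : ℝ) + 1) / 2) (by positivity)).bdd_mul
              (c := 1) hmeas.aestronglyMeasurable (ae_of_all _ fun u => ?_)
            rw [norm_pow, norm_norm]
            exact pow_le_one₀ (norm_nonneg _) (norm_charFun_le_one u)
          · exact ae_of_all _ fun u => by positivity
  have hint : Integrable (fun u => ‖charFun ρ u‖ ^ 2) := by
    refine ⟨hmeas.aestronglyMeasurable, ?_⟩
    rw [hasFiniteIntegral_iff_ofReal (ae_of_all _ fun u => by positivity)]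
    exact hfatou.trans_lt ENNReal.ofReal_lt_top
  refine ⟨hint, ?_⟩
  rw [← ofReal_integral_eq_lintegral_ofReal hint (ae_of_all _ fun u => by positivity)] at hfatou
  exact (ENNReal.ofReal_le_ofReal_iff (by positivity)).1 hfatou

/-! ### Edgeworth expansion for triangular arrays -/

/-- Third order Taylor bound for `exp (iy)`, valid for all real `y`: beyond `|y| = 1` each of the
terms is itself at most `y⁴`. -/
theorem norm_cexp_I_sub_taylor_three_le (y : ℝ) :
    ‖Complex.exp (y * Complex.I) - (1 + y * Complex.I - y ^ 2 / 2 - y ^ 3 / 6 * Complex.I)‖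
      ≤ 4 * y ^ 4 := by
  have hI2 : Complex.I ^ 2 = -1 := Complex.I_sq
  have hI3 : Complex.I ^ 3 = -Complex.I := Complex.I_pow_three
  have hy4 : y ^ 4 = |y| ^ 4 := by rw [← abs_pow, abs_of_nonneg (by positivity)]
  rcases le_or_gt |y| 1 with hy | hy
  · have h := Complex.exp_bound (x := y * Complex.I) (by simpa using hy) (n := 4) (by norm_num)
    have hs : ∑ m ∈ Finset.range 4, (y * Complex.I) ^ m / (m.factorial : ℂ)
        = 1 + y * Complex.I - y ^ 2 / 2 - y ^ 3 / 6 * Complex.I := by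
      simp only [Finset.sum_range_succ, Finset.sum_range_zero, mul_pow, hI2, hI3, Nat.factorial]
      push_cast
      ring
    rw [hs] at h
    refine h.trans ?_
    have hn : ‖(y : ℂ) * Complex.I‖ = |y| := by simp
    rw [hn, hy4, mul_comm]
    refine mul_le_mul_of_nonneg_right ?_ (by positivity)
    norm_num [Nat.factorial]
  · have h1 : ‖Complex.exp (y * Complex.I)‖ = 1 := Complex.norm_exp_ofReal_mul_I y
    have h2 : ‖(1 : ℂ) + y * Complex.I - y ^ 2 / 2 - y ^ 3 / 6 * Complex.I‖
        ≤ 1 + |y| + |y| ^ 2 / 2 + |y| ^ 3 / 6 := by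
      refine (norm_sub_le _ _).trans (add_le_add ((norm_sub_le _ _).trans
        (add_le_add ((norm_add_le _ _).trans ?_) ?_)) ?_) <;> simp
    have h3 := norm_sub_le (Complex.exp (y * Complex.I))
      (1 + y * Complex.I - y ^ 2 / 2 - y ^ 3 / 6 * Complex.I)
    have h4 : 1 ≤ |y| ^ 4 := one_le_pow₀ hy.le
    have h5 : |y| ≤ |y| ^ 4 := by simpa using pow_le_pow_right₀ hy.le (show 1 ≤ 4 by norm_num)
    have h6 : |y| ^ 2 ≤ |y| ^ 4 := pow_le_pow_right₀ hy.le (by norm_num)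
    have h7 : |y| ^ 3 ≤ |y| ^ 4 := pow_le_pow_right₀ hy.le (by norm_num)
    rw [hy4]
    linarith

theorem integrable_pow_of_integrable_pow_four {ρ : Measure ℝ} [IsFiniteMeasure ρ]
    (h4 : Integrable (fun x => x ^ 4) ρ) {k : ℕ} (hk : k ≤ 4) :
    Integrable (fun x => x ^ k) ρ := by
  refine ((integrable_const (1 : ℝ)).add h4).mono' (by fun_prop) (ae_of_all _ fun x => ?_)
  rw [norm_pow, Real.norm_eq_abs, Pi.add_apply,
    show x ^ 4 = |x| ^ 4 by rw [← abs_pow, abs_of_nonneg (by positivity)]]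
  rcases le_total |x| 1 with hx | hx
  · have := pow_le_one₀ (abs_nonneg x) hx (n := k)
    have : 0 ≤ |x| ^ 4 := by positivity
    linarith
  · have := pow_le_pow_right₀ hx hk
    linarith

/-- Third order expansion at `0` of the characteristic function of a standardized law. -/
theorem norm_charFun_sub_taylor_three_le {ρ : Measure ℝ} [IsProbabilityMeasure ρ] {κ M : ℝ}
    (h4 : Integrable (fun x => x ^ 4) ρ) (m1 : ∫ x, x ∂ρ = 0) (m2 : ∫ x, x ^ 2 ∂ρ = 1)
    (m3 : ∫ x, x ^ 3 ∂ρ = κ) (m4 : ∫ x, x ^ 4 ∂ρ ≤ M) (v : ℝ) :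
    ‖charFun ρ v - (1 - v ^ 2 / 2 - κ * v ^ 3 / 6 * Complex.I)‖ ≤ 4 * M * v ^ 4 := by
  have i1 : Integrable (fun x : ℝ => (x : ℂ)) ρ := by
    simpa using (integrable_pow_of_integrable_pow_four h4 (k := 1) (by norm_num)).ofReal (𝕜 := ℂ)
  have i2 : Integrable (fun x : ℝ => ((x ^ 2 : ℝ) : ℂ)) ρ :=
    (integrable_pow_of_integrable_pow_four h4 (k := 2) (by norm_num)).ofReal (𝕜 := ℂ)
  have i3 : Integrable (fun x : ℝ => ((x ^ 3 : ℝ) : ℂ)) ρ :=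
    (integrable_pow_of_integrable_pow_four h4 (k := 3) (by norm_num)).ofReal (𝕜 := ℂ)
  have ie : Integrable (fun x : ℝ => Complex.exp ((v * x : ℝ) * Complex.I)) ρ :=
    Integrable.of_bound (by fun_prop) 1 (ae_of_all _ fun x => by
      rw [Complex.norm_exp_ofReal_mul_I])
  have key : charFun ρ v - (1 - v ^ 2 / 2 - κ * v ^ 3 / 6 * Complex.I)
      = ∫ x : ℝ, (Complex.exp ((v * x : ℝ) * Complex.I) - (1 + (v * x : ℝ) * Complex.I
        - ((v * x : ℝ) : ℂ) ^ 2 / 2 - ((v * x : ℝ) : ℂ) ^ 3 / 6 * Complex.I)) ∂ρ := by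
    have e1 : (fun x : ℝ => (1 + (v * x : ℝ) * Complex.I
        - ((v * x : ℝ) : ℂ) ^ 2 / 2 - ((v * x : ℝ) : ℂ) ^ 3 / 6 * Complex.I))
        = fun x : ℝ => ((1 + (v * Complex.I) * (x : ℂ)) - (v ^ 2 / 2) * ((x ^ 2 : ℝ) : ℂ))
          - (v ^ 3 / 6 * Complex.I) * ((x ^ 3 : ℝ) : ℂ) := by
      ext x; push_cast; ring
    have j1 : Integrable (fun x : ℝ => 1 + (v * Complex.I) * (x : ℂ)) ρ :=
      (integrable_const _).add (i1.const_mul _)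
    have j2 : Integrable (fun x : ℝ => (1 + (v * Complex.I) * (x : ℂ))
        - (v ^ 2 / 2) * ((x ^ 2 : ℝ) : ℂ)) ρ := j1.sub (i2.const_mul _)
    have j3 : Integrable (fun x : ℝ => ((1 + (v * Complex.I) * (x : ℂ))
        - (v ^ 2 / 2) * ((x ^ 2 : ℝ) : ℂ)) - (v ^ 3 / 6 * Complex.I) * ((x ^ 3 : ℝ) : ℂ)) ρ :=
      j2.sub (i3.const_mul _)
    rw [integral_sub ie (by rw [e1]; exact j3), e1,
      integral_sub j2 (i3.const_mul _), integral_sub j1 (i2.const_mul _),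
      integral_add (integrable_const _) (i1.const_mul _), integral_const_mul, integral_const_mul,
      integral_const_mul, integral_complex_ofReal, integral_complex_ofReal,
      integral_complex_ofReal, m1, m2, m3, charFun_apply_real]
    simp
    ring
  rw [key]
  calc _ ≤ ∫ x, 4 * (v * x) ^ 4 ∂ρ := by
        refine norm_integral_le_of_norm_le ?_ (ae_of_all _ fun x => ?_)
        · simp_rw [mul_pow]
          exact (h4.const_mul _).const_mul _
        · exact_mod_cast norm_cexp_I_sub_taylor_three_le (v * x)
    _ = 4 * v ^ 4 * ∫ x, x ^ 4 ∂ρ := by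
        rw [← integral_const_mul]; congr 1; ext x; ring
    _ ≤ 4 * v ^ 4 * M := by gcongr
    _ = 4 * M * v ^ 4 := by ring

theorem norm_pow_sub_pow_le_mul {a b : ℂ} {m : ℝ} (ha : ‖a‖ ≤ m) (hb : ‖b‖ ≤ m) (n : ℕ) :
    ‖a ^ (n + 1) - b ^ (n + 1)‖ ≤ (n + 1) * ‖a - b‖ * m ^ n := by
  have hm : 0 ≤ m := (norm_nonneg a).trans ha
  induction n with
  | zero => simp
  | succ n ih =>
    have h1 : a ^ (n + 1 + 1) - b ^ (n + 1 + 1)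
        = a * (a ^ (n + 1) - b ^ (n + 1)) + (a - b) * b ^ (n + 1) := by ring
    rw [h1]
    refine (norm_add_le _ _).trans ?_
    rw [norm_mul, norm_mul, norm_pow]
    have h2 : ‖a‖ * ‖a ^ (n + 1) - b ^ (n + 1)‖ ≤ m * ((n + 1) * ‖a - b‖ * m ^ n) :=
      mul_le_mul ha ih (norm_nonneg _) hm
    have h3 : ‖a - b‖ * ‖b‖ ^ (n + 1) ≤ ‖a - b‖ * m ^ (n + 1) := by gcongr
    push_cast
    calc _ ≤ _ := add_le_add h2 h3
      _ = _ := by ring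

/-- Near the origin the characteristic function of a standardized law is dominated by a Gaussian,
and differs from the standard Gaussian one by its skewness term and a fourth order remainder. -/
theorem norm_charFun_le_and_sub_gaussian_le {ρ : Measure ℝ} [IsProbabilityMeasure ρ]
    {κ M δ : ℝ} (h4 : Integrable (fun x => x ^ 4) ρ) (m1 : ∫ x, x ∂ρ = 0)
    (m2 : ∫ x, x ^ 2 ∂ρ = 1) (m3 : ∫ x, x ^ 3 ∂ρ = κ) (m4 : ∫ x, x ^ 4 ∂ρ ≤ M)
    (hκ : |κ| ≤ 1) (hM : 0 ≤ M) (hδ0 : 0 < δ) (hδ1 : δ * (1 + 4 * M) ≤ 1 / 4) {v : ℝ}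
    (hvδ : |v| ≤ δ) :
    ‖charFun ρ v‖ ≤ Real.exp (-(v ^ 2 / 4)) ∧
      ‖charFun ρ v - (Real.exp (-(v ^ 2 / 2)) : ℂ)‖
        ≤ |κ| * |v| ^ 3 / 6 + (4 * M + 1) * v ^ 4 := by
  have hδ2 : δ ≤ 1 / 4 := by nlinarith [mul_nonneg hδ0.le hM]
  have hv4 : v ^ 4 = |v| ^ 4 := by rw [← abs_pow, abs_of_nonneg (by positivity)]
  have hv2 : v ^ 2 = |v| ^ 2 := (sq_abs v).symm
  have hv0 := abs_nonneg v
  have hv1 : |v| ≤ 1 := by linarith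
  have hT := norm_charFun_sub_taylor_three_le h4 m1 m2 m3 m4 v
  have hκv : ‖(κ * v ^ 3 / 6 * Complex.I : ℂ)‖ = |κ| * |v| ^ 3 / 6 := by simp
  have hv2le : v ^ 2 ≤ 1 := by rw [hv2]; exact pow_le_one₀ hv0 hv1
  have hq : ‖(1 - v ^ 2 / 2 : ℂ)‖ = 1 - v ^ 2 / 2 := by
    rw [show (1 - v ^ 2 / 2 : ℂ) = ((1 - v ^ 2 / 2 : ℝ) : ℂ) by push_cast; ring,
      Complex.norm_real, Real.norm_of_nonneg (by linarith)]
  have hsmall : |κ| * |v| ^ 3 / 6 + 4 * M * v ^ 4 ≤ v ^ 2 / 4 := by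
    have e1 : |κ| * |v| ^ 3 / 6 ≤ |v| ^ 2 * δ := by
      have : |v| ^ 3 = |v| ^ 2 * |v| := by ring
      have h1 : |κ| * |v| ^ 3 ≤ 1 * |v| ^ 3 := by gcongr
      have h2 : |v| ^ 3 ≤ |v| ^ 2 * δ := by rw [this]; gcongr
      have : 0 ≤ |v| ^ 2 * δ := by positivity
      linarith
    have e2 : v ^ 4 ≤ |v| ^ 2 * δ := by
      rw [hv4, show |v| ^ 4 = |v| ^ 2 * (|v| * |v|) by ring]
      gcongr
      nlinarith
    have e3 : 4 * M * v ^ 4 ≤ 4 * M * (|v| ^ 2 * δ) := by gcongr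
    have e4 : |v| ^ 2 * (δ * (1 + 4 * M)) ≤ |v| ^ 2 * (1 / 4) := by gcongr
    rw [hv2]
    nlinarith
  have ha : ‖charFun ρ v‖ ≤ Real.exp (-(v ^ 2 / 4)) := by
    have h1 : charFun ρ v = (charFun ρ v - (1 - v ^ 2 / 2 - κ * v ^ 3 / 6 * Complex.I))
        + ((1 - v ^ 2 / 2) - κ * v ^ 3 / 6 * Complex.I) := by ring
    have h2 : ‖charFun ρ v‖ ≤ 4 * M * v ^ 4 + (1 - v ^ 2 / 2 + |κ| * |v| ^ 3 / 6) := by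
      rw [h1]
      refine (norm_add_le _ _).trans (add_le_add hT ((norm_sub_le _ _).trans ?_))
      rw [hq, hκv]
    have h3 := Real.add_one_le_exp (-(v ^ 2 / 4))
    linarith
  refine ⟨ha, ?_⟩
  set b : ℂ := (Real.exp (-(v ^ 2 / 2)) : ℂ) with hb
  have hb1 : ‖(1 - v ^ 2 / 2 : ℂ) - b‖ ≤ v ^ 4 := by
    rw [hb, show (1 - v ^ 2 / 2 : ℂ) - (Real.exp (-(v ^ 2 / 2)) : ℂ)
      = ((1 - v ^ 2 / 2 - Real.exp (-(v ^ 2 / 2)) : ℝ) : ℂ) by push_cast; ring,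
      Complex.norm_real, Real.norm_eq_abs, abs_sub_comm]
    have h1 := Real.abs_exp_sub_one_sub_id_le (x := -(v ^ 2 / 2)) (by
      rw [abs_neg, abs_of_nonneg (by positivity)]; linarith)
    have h2 : Real.exp (-(v ^ 2 / 2)) - (1 - v ^ 2 / 2)
        = Real.exp (-(v ^ 2 / 2)) - 1 - -(v ^ 2 / 2) := by ring
    rw [h2]
    refine h1.trans ?_
    nlinarith [sq_nonneg (v ^ 2)]
  have h1 : charFun ρ v - b = (charFun ρ v - (1 - v ^ 2 / 2 - κ * v ^ 3 / 6 * Complex.I))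
      - κ * v ^ 3 / 6 * Complex.I + ((1 - v ^ 2 / 2) - b) := by ring
  rw [h1]
  have := norm_add_le ((charFun ρ v - (1 - v ^ 2 / 2 - κ * v ^ 3 / 6 * Complex.I))
      - κ * v ^ 3 / 6 * Complex.I) ((1 - v ^ 2 / 2) - b)
  have h2 := norm_sub_le (charFun ρ v - (1 - v ^ 2 / 2 - κ * v ^ 3 / 6 * Complex.I))
      (κ * v ^ 3 / 6 * Complex.I)
  rw [hκv] at h2
  linarith

/-- Pointwise comparison of the characteristic function of a normalized sum of `n` independent
copies of a standardized law with the Gaussian one. In the central range `|u| ≤ δ√n` the expansion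
at the origin applies. In its complement `θ` bounds the characteristic function, two factors of
which are kept for integrability, and the Gaussian is absorbed by `(u / (δ√n))⁴ ≥ 1`. -/
theorem sqrt_mul_norm_charFun_pow_sub_gaussian_le {ρ : Measure ℝ} [IsProbabilityMeasure ρ]
    {κ M δ θ : ℝ} (h4 : Integrable (fun x => x ^ 4) ρ) (m1 : ∫ x, x ∂ρ = 0)
    (m2 : ∫ x, x ^ 2 ∂ρ = 1) (m3 : ∫ x, x ^ 3 ∂ρ = κ) (m4 : ∫ x, x ^ 4 ∂ρ ≤ M)
    (hκ : |κ| ≤ 1) (hM : 0 ≤ M) (hδ0 : 0 < δ) (hδ1 : δ * (1 + 4 * M) ≤ 1 / 4)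
    (hθ0 : 0 ≤ θ) (hθ : ∀ v, δ ≤ |v| → ‖charFun ρ v‖ ≤ θ) {n : ℕ} (hn : 2 ≤ n) (u : ℝ) :
    Real.sqrt n * ‖charFun ρ (u / Real.sqrt n) ^ n - (Real.exp (-u ^ 2 / 2) : ℂ)‖
      ≤ (|κ| * |u| ^ 3 + (4 * M + 1 + (δ ^ 4)⁻¹) * (u ^ 4 / Real.sqrt n)) *
          Real.exp (-(1 / 8) * u ^ 2)
        + Real.sqrt n * θ ^ (n - 2) * ‖charFun ρ (u / Real.sqrt n)‖ ^ 2 := by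
  set N := Real.sqrt n with hN
  have hn' : (2 : ℝ) ≤ n := by exact_mod_cast hn
  have hN2 : N ^ 2 = n := Real.sq_sqrt (by positivity)
  have hN0 : 0 < N := Real.sqrt_pos.2 (by linarith)
  have hN1 : 1 ≤ N := by
    rw [hN]; exact Real.one_le_sqrt.2 (by linarith)
  set v := u / N with hv
  have huv : u = N * v := by rw [hv]; field_simp
  have hv4 : v ^ 4 = |v| ^ 4 := by rw [← abs_pow, abs_of_nonneg (by positivity)]
  rcases le_or_gt |v| δ with hvδ | hvδ
  · -- the difference of `n`-th powers telescopes
    obtain ⟨ha, hab⟩ :=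
      norm_charFun_le_and_sub_gaussian_le h4 m1 m2 m3 m4 hκ hM hδ0 hδ1 hvδ
    set b : ℂ := (Real.exp (-(v ^ 2 / 2)) : ℂ) with hb
    have hbn : ‖b‖ ≤ Real.exp (-(v ^ 2 / 4)) := by
      rw [hb, Complex.norm_real, Real.norm_of_nonneg (Real.exp_pos _).le]
      exact Real.exp_le_exp.2 (by linarith [sq_nonneg v])
    obtain ⟨k, rfl⟩ : ∃ k, n = k + 1 := ⟨n - 1, by omega⟩
    have hpow := norm_pow_sub_pow_le_mul ha hbn k
    have hbn' : b ^ (k + 1) = (Real.exp (-u ^ 2 / 2) : ℂ) := by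
      rw [hb, ← Complex.ofReal_pow, ← Real.exp_nat_mul, huv, mul_pow, hN2]
      congr 2
      push_cast
      ring
    rw [← hbn']
    have hexp : Real.exp (-(v ^ 2 / 4)) ^ k ≤ Real.exp (-(1 / 8) * u ^ 2) := by
      rw [← Real.exp_nat_mul]
      refine Real.exp_le_exp.2 ?_
      rw [huv, mul_pow, hN2]
      push_cast at hn' ⊢
      nlinarith [sq_nonneg v]
    have hk1 : ((k : ℝ) + 1) = N ^ 2 := by rw [hN2]; push_cast; ring
    have hmain : N * ‖charFun ρ v ^ (k + 1) - b ^ (k + 1)‖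
        ≤ (|κ| * |u| ^ 3 + (4 * M + 1) * (u ^ 4 / N)) * Real.exp (-(1 / 8) * u ^ 2) := by
      calc N * ‖charFun ρ v ^ (k + 1) - b ^ (k + 1)‖
          ≤ N * (N ^ 2 * (|κ| * |v| ^ 3 / 6 + (4 * M + 1) * v ^ 4)
              * Real.exp (-(1 / 8) * u ^ 2)) := by
            rw [hk1] at hpow
            gcongr
            exact hpow.trans (by gcongr)
        _ = (|κ| * |u| ^ 3 / 6 + (4 * M + 1) * (u ^ 4 / N)) * Real.exp (-(1 / 8) * u ^ 2) := by
            rw [huv, abs_mul, abs_of_pos hN0]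
            field_simp
        _ ≤ _ := by
            gcongr
            have : 0 ≤ |κ| * |u| ^ 3 := by positivity
            linarith
    have h5 : 0 ≤ (δ ^ 4)⁻¹ * (u ^ 4 / N) * Real.exp (-(1 / 8) * u ^ 2) := by positivity
    have h6 : 0 ≤ N * θ ^ (k + 1 - 2) * ‖charFun ρ v‖ ^ 2 := by positivity
    calc _ ≤ _ := hmain
      _ ≤ (|κ| * |u| ^ 3 + (4 * M + 1) * (u ^ 4 / N)) * Real.exp (-(1 / 8) * u ^ 2)
          + (δ ^ 4)⁻¹ * (u ^ 4 / N) * Real.exp (-(1 / 8) * u ^ 2)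
          + N * θ ^ (k + 1 - 2) * ‖charFun ρ v‖ ^ 2 := by linarith only [h5, h6]
      _ = _ := by ring
  · have h1 : ‖charFun ρ v ^ n‖ ≤ θ ^ (n - 2) * ‖charFun ρ v‖ ^ 2 := by
      rw [norm_pow, show n = (n - 2) + 2 by omega, pow_add, Nat.add_sub_cancel]
      gcongr
      exact hθ v hvδ.le
    have h2 : N * Real.exp (-u ^ 2 / 2)
        ≤ (δ ^ 4)⁻¹ * (u ^ 4 / N) * Real.exp (-(1 / 8) * u ^ 2) := by
      have h3 : Real.exp (-u ^ 2 / 2) ≤ Real.exp (-(1 / 8) * u ^ 2) :=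
        Real.exp_le_exp.2 (by nlinarith [sq_nonneg u])
      have h4 : N ≤ (δ ^ 4)⁻¹ * (u ^ 4 / N) := by
        rw [huv, mul_pow, hv4, inv_mul_eq_div, le_div_iff₀ (by positivity),
          le_div_iff₀ hN0]
        have h5 : δ ^ 4 ≤ |v| ^ 4 := by gcongr
        have h6 : N ^ 2 ≤ N ^ 4 := pow_le_pow_right₀ hN1 (by norm_num)
        calc N * δ ^ 4 * N = N ^ 2 * δ ^ 4 := by ring
          _ ≤ N ^ 4 * |v| ^ 4 := by gcongr
      calc _ ≤ _ := mul_le_mul h4 h3 (Real.exp_pos _).le (by positivity)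
        _ = _ := rfl
    have h3 : ‖charFun ρ v ^ n - (Real.exp (-u ^ 2 / 2) : ℂ)‖
        ≤ θ ^ (n - 2) * ‖charFun ρ v‖ ^ 2 + Real.exp (-u ^ 2 / 2) := by
      refine (norm_sub_le _ _).trans (add_le_add h1 (le_of_eq ?_))
      rw [Complex.norm_real, Real.norm_of_nonneg (Real.exp_pos _).le]
    have h5 : 0 ≤ (|κ| * |u| ^ 3 + (4 * M + 1) * (u ^ 4 / N)) * Real.exp (-(1 / 8) * u ^ 2) := by
      positivity
    calc _ ≤ N * (θ ^ (n - 2) * ‖charFun ρ v‖ ^ 2 + Real.exp (-u ^ 2 / 2)) :=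
          mul_le_mul_of_nonneg_left h3 hN0.le
      _ = N * θ ^ (n - 2) * ‖charFun ρ v‖ ^ 2 + N * Real.exp (-u ^ 2 / 2) := by ring
      _ ≤ N * θ ^ (n - 2) * ‖charFun ρ v‖ ^ 2
          + ((|κ| * |u| ^ 3 + (4 * M + 1) * (u ^ 4 / N)) * Real.exp (-(1 / 8) * u ^ 2)
          + (δ ^ 4)⁻¹ * (u ^ 4 / N) * Real.exp (-(1 / 8) * u ^ 2)) := by
          linarith only [h2, h5]
      _ = _ := by ring

theorem integrable_abs_pow_mul_exp_neg_mul_sq (k : ℕ) {b : ℝ} (hb : 0 < b) :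
    Integrable (fun u : ℝ => |u| ^ k * Real.exp (-b * u ^ 2)) := by
  have h := (integrable_rpow_mul_exp_neg_mul_sq hb (s := k)
    (by have : (0 : ℝ) ≤ k := Nat.cast_nonneg k; linarith)).norm
  refine h.congr (ae_of_all _ fun u => ?_)
  simp [Real.rpow_natCast]

/-- Local Edgeworth expansion of order `o(1/√n)` for a triangular array: if the standardized laws
`ρ n` have vanishing third moments, bounded fourth moments, characteristic functions that stay away
from `1` off the origin and are bounded in `L²`, then the characteristic function of the normalized
sum of `n` independent copies is within `o(1/√n)` of the Gaussian one in `L¹`. -/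
theorem tendsto_sqrt_mul_integral_charFun_pow_sub_gaussian (ρ : ℕ → Measure ℝ)
    [∀ n, IsProbabilityMeasure (ρ n)] {κ : ℕ → ℝ} {M C : ℝ} (hκ : Tendsto κ atTop (𝓝 0))
    (h4 : ∀ᶠ n in atTop, Integrable (fun x => x ^ 4) (ρ n))
    (m1 : ∀ᶠ n in atTop, ∫ x, x ∂(ρ n) = 0) (m2 : ∀ᶠ n in atTop, ∫ x, x ^ 2 ∂(ρ n) = 1)
    (m3 : ∀ᶠ n in atTop, ∫ x, x ^ 3 ∂(ρ n) = κ n) (m4 : ∀ᶠ n in atTop, ∫ x, x ^ 4 ∂(ρ n) ≤ M)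
    (hL2 : ∀ᶠ n in atTop, Integrable (fun v => ‖charFun (ρ n) v‖ ^ 2) ∧
      ∫ v, ‖charFun (ρ n) v‖ ^ 2 ≤ C)
    (htail : ∀ δ : ℝ, 0 < δ → ∃ θ : ℝ, 0 ≤ θ ∧ θ < 1 ∧
      ∀ᶠ n in atTop, ∀ v, δ ≤ |v| → ‖charFun (ρ n) v‖ ≤ θ) :
    (∀ᶠ n : ℕ in atTop, Integrable (fun u : ℝ =>
      charFun (ρ n) (u / Real.sqrt n) ^ n - (Real.exp (-u ^ 2 / 2) : ℂ))) ∧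
    Tendsto (fun n : ℕ => Real.sqrt n * ∫ u : ℝ,
      ‖charFun (ρ n) (u / Real.sqrt n) ^ n - (Real.exp (-u ^ 2 / 2) : ℂ)‖) atTop (𝓝 0) := by
  wlog hM : 0 ≤ M generalizing M
  · exact this (M := max M 0) (m4.mono fun n hn => hn.trans (le_max_left _ _)) (le_max_right _ _)
  obtain ⟨δ, hδ0, hδ1⟩ : ∃ δ : ℝ, 0 < δ ∧ δ * (1 + 4 * M) ≤ 1 / 4 :=
    ⟨1 / (4 * (1 + 4 * M)), by positivity, le_of_eq (by field_simp)⟩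
  obtain ⟨θ, hθ0, hθ1, hθ⟩ := htail δ hδ0
  set A3 := ∫ u : ℝ, |u| ^ 3 * Real.exp (-(1 / 8) * u ^ 2)
  set A4 := ∫ u : ℝ, |u| ^ 4 * Real.exp (-(1 / 8) * u ^ 2)
  set Q := 4 * M + 1 + (δ ^ 4)⁻¹
  have i3 := integrable_abs_pow_mul_exp_neg_mul_sq 3 (b := 1 / 8) (by norm_num)
  have i4 := integrable_abs_pow_mul_exp_neg_mul_sq 4 (b := 1 / 8) (by norm_num)
  have hκ1 : ∀ᶠ n in atTop, |κ n| ≤ 1 := by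
    have := hκ.abs
    rw [abs_zero] at this
    exact this.eventually_le_const one_pos
  have hmain : ∀ᶠ n : ℕ in atTop, Integrable (fun u : ℝ =>
      charFun (ρ n) (u / Real.sqrt n) ^ n - (Real.exp (-u ^ 2 / 2) : ℂ)) ∧
      Real.sqrt n * ∫ u : ℝ,
        ‖charFun (ρ n) (u / Real.sqrt n) ^ n - (Real.exp (-u ^ 2 / 2) : ℂ)‖
      ≤ |κ n| * A3 + Q * A4 * (Real.sqrt n)⁻¹ + n * θ ^ (n - 2) * C := by
    filter_upwards [h4, m1, m2, m3, m4, hL2, hθ, hκ1, eventually_ge_atTop 2]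
      with n h4 m1 m2 m3 m4 hL2 hθ hκ1 hn
    have hN0 : 0 < Real.sqrt n := Real.sqrt_pos.2 (by exact_mod_cast (by omega : 0 < n))
    have hpt := sqrt_mul_norm_charFun_pow_sub_gaussian_le h4 m1 m2 m3 m4 hκ1 hM hδ0 hδ1 hθ0 hθ hn
    have j1 : Integrable (fun u : ℝ => |κ n| * (|u| ^ 3 * Real.exp (-(1 / 8) * u ^ 2))
        + Q * (Real.sqrt n)⁻¹ * (|u| ^ 4 * Real.exp (-(1 / 8) * u ^ 2))) :=
      (i3.const_mul _).add (i4.const_mul _)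
    have j2 : Integrable (fun u : ℝ => Real.sqrt n * θ ^ (n - 2) *
        ‖charFun (ρ n) (u / Real.sqrt n)‖ ^ 2) :=
      ((hL2.1.comp_div hN0.ne').const_mul _)
    have hpt' : ∀ u : ℝ, Real.sqrt n *
        ‖charFun (ρ n) (u / Real.sqrt n) ^ n - (Real.exp (-u ^ 2 / 2) : ℂ)‖
        ≤ (|κ n| * (|u| ^ 3 * Real.exp (-(1 / 8) * u ^ 2))
          + Q * (Real.sqrt n)⁻¹ * (|u| ^ 4 * Real.exp (-(1 / 8) * u ^ 2)))
          + Real.sqrt n * θ ^ (n - 2) * ‖charFun (ρ n) (u / Real.sqrt n)‖ ^ 2 := by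
      intro u
      refine (hpt u).trans (le_of_eq ?_)
      rw [show |u| ^ 4 = u ^ 4 by rw [← abs_pow, abs_of_nonneg (by positivity)]]
      ring
    have hint : Integrable (fun u : ℝ =>
        charFun (ρ n) (u / Real.sqrt n) ^ n - (Real.exp (-u ^ 2 / 2) : ℂ)) := by
      refine ((j1.add j2).const_mul (Real.sqrt n)⁻¹).mono' ?_ (ae_of_all _ fun u => ?_)
      · have := measurable_charFun (μ := ρ n)
        refine Measurable.aestronglyMeasurable ?_
        exact ((this.comp (by fun_prop)).pow_const n).sub (by fun_prop)
      · rw [inv_mul_eq_div, le_div_iff₀ hN0, mul_comm]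
        exact hpt' u
    refine ⟨hint, ?_⟩
    rw [← integral_const_mul]
    refine (integral_mono (hint.norm.const_mul _) (j1.add j2) hpt').trans ?_
    simp only [Pi.add_apply]
    rw [integral_add j1 j2, integral_add (i3.const_mul _) (i4.const_mul _), integral_const_mul,
      integral_const_mul, integral_const_mul,
      Measure.integral_comp_div (fun u => ‖charFun (ρ n) u‖ ^ 2), abs_of_pos hN0, smul_eq_mul]
    have h5 : Real.sqrt n * θ ^ (n - 2) * (Real.sqrt n * ∫ u, ‖charFun (ρ n) u‖ ^ 2)
        ≤ n * θ ^ (n - 2) * C := by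
      calc _ = (Real.sqrt n * Real.sqrt n) * θ ^ (n - 2) * ∫ u, ‖charFun (ρ n) u‖ ^ 2 := by ring
        _ ≤ _ := by
          rw [Real.mul_self_sqrt (Nat.cast_nonneg n)]
          gcongr
          exact hL2.2
    have h6 : Q * (Real.sqrt n)⁻¹ * A4 = Q * A4 * (Real.sqrt n)⁻¹ := by ring
    linarith
  refine ⟨hmain.mono fun n hn => hn.1, ?_⟩
  have hlim : Tendsto (fun n : ℕ => |κ n| * A3 + Q * A4 * (Real.sqrt n)⁻¹ + n * θ ^ (n - 2) * C)
      atTop (𝓝 0) := by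
    have l1 : Tendsto (fun n : ℕ => |κ n| * A3) atTop (𝓝 0) := by
      simpa using hκ.abs.mul_const A3
    have l2 : Tendsto (fun n : ℕ => Q * A4 * (Real.sqrt n)⁻¹) atTop (𝓝 0) := by
      simpa using (tendsto_inv_atTop_zero.comp
        (Real.tendsto_sqrt_atTop.comp tendsto_natCast_atTop_atTop)).const_mul (Q * A4)
    have l3 : Tendsto (fun n : ℕ => (n : ℝ) * θ ^ (n - 2) * C) atTop (𝓝 0) := by
      have h1 := tendsto_self_mul_const_pow_of_lt_one hθ0 hθ1
      have h2 := tendsto_pow_atTop_nhds_zero_of_lt_one hθ0 hθ1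
      have h3 : Tendsto (fun n : ℕ => ((n : ℝ) * θ ^ n + 2 * θ ^ n) * C) atTop (𝓝 0) := by
        simpa using (h1.add (h2.const_mul 2)).mul_const C
      rw [← tendsto_add_atTop_iff_nat 2]
      refine h3.congr fun n => ?_
      push_cast
      ring
    simpa using (l1.add l2).add l3
  refine squeeze_zero' (Eventually.of_forall fun n => by positivity)
    (hmain.mono fun n hn => hn.2) hlim

/-! ### Tilted laws and the tail probability -/

theorem integral_indicator_exp_neg_mul {l : ℝ} (hl : 0 < l) :
    Integrable ((Ici (0 : ℝ)).indicator fun y => Real.exp (-(l * y))) ∧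
      ∫ y, (Ici (0 : ℝ)).indicator (fun y => Real.exp (-(l * y))) y = 1 / l := by
  have h := integrableOn_exp_mul_Ioi (a := -l) (by linarith) 0
  have h' := integral_exp_mul_Ioi (a := -l) (by linarith) 0
  simp only [neg_mul] at h h'
  rw [integrable_indicator_iff measurableSet_Ici, integrableOn_Ici_iff_integrableOn_Ioi,
    integral_indicator measurableSet_Ici, integral_Ici_eq_integral_Ioi, h']
  refine ⟨h, ?_⟩
  rw [mul_zero, neg_zero, Real.exp_zero, neg_div_neg_eq]

theorem integral_indicator_sq_mul_exp_neg_mul {l : ℝ} (hl : 0 < l) :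
    Integrable ((Ici (0 : ℝ)).indicator fun y => y ^ 2 * Real.exp (-(l * y))) ∧
      ∫ y, (Ici (0 : ℝ)).indicator (fun y => y ^ 2 * Real.exp (-(l * y))) y = 2 / l ^ 3 := by
  have h' := Real.integral_rpow_mul_exp_neg_mul_Ioi (a := 3) (r := l) (by norm_num) hl
  have e : ∀ y : ℝ, y ^ ((3 : ℝ) - 1) = y ^ 2 := fun y => by
    rw [show (3 : ℝ) - 1 = (2 : ℕ) by norm_num, Real.rpow_natCast]
  simp only [e] at h'
  have hG : Real.Gamma 3 = 2 := by
    rw [show (3 : ℝ) = (2 : ℕ) + 1 by norm_num, Real.Gamma_nat_eq_factorial]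
    norm_num [Nat.factorial]
  rw [hG, show (1 / l) ^ (3 : ℝ) * 2 = 2 / l ^ 3 by
    rw [show (3 : ℝ) = (3 : ℕ) by norm_num, Real.rpow_natCast]; field_simp] at h'
  rw [integrable_indicator_iff measurableSet_Ici, integrableOn_Ici_iff_integrableOn_Ioi,
    integral_indicator measurableSet_Ici, integral_Ici_eq_integral_Ioi, h']
  refine ⟨?_, rfl⟩
  -- a nonintegrable function would have integral `0`
  by_contra hcon
  have := integral_undef hcon
  rw [h'] at this
  have : 0 < 2 / l ^ 3 := by positivity
  linarith

/-- The Laplace transform of the positive half of the Gaussian density, to relative order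
`O(l⁻²)`. -/
theorem gaussian_laplace_bounds {l : ℝ} (hl : 0 < l) :
    (Real.sqrt (2 * Real.pi))⁻¹ * (1 / l - 1 / l ^ 3)
      ≤ ∫ y, (Ici (0 : ℝ)).indicator (fun y => Real.exp (-(l * y))) y ∂(gaussianReal 0 1) ∧
    ∫ y, (Ici (0 : ℝ)).indicator (fun y => Real.exp (-(l * y))) y ∂(gaussianReal 0 1)
      ≤ (Real.sqrt (2 * Real.pi))⁻¹ * (1 / l) := by
  obtain ⟨i0, e0⟩ := integral_indicator_exp_neg_mul hl
  obtain ⟨i2, e2⟩ := integral_indicator_sq_mul_exp_neg_mul hl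
  set F := (Ici (0 : ℝ)).indicator fun y => Real.exp (-(l * y)) with hF
  have hF0 : ∀ y, 0 ≤ F y := fun y => indicator_nonneg (fun _ _ => (Real.exp_pos _).le) y
  have hG : ∀ y, (Ici (0 : ℝ)).indicator (fun y => y ^ 2 * Real.exp (-(l * y))) y
      = y ^ 2 * F y := by
    intro y
    by_cases hy : y ∈ Ici (0 : ℝ) <;> simp [hF, hy]
  have e2' : ∫ y, y ^ 2 * F y = 2 / l ^ 3 := by
    rw [← e2]; exact integral_congr_ae (ae_of_all _ fun y => (hG y).symm)
  have i2' : Integrable fun y => y ^ 2 * F y := i2.congr (ae_of_all _ hG)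
  have hpdf : ∀ y, gaussianPDFReal 0 1 y
      = (Real.sqrt (2 * Real.pi))⁻¹ * Real.exp (-(y ^ 2 / 2)) := by
    intro y
    simp [gaussianPDFReal, neg_div]
  rw [integral_gaussianReal_eq_integral_smul one_ne_zero]
  simp_rw [hpdf, smul_eq_mul, mul_assoc]
  rw [integral_const_mul]
  have hi : Integrable fun y => Real.exp (-(y ^ 2 / 2)) * F y := by
    refine i0.bdd_mul (c := 1) (by fun_prop) (ae_of_all _ fun y => ?_)
    rw [Real.norm_of_nonneg (Real.exp_pos _).le, Real.exp_le_one_iff]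
    linarith [sq_nonneg y]
  constructor
  · refine mul_le_mul_of_nonneg_left ?_ (by positivity)
    have : 1 / l - 1 / l ^ 3 = ∫ y, (F y - 1 / 2 * (y ^ 2 * F y)) := by
      rw [integral_sub i0 (i2'.const_mul _), integral_const_mul, e0, e2']
      ring
    rw [this]
    refine integral_mono (i0.sub (i2'.const_mul _)) hi fun y => ?_
    -- the lower bound comes from `exp (-y²/2) ≥ 1 - y²/2`
    have := Real.add_one_le_exp (-(y ^ 2 / 2))
    dsimp only
    nlinarith [hF0 y]
  · refine mul_le_mul_of_nonneg_left ?_ (by positivity)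
    rw [← e0]
    refine integral_mono hi i0 fun y => ?_
    have : Real.exp (-(y ^ 2 / 2)) ≤ 1 := Real.exp_le_one_iff.2 (by linarith [sq_nonneg y])
    dsimp only
    nlinarith [hF0 y]

/-- A law whose characteristic function is `L¹`-close to the Gaussian one has nearly the same
one-sided Laplace transform as the Gaussian, with an error that keeps the factor `1 / l`. -/
theorem abs_laplace_sub_one_le {μ : Measure ℝ} [IsProbabilityMeasure μ] {l : ℝ} (hl : 0 < l)
    (hint : Integrable fun u : ℝ => charFun μ u - (Real.exp (-u ^ 2 / 2) : ℂ)) :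
    |Real.sqrt (2 * Real.pi) * l *
        ∫ y, (Ici (0 : ℝ)).indicator (fun y => Real.exp (-(l * y))) y ∂μ - 1|
      ≤ 1 / l ^ 2 + ∫ u : ℝ, ‖charFun μ u - (Real.exp (-u ^ 2 / 2) : ℂ)‖ := by
  have hcf : ∀ u : ℝ, charFun (gaussianReal 0 1) u = (Real.exp (-u ^ 2 / 2) : ℂ) := by
    intro u
    rw [charFun_gaussianReal]
    push_cast
    congr 1
    simp [neg_div]
  simp_rw [← hcf] at hint ⊢
  set γ := gaussianReal 0 1
  set J := ∫ u : ℝ, ‖charFun μ u - charFun γ u‖ with hJ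
  have hJ0 : 0 ≤ J := by positivity
  have h1 := measure_le_add_of_charFun μ γ hint
  have hint' : Integrable fun u : ℝ => charFun γ u - charFun μ u := by
    simpa [Pi.neg_def] using hint.neg
  have h2 := measure_le_add_of_charFun γ μ hint'
  rw [show ∫ u : ℝ, ‖charFun γ u - charFun μ u‖ = J by simp_rw [hJ, norm_sub_rev]] at h2
  obtain ⟨i0, e0⟩ := integral_indicator_exp_neg_mul hl
  obtain ⟨g1, g2⟩ := gaussian_laplace_bounds hl
  set F := (Ici (0 : ℝ)).indicator fun y => Real.exp (-(l * y)) with hF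
  have hFm : Measurable F := (by fun_prop : Measurable fun y => Real.exp (-(l * y))).indicator
    measurableSet_Ici
  have hF0 : ∀ y, 0 ≤ F y := fun y => indicator_nonneg (fun _ _ => (Real.exp_pos _).le) y
  have hF1 : ∀ y, F y ≤ 1 := by
    intro y
    refine indicator_le' (fun y hy => ?_) (fun _ _ => zero_le_one) y
    exact Real.exp_le_one_iff.2 (by have := mul_nonneg hl.le hy; linarith)
  have hFi : ∀ (m : Measure ℝ) [IsProbabilityMeasure m], Integrable F m := fun m _ =>
    Integrable.of_bound hFm.aestronglyMeasurable 1 (ae_of_all _ fun y => by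
      rw [Real.norm_of_nonneg (hF0 y)]; exact hF1 y)
  have hcmp : ∀ (m m' : Measure ℝ) [IsProbabilityMeasure m] [IsProbabilityMeasure m'],
      m ≤ m' + ENNReal.ofReal ((2 * Real.pi)⁻¹ * J) • volume →
      ∫ y, F y ∂m ≤ ∫ y, F y ∂m' + (2 * Real.pi)⁻¹ * J * (1 / l) := by
    intro m m' _ _ hle
    refine (integral_mono_measure hle (ae_of_all _ hF0)
      ((hFi m').add_measure (i0.smul_measure (by simp)))).trans (le_of_eq ?_)
    rw [integral_add_measure (hFi m') (i0.smul_measure (by simp)), integral_smul_measure,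
      ENNReal.toReal_ofReal (by positivity), e0, smul_eq_mul]
  have c1 := hcmp μ γ h1
  have c2 := hcmp γ μ h2
  set A := ∫ y, F y ∂μ
  set B := ∫ y, F y ∂γ
  set S := Real.sqrt (2 * Real.pi) with hS
  have hpi : 2 ≤ Real.pi := Real.two_le_pi
  have hS2 : S ^ 2 = 2 * Real.pi := Real.sq_sqrt (by positivity)
  have hS0 : 0 < S := Real.sqrt_pos.2 (by positivity)
  have hS1 : 1 ≤ S := by
    rw [hS]; exact Real.one_le_sqrt.2 (by linarith)
  have hSinv : S * ((2 * Real.pi)⁻¹ * J) ≤ J := by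
    rw [← hS2, sq, mul_inv, ← mul_assoc, ← mul_assoc, mul_inv_cancel₀ hS0.ne', one_mul]
    exact mul_le_of_le_one_left hJ0 (inv_le_one_of_one_le₀ hS1)
  have up : S * l * A ≤ 1 + J := by
    calc S * l * A ≤ S * l * (S⁻¹ * (1 / l) + (2 * Real.pi)⁻¹ * J * (1 / l)) := by
          gcongr; linarith
      _ = 1 + S * ((2 * Real.pi)⁻¹ * J) := by field_simp
      _ ≤ 1 + J := by linarith
  have lo : 1 - 1 / l ^ 2 - J ≤ S * l * A := by
    calc 1 - 1 / l ^ 2 - J ≤ 1 - 1 / l ^ 2 - S * ((2 * Real.pi)⁻¹ * J) := by linarith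
      _ = S * l * (S⁻¹ * (1 / l - 1 / l ^ 3) - (2 * Real.pi)⁻¹ * J * (1 / l)) := by field_simp
      _ ≤ S * l * A := by gcongr; linarith
  have hl2 : 0 ≤ 1 / l ^ 2 := by positivity
  rw [abs_le]
  constructor <;> linarith

section TiltedLaw

variable {Ω : Type*} [MeasurableSpace Ω]

/-- The law of `(X - m) / s` under the exponentially tilted measure `exp (tX) P / E exp (tX)`. -/
noncomputable def tiltedLaw (P : Measure Ω) (X : Ω → ℝ) (t m s : ℝ) : Measure ℝ :=
  (P.tilted (t * X ·)).map fun ω => (X ω - m) / s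

theorem isProbabilityMeasure_tiltedLaw {P : Measure Ω} [IsProbabilityMeasure P] {X : Ω → ℝ}
    (hX : Measurable X) {t : ℝ} (ht : Integrable (fun ω => Real.exp (t * X ω)) P) (m s : ℝ) :
    IsProbabilityMeasure (tiltedLaw P X t m s) := by
  have := isProbabilityMeasure_tilted ht
  exact Measure.isProbabilityMeasure_map (by fun_prop)

theorem integral_tiltedLaw {E : Type*} [NormedAddCommGroup E] [NormedSpace ℝ E] {P : Measure Ω}
    {X : Ω → ℝ} (hX : Measurable X) (t m s : ℝ) {F : ℝ → E} (hF : StronglyMeasurable F) :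
    ∫ y, F y ∂(tiltedLaw P X t m s)
      = ∫ ω, (Real.exp (t * X ω) / mgf X P t) • F ((X ω - m) / s) ∂P := by
  rw [tiltedLaw, integral_map (by fun_prop) hF.aestronglyMeasurable, integral_tilted_mul_eq_mgf]

/-- The tilted law of a sum of `n` independent copies, normalized by `s√n`, has characteristic
function `χ (u / √n) ^ n`, where `χ` is that of the tilted law of one summand, normalized by `s`. -/
theorem charFun_tiltedLaw_sum {P : Measure Ω} [IsProbabilityMeasure P] {X : ℕ → Ω → ℝ}
    (hX : ∀ i, Measurable (X i)) (hindep : iIndepFun X P) (hlaw : ∀ i, P.map (X i) = P.map (X 0))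
    (t m s : ℝ) (n : ℕ) (u : ℝ) :
    charFun (tiltedLaw P (fun ω => ∑ i ∈ Finset.range n, X i ω) t (n * m) (s * Real.sqrt n)) u
      = charFun (tiltedLaw P (X 0) t m s) (u / Real.sqrt n) ^ n := by
  have hSm : Measurable fun ω => ∑ i ∈ Finset.range n, X i ω := by fun_prop
  have hmgf1 : ∀ i, mgf (X i) P t = mgf (X 0) P t := by
    intro i
    rw [← mgf_id_map (hX i).aemeasurable, hlaw i, mgf_id_map (hX 0).aemeasurable]
  have hmgf : mgf (fun ω => ∑ i ∈ Finset.range n, X i ω) P t = mgf (X 0) P t ^ n := by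
    have := hindep.mgf_sum hX (Finset.range n) (t := t)
    simp only [Finset.sum_fn, hmgf1, Finset.prod_const, Finset.card_range] at this
    simpa using this
  set f : ℝ → ℂ := fun x => ((Real.exp (t * x) / mgf (X 0) P t : ℝ) : ℂ) *
    Complex.exp ((u / Real.sqrt n : ℝ) * ((x - m) / s : ℝ) * Complex.I) with hf
  have hfm : Measurable f := by fun_prop
  have h1 : charFun (tiltedLaw P (X 0) t m s) (u / Real.sqrt n) = ∫ ω, f (X 0 ω) ∂P := by
    rw [charFun_apply_real, integral_tiltedLaw (hX 0) t m s
      (Measurable.stronglyMeasurable (by fun_prop))]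
    rfl
  have h2 : ∀ i, ∫ ω, f (X i ω) ∂P = ∫ ω, f (X 0 ω) ∂P := by
    intro i
    rw [← integral_map (hX i).aemeasurable hfm.aestronglyMeasurable, hlaw i,
      integral_map (hX 0).aemeasurable hfm.aestronglyMeasurable]
  have h3 : ∫ ω, ∏ i ∈ Finset.range n, f (X i ω) ∂P = (∫ ω, f (X 0 ω) ∂P) ^ n := by
    have h := (hindep.precomp (g := fun i : Fin n => (i : ℕ)) Fin.val_injective)
    have h' := h.integral_fun_prod_comp (f := fun _ => f) (fun i => (hX i).aemeasurable)
      (fun i => hfm.aestronglyMeasurable)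
    simp only [h2, Finset.prod_const, Finset.card_univ, Fintype.card_fin] at h'
    rw [← h']
    congr 1
    ext ω
    exact Finset.prod_range fun i => f (X i ω)
  rw [h1, ← h3, charFun_apply_real, integral_tiltedLaw hSm t _ _
      (Measurable.stronglyMeasurable (by fun_prop)), hmgf]
  congr 1
  ext ω
  rw [hf, Finset.prod_mul_distrib, ← Complex.exp_sum, ← Complex.ofReal_prod,
    Finset.prod_div_distrib, ← Real.exp_sum, ← Finset.mul_sum,
    Finset.prod_const, Finset.card_range, Complex.real_smul]
  congr 2
  rw [← Finset.sum_mul, ← Finset.mul_sum, ← Complex.ofReal_sum, ← Finset.sum_div,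
    Finset.sum_sub_distrib, Finset.sum_const, Finset.card_range, nsmul_eq_mul]
  push_cast
  congr 1
  rw [div_mul_div_comm, mul_div_assoc', mul_comm (Real.sqrt n : ℂ)]

/-- Exponential change of measure: an upper tail probability at the tilted mean `m`
is an exponential prefactor times a one-sided Laplace transform of the normalized tilted law. -/
theorem measureReal_le_eq_laplace {P : Measure Ω} [IsProbabilityMeasure P] {S : Ω → ℝ}
    (hS : Measurable S) {t m σ : ℝ} (ht : Integrable (fun ω => Real.exp (t * S ω)) P) (hσ : 0 < σ) :
    P.real {ω | m ≤ S ω} = mgf S P t * Real.exp (-(t * m)) *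
      ∫ y, (Ici (0 : ℝ)).indicator (fun y => Real.exp (-(t * σ * y))) y ∂(tiltedLaw P S t m σ) := by
  have hm : 0 < mgf S P t := mgf_pos ht
  have hset : MeasurableSet {ω | m ≤ S ω} := measurableSet_le measurable_const hS
  rw [integral_tiltedLaw hS t m σ (Measurable.stronglyMeasurable
    (Measurable.indicator (by fun_prop) measurableSet_Ici)), ← integral_const_mul,
    ← integral_indicator_one hset]
  congr 1
  ext ω
  have hiff : 0 ≤ (S ω - m) / σ ↔ m ≤ S ω := by
    rw [le_div_iff₀ hσ, zero_mul, sub_nonneg]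
  by_cases hω : m ≤ S ω
  · rw [indicator_of_mem (by exact hω), indicator_of_mem (by exact hiff.2 hω), smul_eq_mul,
      show t * σ * ((S ω - m) / σ) = t * S ω - t * m by field_simp, neg_sub, Real.exp_sub,
      Real.exp_neg]
    field_simp
    simp
  · rw [indicator_of_notMem (by exact hω), indicator_of_notMem (by exact fun h => hω (hiff.1 h)),
      smul_zero, mul_zero]

/-- The upper tail of a sum of a fixed number of independent copies, relative to its exponential
approximation at the tilt `t`. The error is that of the one-sided Laplace transform at `t s √n`. -/
theorem abs_tail_ratio_sub_one_le {P : Measure Ω} [IsProbabilityMeasure P] {X : ℕ → Ω → ℝ}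
    (hX : ∀ i, Measurable (X i)) (hindep : iIndepFun X P) (hlaw : ∀ i, P.map (X i) = P.map (X 0))
    {t m s : ℝ} (hint : Integrable (fun ω => Real.exp (t * X 0 ω)) P) (ht : 0 < t) (hs : 0 < s)
    {n : ℕ} (hn : 0 < n)
    (hcf : Integrable fun u : ℝ => charFun (tiltedLaw P (X 0) t m s) (u / Real.sqrt n) ^ n
      - (Real.exp (-u ^ 2 / 2) : ℂ)) :
    |P.real {ω | n * m ≤ ∑ i ∈ Finset.range n, X i ω} /
        (Real.exp (-n * (m * t - cgf (X 0) P t)) /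
          (Real.sqrt (2 * Real.pi) * Real.sqrt n * t * s)) - 1|
      ≤ 1 / (t * (s * Real.sqrt n)) ^ 2 +
        ∫ u : ℝ, ‖charFun (tiltedLaw P (X 0) t m s) (u / Real.sqrt n) ^ n
          - (Real.exp (-u ^ 2 / 2) : ℂ)‖ := by
  have hN : 0 < Real.sqrt n := Real.sqrt_pos.2 (by exact_mod_cast hn)
  have hSm : Measurable fun ω => ∑ i ∈ Finset.range n, X i ω := by fun_prop
  have hident : ∀ i, Integrable (fun ω => Real.exp (t * X i ω)) P := by
    intro i
    have hm : Measurable fun x => Real.exp (t * x) := by fun_prop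
    have h1 := (integrable_map_measure (f := X 0) (μ := P) hm.aestronglyMeasurable
      (hX 0).aemeasurable).2 hint
    rw [← hlaw i] at h1
    exact (integrable_map_measure hm.aestronglyMeasurable (hX i).aemeasurable).1 h1
  have hSint : Integrable (fun ω => Real.exp (t * ∑ i ∈ Finset.range n, X i ω)) P := by
    have := hindep.integrable_exp_mul_sum hX (s := Finset.range n) (fun i _ => hident i)
    simpa [Finset.sum_fn] using this
  have hmgf1 : ∀ i, mgf (X i) P t = mgf (X 0) P t := by
    intro i
    rw [← mgf_id_map (hX i).aemeasurable, hlaw i, mgf_id_map (hX 0).aemeasurable]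
  have hmgf : mgf (fun ω => ∑ i ∈ Finset.range n, X i ω) P t = mgf (X 0) P t ^ n := by
    have := hindep.mgf_sum hX (Finset.range n) (t := t)
    simp only [Finset.sum_fn, hmgf1, Finset.prod_const, Finset.card_range] at this
    simpa using this
  have hpre : mgf (X 0) P t ^ n * Real.exp (-(t * (n * m)))
      = Real.exp (-n * (m * t - cgf (X 0) P t)) := by
    rw [← exp_cgf hint, ← Real.exp_nat_mul, ← Real.exp_add]
    congr 1
    ring
  have := isProbabilityMeasure_tiltedLaw hSm hSint (n * m) (s * Real.sqrt n)
  have hl : 0 < t * (s * Real.sqrt n) := by positivity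
  have hcs := charFun_tiltedLaw_sum hX hindep hlaw t m s n
  have hmain := abs_laplace_sub_one_le
    (μ := tiltedLaw P (fun ω => ∑ i ∈ Finset.range n, X i ω) t (n * m) (s * Real.sqrt n)) hl
    (by simpa only [hcs] using hcf)
  simp only [hcs] at hmain
  rw [measureReal_le_eq_laplace hSm hSint (σ := s * Real.sqrt n) (by positivity), hmgf, hpre]
  refine le_trans (le_of_eq ?_) hmain
  congr 2
  have := Real.exp_pos (-n * (m * t - cgf (X 0) P t))
  field_simp

end TiltedLaw

/-! ### Regular exponents -/

/-- Regularity at infinity of an exponent `g` with derivative `h`, on the half-line `(K, ∞)`.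
The function `r = h / h'` is the distance over which `h` roughly grows by a factor `e`; the second
derivative of `g` is `h / r`. Lipschitz continuity of `r` makes `h'` self-neglecting at its own
Gaussian scale `(r / h)^{1/2}`; the last two limits say that this scale is negligible with respect
to `r` and to `x`. -/
structure RegularExponent (g h r : ℝ → ℝ) (K : ℝ) : Prop where
  K_pos : 0 < K
  deriv_g : ∀ x, K < x → HasDerivAt g (h x) x
  deriv_h : ∀ x, K < x → HasDerivAt h (h x / r x) x
  h_pos : ∀ x, K < x → 0 < h x
  r_pos : ∀ x, K < x → 0 < r x
  lip : ∃ C : ℝ, ∀ x y, K < x → K < y → |r x - r y| ≤ C * |x - y|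
  h_top : Tendsto h atTop atTop
  hr_top : Tendsto (fun x => h x * r x) atTop atTop
  sq_top : Tendsto (fun x => x ^ 2 * (h x / r x)) atTop atTop

namespace RegularExponent

/-- The width `(h')^{-1/2}` of the Gaussian peak of `exp (h(x) y - g(y))` at its mode `y = x`. -/
noncomputable def width (h r : ℝ → ℝ) (x : ℝ) : ℝ := Real.sqrt (r x / h x)

/-- The drop of the exponent `y ↦ h(x) y - g(y)` from its mode `x` to `x + z · width`. -/
noncomputable def drop (g h r : ℝ → ℝ) (x z : ℝ) : ℝ :=
  g (x + width h r x * z) - g x - h x * (width h r x * z)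

variable {g h r : ℝ → ℝ} {K : ℝ}

theorem strictMonoOn (R : RegularExponent g h r K) : StrictMonoOn h (Ioi K) := by
  refine strictMonoOn_of_deriv_pos (convex_Ioi K)
    (fun x hx => (R.deriv_h x hx).continuousAt.continuousWithinAt) fun x hx => ?_
  rw [interior_Ioi] at hx
  rw [(R.deriv_h x hx).deriv]
  exact div_pos (R.h_pos x hx) (R.r_pos x hx)

theorem width_pos (R : RegularExponent g h r K) {x : ℝ} (hx : K < x) : 0 < width h r x :=
  Real.sqrt_pos.2 (div_pos (R.r_pos x hx) (R.h_pos x hx))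

theorem width_sq (R : RegularExponent g h r K) {x : ℝ} (hx : K < x) :
    width h r x ^ 2 = r x / h x :=
  Real.sq_sqrt (div_pos (R.r_pos x hx) (R.h_pos x hx)).le

theorem tendsto_width_div_r (R : RegularExponent g h r K) :
    Tendsto (fun x => width h r x / r x) atTop (𝓝 0) := by
  have h1 := tendsto_inv_atTop_zero.comp (Real.tendsto_sqrt_atTop.comp R.hr_top)
  refine h1.congr' ?_
  filter_upwards [eventually_gt_atTop K] with x hx
  have hh := R.h_pos x hx
  have hr := R.r_pos x hx
  simp only [Function.comp, width]
  rw [Real.sqrt_div hr.le, Real.sqrt_mul hh.le]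
  nth_rewrite 3 [← Real.mul_self_sqrt hr.le]
  field_simp

theorem tendsto_width_div (R : RegularExponent g h r K) :
    Tendsto (fun x => width h r x / x) atTop (𝓝 0) := by
  have h1 := tendsto_inv_atTop_zero.comp (Real.tendsto_sqrt_atTop.comp R.sq_top)
  refine h1.congr' ?_
  filter_upwards [eventually_gt_atTop K] with x hx
  have hx0 : 0 < x := R.K_pos.trans hx
  simp only [Function.comp, width]
  rw [Real.sqrt_mul (by positivity), Real.sqrt_sq hx0.le, mul_inv, ← Real.sqrt_inv, inv_div]
  field_simp

theorem tendsto_add_width_mul (R : RegularExponent g h r K) {y : ℝ → ℝ} {A : ℝ}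
    (hy : ∀ x, |y x| ≤ A) : Tendsto (fun x => x + width h r x * y x) atTop atTop := by
  have h1 : Tendsto (fun x => 1 + width h r x / x * y x) atTop (𝓝 1) := by
    have : Tendsto (fun x => width h r x / x * y x) atTop (𝓝 0) :=
      R.tendsto_width_div.zero_mul_isBoundedUnder_le
        (isBoundedUnder_of ⟨A, fun x => by simpa using hy x⟩)
    simpa using this.const_add 1
  refine (tendsto_id.atTop_mul_pos one_pos h1).congr' ?_
  filter_upwards [eventually_gt_atTop 0] with x hx
  simp only [id]
  field_simp

theorem eventually_lt_add_width_mul (R : RegularExponent g h r K) (A L : ℝ) :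
    ∀ᶠ x in atTop, ∀ z, |z| ≤ A → L < x + width h r x * z := by
  have h1 := R.tendsto_add_width_mul (y := fun _ => -|A|) (A := |A|) (by simp)
  filter_upwards [h1.eventually_gt_atTop L, eventually_gt_atTop K] with x hx hK z hz
  have : -|A| ≤ z := by have := (abs_le.1 hz).1; have := le_abs_self A; linarith
  have := mul_le_mul_of_nonneg_left this (R.width_pos hK).le
  linarith

/-- On the scale of the width, `r` is asymptotically constant, being Lipschitz. -/
theorem tendsto_r_ratio (R : RegularExponent g h r K) {y : ℝ → ℝ} {A : ℝ}
    (hy : ∀ x, |y x| ≤ A) :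
    Tendsto (fun x => r (x + width h r x * y x) / r x) atTop (𝓝 1) := by
  obtain ⟨C, hC⟩ := R.lip
  rw [tendsto_iff_norm_sub_tendsto_zero]
  have hlim : Tendsto (fun x => |C| * A * (width h r x / r x)) atTop (𝓝 0) := by
    simpa using R.tendsto_width_div_r.const_mul (|C| * A)
  refine squeeze_zero' (Eventually.of_forall fun x => norm_nonneg _) ?_ hlim
  filter_upwards [eventually_gt_atTop K, R.eventually_lt_add_width_mul A K] with x hx hx'
  have hr := R.r_pos x hx
  have hw := R.width_pos hx
  rw [div_sub_one hr.ne', norm_div, Real.norm_of_nonneg hr.le, Real.norm_eq_abs,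
    div_le_iff₀ hr]
  have h1 := hC _ _ (hx' _ (hy x)) hx
  rw [add_sub_cancel_left, abs_mul, abs_of_pos hw] at h1
  calc |r (x + width h r x * y x) - r x| ≤ |C| * (width h r x * A) := by
        refine h1.trans ?_
        gcongr
        · exact le_abs_self C
        · exact hy x
    _ = |C| * A * (width h r x / r x) * r x := by field_simp

/-- On the scale of the width, `h` is asymptotically constant: `(log h)' = 1 / r`, and the width is
negligible with respect to `r`. -/
theorem tendsto_h_ratio (R : RegularExponent g h r K) {y : ℝ → ℝ} {A : ℝ}
    (hy : ∀ x, |y x| ≤ A) :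
    Tendsto (fun x => h (x + width h r x * y x) / h x) atTop (𝓝 1) := by
  have hev : ∀ᶠ x in atTop, ∃ y', |y'| ≤ A ∧
      Real.log (h (x + width h r x * y x) / h x)
        = width h r x * y x / r (x + width h r x * y') := by
    filter_upwards [eventually_gt_atTop K, R.eventually_lt_add_width_mul A K] with x hx hx'
    set w := width h r x
    have hin : ∀ s ∈ Icc (0 : ℝ) 1, |s * y x| ≤ A := by
      intro s hs
      rw [abs_mul, abs_of_nonneg hs.1]
      exact (mul_le_of_le_one_left (abs_nonneg _) hs.2).trans (hy x)
    have hd : ∀ s ∈ Icc (0 : ℝ) 1, HasDerivAt (fun s => Real.log (h (x + w * (s * y x))))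
        (w * y x / r (x + w * (s * y x))) s := by
      intro s hs
      have hK := hx' _ (hin s hs)
      have h1 : HasDerivAt (fun s => x + w * (s * y x)) (w * (1 * y x)) s :=
        (((hasDerivAt_id s).mul_const (y x)).const_mul w).const_add x
      have h2 := ((R.deriv_h _ hK).comp s h1).log (R.h_pos _ hK).ne'
      refine h2.congr_deriv ?_
      have key : ∀ a b : ℝ, 0 < a → 0 < b → a / b * (w * (1 * y x)) / a = w * y x / b := by
        intro a b ha hb
        field_simp
      exact key _ _ (R.h_pos _ hK) (R.r_pos _ hK)
    obtain ⟨c, hc, hc'⟩ := exists_hasDerivAt_eq_slope _ _ (zero_lt_one' ℝ)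
      (fun s hs => (hd s hs).continuousAt.continuousWithinAt)
      (fun s hs => hd s (Ioo_subset_Icc_self hs))
    refine ⟨c * y x, hin c (Ioo_subset_Icc_self hc), ?_⟩
    rw [hc', Real.log_div (R.h_pos _ (hx' _ (hy x))).ne' (R.h_pos _ hx).ne']
    simp
  classical
  choose! y' hy' using fun x (hx : ∃ y', |y'| ≤ A ∧
      Real.log (h (x + width h r x * y x) / h x)
        = width h r x * y x / r (x + width h r x * y')) => hx
  have hA : 0 ≤ A := (abs_nonneg _).trans (hy 0)
  -- a globally bounded version of the intermediate points
  set y'' : ℝ → ℝ := fun x => if |y' x| ≤ A then y' x else 0 with hy''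
  have hb : ∀ x, |y'' x| ≤ A := by
    intro x
    by_cases hx : |y' x| ≤ A <;> simp [hy'', hx, hA]
  have hr := (R.tendsto_r_ratio hb).inv₀ one_ne_zero
  have hlog : Tendsto (fun x => Real.log (h (x + width h r x * y x) / h x)) atTop (𝓝 0) := by
    have h1 : Tendsto (fun x => width h r x / r x * (r (x + width h r x * y'' x) / r x)⁻¹ * y x)
        atTop (𝓝 0) := by
      have := R.tendsto_width_div_r.mul hr
      rw [zero_mul] at this
      exact this.zero_mul_isBoundedUnder_le (isBoundedUnder_of ⟨A, fun x => by simpa using hy x⟩)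
    refine h1.congr' ?_
    filter_upwards [hev, eventually_gt_atTop K, R.eventually_lt_add_width_mul A K] with x hx hK hK'
    obtain ⟨e1, e2⟩ := hy' x hx
    rw [e2]
    simp only [hy'', e1, if_true]
    have := R.r_pos x hK
    have := R.r_pos _ (hK' _ e1)
    field_simp
  have hexp := (Real.continuous_exp.tendsto 0).comp hlog
  rw [Real.exp_zero] at hexp
  refine hexp.congr' ?_
  filter_upwards [eventually_gt_atTop K, R.eventually_lt_add_width_mul A K] with x hx hx'
  exact Real.exp_log (div_pos (R.h_pos _ (hx' _ (hy x))) (R.h_pos x hx))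

/-- After rescaling by the width, the exponent has a standard quadratic peak. -/
theorem tendsto_drop (R : RegularExponent g h r K) (z : ℝ) :
    Tendsto (fun x => drop g h r x z) atTop (𝓝 (z ^ 2 / 2)) := by
  have hev : ∀ᶠ x in atTop, ∃ y', |y'| ≤ |z| ∧
      drop g h r x z = z ^ 2 / 2 * (h (x + width h r x * y') / h x *
        (r (x + width h r x * y') / r x)⁻¹) := by
    filter_upwards [eventually_gt_atTop K, R.eventually_lt_add_width_mul |z| K] with x hx hx'
    set w := width h r x with hw
    have hw2 : w ^ 2 = r x / h x := R.width_sq hx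
    have hin : ∀ s ∈ Icc (0 : ℝ) 1, |s * z| ≤ |z| := by
      intro s hs
      rw [abs_mul, abs_of_nonneg hs.1]
      exact mul_le_of_le_one_left (abs_nonneg _) hs.2
    have hlin : ∀ s, HasDerivAt (fun s => x + w * (s * z)) (w * z) s := fun s => by
      simpa using (((hasDerivAt_id s).mul_const z).const_mul w).const_add x
    have hdh : ∀ s ∈ Icc (0 : ℝ) 1, HasDerivAt (fun s => h (x + w * (s * z)))
        (h (x + w * (s * z)) / r (x + w * (s * z)) * (w * z)) s := fun s hs =>
      (R.deriv_h _ (hx' _ (hin s hs))).comp s (hlin s)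
    have hdφ : ∀ s ∈ Icc (0 : ℝ) 1, HasDerivAt
        (fun s => g (x + w * (s * z)) - h x * (w * (s * z)))
        ((h (x + w * (s * z)) - h x) * (w * z)) s := by
      intro s hs
      have h1 := (R.deriv_g _ (hx' _ (hin s hs))).comp s (hlin s)
      have h2 : HasDerivAt (fun s => h x * (w * (s * z))) (h x * (w * z)) s := by
        simpa using (((hasDerivAt_id s).mul_const z).const_mul w).const_mul (h x)
      exact (h1.sub h2).congr_deriv (by ring)
    have hsq : ∀ s : ℝ, HasDerivAt (fun s => s ^ 2) (2 * s) s := fun s => by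
      simpa using hasDerivAt_pow 2 s
    obtain ⟨c, hc, hc'⟩ := exists_ratio_hasDerivAt_eq_ratio_slope _ _ (zero_lt_one' ℝ)
      (fun s hs => (hdφ s hs).continuousAt.continuousWithinAt)
      (fun s hs => hdφ s (Ioo_subset_Icc_self hs)) _ _
      (fun s _ => (hsq s).continuousAt.continuousWithinAt) (fun s _ => hsq s)
    have hsub : ∀ s ∈ Icc (0 : ℝ) c, s ∈ Icc (0 : ℝ) 1 := fun s hs => ⟨hs.1, hs.2.trans hc.2.le⟩
    obtain ⟨d, hd, hd'⟩ := exists_hasDerivAt_eq_slope _ _ hc.1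
      (fun s hs => (hdh s (hsub s hs)).continuousAt.continuousWithinAt)
      (fun s hs => hdh s (hsub s (Ioo_subset_Icc_self hs)))
    have hdin := hin d (hsub d (Ioo_subset_Icc_self hd))
    refine ⟨d * z, hdin, ?_⟩
    have hD : drop g h r x z = g (x + w * (1 * z)) - h x * (w * (1 * z)) -
        (g (x + w * (0 * z)) - h x * (w * (0 * z))) := by
      simp only [drop, ← hw, one_mul, zero_mul, mul_zero, add_zero]
      ring
    rw [← hD] at hc'
    simp only [zero_mul, mul_zero, add_zero, sub_zero] at hd' hc'
    have hc0 := hc.1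
    have hh := R.h_pos x hx
    have hr := R.r_pos x hx
    have hr' := R.r_pos _ (hx' _ hdin)
    have e1 : h (x + w * (c * z)) - h x
        = h (x + w * (d * z)) / r (x + w * (d * z)) * (w * z) * c := by
      rw [hd']; field_simp
    rw [e1] at hc'
    have e2 : drop g h r x z
        = z ^ 2 / 2 * (w ^ 2 * (h (x + w * (d * z)) / r (x + w * (d * z)))) := by
      have : (2 * c) * drop g h r x z = (2 * c) *
          (z ^ 2 / 2 * (w ^ 2 * (h (x + w * (d * z)) / r (x + w * (d * z))))) := by
        linear_combination -hc'
      exact mul_left_cancel₀ (by positivity) this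
    rw [e2, hw2]
    field_simp
  classical
  choose! y' hy' using fun x (hx : ∃ y', |y'| ≤ |z| ∧
      drop g h r x z = z ^ 2 / 2 * (h (x + width h r x * y') / h x *
        (r (x + width h r x * y') / r x)⁻¹)) => hx
  -- a globally bounded version of the intermediate points
  set y'' : ℝ → ℝ := fun x => if |y' x| ≤ |z| then y' x else 0 with hy''
  have hb : ∀ x, |y'' x| ≤ |z| := by
    intro x
    by_cases hx : |y' x| ≤ |z| <;> simp [hy'', hx]
  have hlim := ((R.tendsto_h_ratio hb).mul ((R.tendsto_r_ratio hb).inv₀ one_ne_zero)).const_mul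
    (z ^ 2 / 2)
  rw [inv_one, mul_one, mul_one] at hlim
  refine hlim.congr' ?_
  filter_upwards [hev] with x hx
  obtain ⟨e1, e2⟩ := hy' x hx
  rw [e2]
  simp only [hy'', e1, if_true]

theorem convexOn (R : RegularExponent g h r K) : ConvexOn ℝ (Ioi K) g := by
  refine MonotoneOn.convexOn_of_deriv (convex_Ioi K)
    (fun x hx => (R.deriv_g x hx).continuousAt.continuousWithinAt) ?_ ?_
  · rw [interior_Ioi]
    exact fun x hx => (R.deriv_g x hx).differentiableAt.differentiableWithinAt
  · rw [interior_Ioi]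
    exact R.strictMonoOn.monotoneOn.congr fun x hx => (R.deriv_g x hx).deriv.symm

/-- Away from its peak the exponent drops at least linearly, by convexity. -/
theorem eventually_le_drop (R : RegularExponent g h r K) :
    ∀ᶠ x in atTop, ∀ z, K < x + width h r x * z → (|z| - 1) / 4 ≤ drop g h r x z := by
  have h1 := (R.tendsto_drop 1).eventually_const_le (show (1 / 4 : ℝ) < 1 ^ 2 / 2 by norm_num)
  have h2 := (R.tendsto_drop (-1)).eventually_const_le
    (show (1 / 4 : ℝ) < (-1) ^ 2 / 2 by norm_num)
  -- beyond `|z| = 1`, the bound at `±1` is propagated by convexity along rays from the mode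
  filter_upwards [h1, h2, eventually_gt_atTop K] with x hx1 hx2 hx z hz
  set w := width h r x with hw
  have hw0 : 0 < w := R.width_pos hx
  have hconv : ∀ s ∈ Icc (0 : ℝ) 1, drop g h r x (s * z) ≤ s * drop g h r x z := by
    intro s hs
    have := R.convexOn.2 (mem_Ioi.2 hx) (mem_Ioi.2 hz) (sub_nonneg.2 hs.2) hs.1 (by ring)
    simp only [smul_eq_mul] at this
    rw [show (1 - s) * x + s * (x + w * z) = x + w * (s * z) by ring] at this
    simp only [drop, ← hw]
    linarith
  rcases le_or_gt |z| 1 with hz1 | hz1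
  · -- the tangent line at the mode lies below the convex function `g`
    have htan : 0 ≤ drop g h r x z := by
      have hd : HasDerivAt g (h x) x := R.deriv_g x hx
      have hle : ∀ y ∈ Ioi K, g x + h x * (y - x) ≤ g y := by
        intro y hy
        rcases lt_trichotomy x y with hxy | hxy | hxy
        · have := R.convexOn.le_slope_of_hasDerivAt (mem_Ioi.2 hx) hy hxy hd
          rw [slope_def_field, le_div_iff₀ (sub_pos.2 hxy)] at this
          linarith
        · simp [hxy]
        · have := R.convexOn.slope_le_of_hasDerivAt hy (mem_Ioi.2 hx) hxy hd
          rw [slope_def_field, div_le_iff₀ (sub_pos.2 hxy)] at this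
          linarith
      have := hle _ hz
      simp only [drop, ← hw]
      linarith
    linarith
  · have hz0 : 0 < |z| := by linarith
    have h3 := hconv |z|⁻¹ ⟨by positivity, inv_le_one_of_one_le₀ hz1.le⟩
    have h4 : 1 / 4 ≤ drop g h r x (|z|⁻¹ * z) := by
      rcases le_or_gt 0 z with hs | hs
      · rw [abs_of_nonneg hs] at hz0 ⊢
        rwa [inv_mul_cancel₀ hz0.ne']
      · rw [abs_of_neg hs] at hz0 ⊢
        rw [inv_neg, neg_mul, inv_mul_cancel₀ hs.ne]
        exact hx2
    have h5 : 1 / 4 ≤ |z|⁻¹ * drop g h r x z := h4.trans h3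
    rw [inv_mul_eq_div, le_div_iff₀ hz0] at h5
    linarith

/-- The derivative `h` takes every large value `t`, at a point `x t` that tends to infinity with
`t`: the mode of `exp (t y - g(y))`. -/
theorem exists_mode (R : RegularExponent g h r K) :
    ∃ x : ℝ → ℝ, Tendsto x atTop atTop ∧ ∀ᶠ t in atTop, h (x t) = t := by
  have hex : ∀ t, h (K + 1) ≤ t → ∃ x, K + 1 ≤ x ∧ h x = t := by
    intro t ht
    obtain ⟨y, hy1, hy2⟩ := ((R.h_top.eventually_ge_atTop t).and
      (eventually_ge_atTop (K + 1))).exists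
    have hc : ContinuousOn h (Icc (K + 1) y) := fun x hx =>
      (R.deriv_h x (by linarith [hx.1])).continuousAt.continuousWithinAt
    obtain ⟨x, hx, hx'⟩ := intermediate_value_Icc hy2 hc ⟨ht, hy1⟩
    exact ⟨x, hx.1, hx'⟩
  choose! x hx using hex
  refine ⟨x, tendsto_atTop.2 fun b => ?_, ?_⟩
  · filter_upwards [eventually_ge_atTop (h (K + 1)), eventually_ge_atTop (h (max b (K + 1)))]
      with t ht ht'
    obtain ⟨h1, h2⟩ := hx t ht
    rw [← h2] at ht'
    have h3 : max b (K + 1) ∈ Ioi K := (lt_add_one K).trans_le (le_max_right _ _)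
    have h4 : x t ∈ Ioi K := (lt_add_one K).trans_le h1
    exact (le_max_left _ _).trans ((R.strictMonoOn.le_iff_le h3 h4).1 ht')
  · filter_upwards [eventually_ge_atTop (h (K + 1))] with t ht
    exact (hx t ht).2

end RegularExponent

/-! ### Regularly and rapidly varying derivatives -/

theorem IsR0Rep.hasDerivAt {l ε : ℝ → ℝ} (H : IsR0Rep l ε) {x : ℝ} (hx : 1 < x) :
    HasDerivAt l (l x * (ε x / x)) x := by
  have hc : ContinuousOn (fun u => ε u / u) (Ici 1) :=
    H.cont.div continuousOn_id fun u hu => (zero_lt_one.trans_le (mem_Ici.1 hu)).ne'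
  have hcx : ContinuousAt (fun u => ε u / u) x := hc.continuousAt (Ici_mem_nhds hx)
  have hsub : uIcc 1 x ⊆ Ici 1 := by
    rw [uIcc_of_le hx.le]; exact Icc_subset_Ici_self
  have hm : StronglyMeasurableAtFilter (fun u => ε u / u) (𝓝 x) volume :=
    (hc.mono Ioi_subset_Ici_self).stronglyMeasurableAtFilter isOpen_Ioi x hx
  have h1 := (intervalIntegral.integral_hasDerivAt_right
    (hc.mono hsub).intervalIntegrable hm hcx).exp
  rw [← H.repr x hx.le] at h1
  refine h1.congr_of_eventuallyEq ?_
  filter_upwards [Ioi_mem_nhds hx] with y hy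
  exact H.repr y (le_of_lt hy)

theorem IsR0Rep.pos {l ε : ℝ → ℝ} (H : IsR0Rep l ε) {x : ℝ} (hx : 1 ≤ x) : 0 < l x := by
  rw [H.repr x hx]; exact Real.exp_pos _

/-- An increasing derivative of a superlinear function is unbounded. -/
theorem tendsto_atTop_of_monotoneOn_deriv {g h : ℝ → ℝ} {K : ℝ} (hK : 0 ≤ K)
    (hd : ∀ x, K < x → HasDerivAt g (h x) x) (hm : MonotoneOn h (Ioi K))
    (hg : Tendsto (fun x => g x / x) atTop atTop) : Tendsto h atTop atTop := by
  have hex : ∀ B : ℝ, 0 ≤ B → ∃ x, K < x ∧ B ≤ h x := by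
    intro B hB
    by_contra! hcon
    obtain ⟨x, hx1, hx2⟩ := ((hg.eventually_gt_atTop (|g (K + 1)| + B)).and
      (eventually_ge_atTop (K + 1))).exists
    have hx0 : 1 ≤ x := by linarith
    have h1 : g x - g (K + 1) ≤ B * (x - (K + 1)) := by
      refine Convex.image_sub_le_mul_sub_of_deriv_le (convex_Ioi K)
        (fun y hy => (hd y hy).continuousAt.continuousWithinAt)
        (fun y hy => ?_) (fun y hy => ?_) _ (lt_add_one K) _
        ((lt_add_one K).trans_le hx2) hx2
      · rw [interior_Ioi] at hy
        exact (hd y hy).differentiableAt.differentiableWithinAt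
      · rw [interior_Ioi] at hy
        rw [(hd y hy).deriv]
        exact (hcon y hy).le
    rw [lt_div_iff₀ (by linarith)] at hx1
    have h2 := le_abs_self (g (K + 1))
    have h3 : |g (K + 1)| ≤ |g (K + 1)| * x := le_mul_of_one_le_right (abs_nonneg _) hx0
    have h4 : 0 ≤ B * (K + 1) := by positivity
    linarith
  refine tendsto_atTop.2 fun b => ?_
  obtain ⟨x, hx, hb⟩ := hex |b| (abs_nonneg b)
  filter_upwards [eventually_ge_atTop x] with y hy
  exact (le_abs_self b).trans (hb.trans (hm hx (hx.trans_le hy) hy))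

theorem abs_sub_le_of_forall_hasDerivAt {r r' : ℝ → ℝ} {K C : ℝ}
    (hd : ∀ x, K < x → HasDerivAt r (r' x) x) (hb : ∀ x, K < x → |r' x| ≤ C) :
    ∀ x y, K < x → K < y → |r x - r y| ≤ C * |x - y| := fun _ _ hx hy =>
  (convex_Ioi K).norm_image_sub_le_of_norm_hasDerivWithin_le
    (fun z hz => (hd z hz).hasDerivWithinAt) (fun z hz => hb z hz) hy hx

/-- Regularly varying case: with `h(x) = x ^ β l(x)` one has `h / h' = x / (β + ε(x))`. -/
theorem MemRBeta.regularExponent {g : ℝ → ℝ} {β : ℝ} (H : MemRBeta β (deriv g))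
    (hg : ∀ x, 0 < x → DifferentiableAt ℝ g x)
    (hlim : Tendsto (fun x => g x / x) atTop atTop) :
    ∃ r K, RegularExponent g (deriv g) r K := by
  obtain ⟨hβ, l, ε, hl, hε1, -, heq⟩ := H
  set h := deriv g with hh
  obtain ⟨C, hC⟩ := hε1
  rw [eventually_map] at hC
  have hε0 : ∀ᶠ x in atTop, |ε x| ≤ β / 2 := by
    have := hl.tendsto_zero.abs
    rw [abs_zero] at this
    exact this.eventually_le_const (by positivity)
  obtain ⟨K₀, hK₀⟩ := eventually_atTop.1 ((hC.and hε0).and heq)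
  set K := max K₀ 1
  have hK1 : ∀ x, K < x → 1 < x := fun x hx => (le_max_right _ _).trans_lt hx
  have hK : ∀ x, K < x → (x * |deriv ε x| ≤ C ∧ |ε x| ≤ β / 2) ∧ h x = x ^ β * l x :=
    fun x hx => hK₀ x ((le_max_left _ _).trans hx.le)
  have hb : ∀ x, K < x → β / 2 ≤ β + ε x ∧ β + ε x ≤ 2 * β := fun x hx => by
    have := abs_le.1 (hK x hx).1.2
    constructor <;> linarith
  have hpos : ∀ x, K < x → 0 < h x := fun x hx => by
    rw [(hK x hx).2]
    have := hK1 x hx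
    exact mul_pos (Real.rpow_pos_of_pos (by linarith) _) (hl.pos this.le)
  have hrpos : ∀ x, K < x → 0 < x / (β + ε x) := fun x hx =>
    div_pos (by linarith [hK1 x hx]) (by linarith [(hb x hx).1])
  have hdg : ∀ x, K < x → HasDerivAt g (h x) x := fun x hx =>
    (hg x (by linarith [hK1 x hx])).hasDerivAt
  have hdh : ∀ x, K < x → HasDerivAt h (h x / (x / (β + ε x))) x := by
    intro x hx
    have hx1 := hK1 x hx
    have hx0 : 0 < x := by linarith
    have h1 := (Real.hasDerivAt_rpow_const (p := β) (Or.inl hx0.ne')).mul (hl.hasDerivAt hx1)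
    have h2 : h =ᶠ[𝓝 x] fun y => y ^ β * l y := by
      filter_upwards [Ioi_mem_nhds hx] with y hy using (hK y hy).2
    refine (h1.congr_of_eventuallyEq h2).congr_deriv ?_
    rw [(hK x hx).2, Real.rpow_sub_one hx0.ne', div_div_eq_mul_div]
    ring
  have hmono : MonotoneOn h (Ioi K) := by
    refine monotoneOn_of_deriv_nonneg (convex_Ioi K)
      (fun x hx => (hdh x hx).continuousAt.continuousWithinAt) (fun x hx => ?_) fun x hx => ?_
    · rw [interior_Ioi] at hx
      exact (hdh x hx).differentiableAt.differentiableWithinAt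
    · rw [interior_Ioi] at hx
      rw [(hdh x hx).deriv]
      exact (div_pos (hpos x hx) (hrpos x hx)).le
  have hKpos : 0 < K := zero_lt_one.trans_le (le_max_right _ _)
  have htop := tendsto_atTop_of_monotoneOn_deriv hKpos.le hdg hmono hlim
  have hxh : Tendsto (fun x => x * h x) atTop atTop := tendsto_id.atTop_mul_atTop₀ htop
  refine ⟨fun x => x / (β + ε x), K, hKpos, hdg, hdh, hpos, hrpos, ?_, htop, ?_, ?_⟩
  · refine ⟨2 / β + C * (2 / β) ^ 2, abs_sub_le_of_forall_hasDerivAt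
      (r' := fun x => (1 * (β + ε x) - x * deriv ε x) / (β + ε x) ^ 2)
      (fun x hx => ?_) fun x hx => ?_⟩
    · exact (hasDerivAt_id x).fun_div ((hl.diff x (hK1 x hx)).hasDerivAt.const_add β)
        (by linarith [(hb x hx).1] : 0 < β + ε x).ne'
    · have hx0 : 0 < x := by linarith [hK1 x hx]
      have hb1 := (hb x hx).1
      have hb0 : 0 < β + ε x := by linarith
      have hinv : (β + ε x)⁻¹ ≤ 2 / β := by
        rw [inv_le_comm₀ hb0 (by positivity), inv_div]; exact hb1
      have hCx := (hK x hx).1.1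
      have hC0 : 0 ≤ C := le_trans (by positivity) hCx
      rw [show (1 * (β + ε x) - x * deriv ε x) / (β + ε x) ^ 2
        = (β + ε x)⁻¹ - (x * deriv ε x) * (β + ε x)⁻¹ ^ 2 by field_simp]
      refine (abs_sub _ _).trans (add_le_add ?_ ?_)
      · rw [abs_of_pos (by positivity)]; exact hinv
      · rw [abs_mul, abs_mul, abs_of_pos hx0, abs_of_nonneg (sq_nonneg ((β + ε x)⁻¹))]
        gcongr
  · refine tendsto_atTop_mono' _ ?_ (hxh.const_mul_atTop (show 0 < 1 / (2 * β) by positivity))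
    filter_upwards [eventually_gt_atTop K] with x hx
    have := (hb x hx)
    have hx0 : 0 < x := by linarith [hK1 x hx]
    have hb0 : 0 < β + ε x := by linarith
    calc 1 / (2 * β) * (x * h x) ≤ 1 / (β + ε x) * (x * h x) := by
          have := (mul_pos hx0 (hpos x hx)).le
          gcongr
          linarith
      _ = _ := by ring
  · refine tendsto_atTop_mono' _ ?_ (hxh.const_mul_atTop (show 0 < β / 2 by positivity))
    filter_upwards [eventually_gt_atTop K] with x hx
    have := (hb x hx)
    have hx0 : 0 < x := by linarith [hK1 x hx]
    have hb0 : 0 < β + ε x := by linarith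
    calc β / 2 * (x * h x) ≤ (β + ε x) * (x * h x) := by
          have := (mul_pos hx0 (hpos x hx)).le
          gcongr
          linarith
      _ = _ := by field_simp

theorem leftInv_apply {h : ℝ → ℝ} (hm : StrictMonoOn h (Ioi 0)) {x : ℝ} (hx : 0 < x) :
    leftInv h (h x) = x := by
  have : {y : ℝ | 0 < y ∧ h x ≤ h y} = Ici x := by
    ext y
    constructor
    · rintro ⟨hy, hle⟩
      exact (hm.le_iff_le hx hy).1 hle
    · intro hy
      exact ⟨hx.trans_le hy, (hm.le_iff_le hx (hx.trans_le hy)).2 hy⟩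
  rw [leftInv, this, csInf_Ici]

/-- A derivative that is strictly increasing is continuous, by Darboux's theorem. -/
theorem continuousAt_deriv_of_strictMonoOn {g : ℝ → ℝ}
    (hg : ∀ x, 0 < x → DifferentiableAt ℝ g x) (hm : StrictMonoOn (deriv g) (Ioi 0)) {x : ℝ}
    (hx : 0 < x) : ContinuousAt (deriv g) x := by
  refine hm.continuousAt_of_image_mem_nhds (Ioi_mem_nhds hx) ?_
  have hoc : OrdConnected (deriv g '' Ioi 0) := ordConnected_Ioi.image_deriv fun y hy => hg y hy
  have h1 : deriv g (x / 2) < deriv g x := hm (half_pos hx) hx (by linarith)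
  have h2 : deriv g x < deriv g (2 * x) := hm hx (by simpa using hx) (by linarith)
  exact mem_of_superset (Icc_mem_nhds h1 h2)
    (hoc.out (mem_image_of_mem _ (half_pos hx)) (mem_image_of_mem _ (by simpa using hx)))

/-- Rapidly varying case: if `ψ = h⁻¹` has `ψ' = ψ ε / u`, then `h / h' = x ε(h(x))`. -/
theorem MemRInfty.regularExponent {g : ℝ → ℝ} (H : MemRInfty (deriv g))
    (hg : ∀ x, 0 < x → DifferentiableAt ℝ g x)
    (hlim : Tendsto (fun x => g x / x) atTop atTop) :
    ∃ r K, RegularExponent g (deriv g) r K := by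
  obtain ⟨hm, ε, hl, -, hε1, -, η, hη, δ, hδ, hlow⟩ := H
  have hcont : ∀ x, 0 < x → ContinuousAt (deriv g) x := fun x hx =>
    continuousAt_deriv_of_strictMonoOn hg hm hx
  have hinv : ∀ x, 0 < x → leftInv (deriv g) (deriv g x) = x := fun x hx => leftInv_apply hm hx
  have htop : Tendsto (deriv g) atTop atTop := tendsto_atTop_of_monotoneOn_deriv le_rfl
    (fun x hx => (hg x hx).hasDerivAt) hm.monotoneOn hlim
  set h := deriv g with hh
  set ψ := leftInv h
  have hε0 : ∀ᶠ u in atTop, ε u ≤ 1 := hl.tendsto_zero.eventually_le_const one_pos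
  have hε1' : ∀ᶠ u in atTop, |u * deriv ε u / ε u| ≤ 1 := by
    have := hε1.abs
    rw [abs_zero] at this
    exact this.eventually_le_const one_pos
  have hall : ∀ᶠ x in atTop, (ε (h x) ≤ 1 ∧ |h x * deriv ε (h x) / ε (h x)| ≤ 1) ∧
      δ ≤ h x ^ η * ε (h x) ∧ 1 < h x :=
    htop.eventually ((hε0.and hε1').and (hlow.and (eventually_gt_atTop 1)))
  obtain ⟨K₀, hK₀⟩ := eventually_atTop.1 hall
  set K := max K₀ 1
  have hK1 : ∀ x, K < x → 1 < x := fun x hx => (le_max_right _ _).trans_lt hx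
  have hK : ∀ x, K < x → (ε (h x) ≤ 1 ∧ |h x * deriv ε (h x) / ε (h x)| ≤ 1) ∧
      δ ≤ h x ^ η * ε (h x) ∧ 1 < h x :=
    fun x hx => hK₀ x ((le_max_left _ _).trans hx.le)
  have hpos : ∀ x, K < x → 0 < h x := fun x hx => by linarith [(hK x hx).2.2]
  have hεpos : ∀ x, K < x → 0 < ε (h x) := fun x hx => by
    have h1 := (hK x hx).2.1
    have h2 : 0 < h x ^ η := Real.rpow_pos_of_pos (hpos x hx) _
    exact pos_of_mul_pos_right (hδ.trans_le h1) h2.le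
  have hrpos : ∀ x, K < x → 0 < x * ε (h x) := fun x hx =>
    mul_pos (by linarith [hK1 x hx]) (hεpos x hx)
  have hdh : ∀ x, K < x → HasDerivAt h (h x / (x * ε (h x))) x := by
    intro x hx
    have hx0 : 0 < x := by linarith [hK1 x hx]
    have h1 := hl.hasDerivAt (hK x hx).2.2
    rw [hinv x hx0] at h1
    have hne : x * (ε (h x) / h x) ≠ 0 :=
      (mul_pos hx0 (div_pos (hεpos x hx) (hpos x hx))).ne'
    have h2 := HasDerivAt.of_local_left_inverse (hcont x hx0) h1 hne (by
      filter_upwards [Ioi_mem_nhds hx0] with y hy using hinv y hy)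
    refine h2.congr_deriv ?_
    have := hpos x hx
    have := hεpos x hx
    field_simp
  have hKpos : 0 < K := zero_lt_one.trans_le (le_max_right _ _)
  refine ⟨fun x => x * ε (h x), K, hKpos,
    fun x hx => (hg x (by linarith [hK1 x hx])).hasDerivAt, hdh, hpos, hrpos, ?_, htop, ?_, ?_⟩
  · refine ⟨2, abs_sub_le_of_forall_hasDerivAt
      (r' := fun x => 1 * ε (h x) + x * (deriv ε (h x) * (h x / (x * ε (h x)))))
      (fun x hx => ?_) fun x hx => ?_⟩
    · exact (hasDerivAt_id x).fun_mul
        ((hl.diff _ (hK x hx).2.2).hasDerivAt.comp x (hdh x hx))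
    · have hx0 : 0 < x := by linarith [hK1 x hx]
      have he := hεpos x hx
      have h1 := (hK x hx).1
      rw [show 1 * ε (h x) + x * (deriv ε (h x) * (h x / (x * ε (h x))))
        = ε (h x) + h x * deriv ε (h x) / ε (h x) by field_simp]
      refine (abs_add_le _ _).trans ?_
      rw [abs_of_pos he]
      linarith
  · -- `h ε(h) ≥ δ` because `h ^ η ≤ h`
    refine tendsto_atTop_mono' _ ?_ (tendsto_id.const_mul_atTop hδ)
    filter_upwards [eventually_gt_atTop K] with x hx
    have hx0 : 0 < x := by linarith [hK1 x hx]
    have h1 : h x ^ η ≤ h x := by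
      have := Real.rpow_le_rpow_of_exponent_le (hK x hx).2.2.le
        (show η ≤ 1 by linarith [hη.2])
      rwa [Real.rpow_one] at this
    have h2 : δ ≤ h x * ε (h x) :=
      (hK x hx).2.1.trans (mul_le_mul_of_nonneg_right h1 (hεpos x hx).le)
    calc δ * id x ≤ (h x * ε (h x)) * x := mul_le_mul_of_nonneg_right h2 hx0.le
      _ = _ := by ring
  · refine tendsto_atTop_mono' _ ?_ tendsto_id
    filter_upwards [eventually_gt_atTop K] with x hx
    have hx0 : 0 < x := by linarith [hK1 x hx]
    have he := hεpos x hx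
    have he1 := (hK x hx).1.1
    have hh1 := (hK x hx).2.2
    have h1 : 1 ≤ h x / ε (h x) := by
      rw [one_le_div he]; linarith
    calc id x ≤ x * (h x / ε (h x)) := le_mul_of_one_le_right hx0.le h1
      _ = _ := by field_simp

/-! ### Tilted densities in the scale of their width -/

theorem integrable_abs_pow_mul_exp_neg_mul_abs (k : ℕ) {a : ℝ} (ha : 0 < a) :
    Integrable (fun z : ℝ => |z| ^ k * Real.exp (-(a * |z|))) := by
  have hpos : IntegrableOn (fun z : ℝ => |z| ^ k * Real.exp (-(a * |z|))) (Ioi 0) := by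
    have h := integrableOn_rpow_mul_exp_neg_mul_rpow (p := 1) (s := k) (b := a)
      (by have : (0 : ℝ) ≤ k := Nat.cast_nonneg k; linarith) one_pos ha
    refine h.congr_fun (fun z hz => ?_) measurableSet_Ioi
    have hz' : (0 : ℝ) < z := hz
    simp [abs_of_pos hz']
  have hneg : IntegrableOn (fun z : ℝ => |z| ^ k * Real.exp (-(a * |z|))) (Iic 0) := by
    rw [← Measure.map_neg_eq_self (volume : Measure ℝ)]
    have m : MeasurableEmbedding fun x : ℝ => -x := (Homeomorph.neg ℝ).measurableEmbedding
    rw [m.integrableOn_map_iff]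
    simp_rw [Function.comp_def, abs_neg, neg_preimage, neg_Iic, neg_zero]
    exact Iff.mpr integrableOn_Ici_iff_integrableOn_Ioi hpos
  rw [← integrableOn_univ, ← Iic_union_Ioi (a := (0 : ℝ))]
  exact hneg.union hpos

section Weight

open RegularExponent

/-- The tilted density `exp (h(x) y) p(y)`, recentred at its mode `x`, rescaled by the width of the
peak and divided by its approximate height. -/
noncomputable def peakWeight (g h r p : ℝ → ℝ) (c x z : ℝ) : ℝ :=
  Real.exp (g x) / c * Real.exp (h x * (width h r x * z)) * p (x + width h r x * z)

variable {g h r p q : ℝ → ℝ} {K M c : ℝ}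

theorem peakWeight_eq_exp_drop (hc : 0 < c) {x z : ℝ}
    (hp : p (x + width h r x * z) = c * Real.exp
      (-(g (x + width h r x * z) - q (x + width h r x * z)))) :
    peakWeight g h r p c x z = Real.exp (-drop g h r x z + q (x + width h r x * z)) := by
  rw [peakWeight, hp, show ∀ a b d : ℝ, a / c * b * (c * d) = a * b * d * (c / c) from
    fun a b d => by ring, div_self hc.ne', mul_one, ← Real.exp_add, ← Real.exp_add, drop]
  congr 1
  ring

theorem tendsto_peakWeight (R : RegularExponent g h r K) (hc : 0 < c)
    (hp : ∀ x, 0 < x → p x = c * Real.exp (-(g x - q x))) (hq : Tendsto q atTop (𝓝 0)) (z : ℝ) :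
    Tendsto (fun x => peakWeight g h r p c x z) atTop (𝓝 (Real.exp (-(z ^ 2 / 2)))) := by
  have h1 : Tendsto (fun x => -drop g h r x z + q (x + width h r x * z)) atTop
      (𝓝 (-(z ^ 2 / 2) + 0)) :=
    (R.tendsto_drop z).neg.add (hq.comp (R.tendsto_add_width_mul (y := fun _ => z) (A := |z|)
      fun _ => le_rfl))
  rw [add_zero] at h1
  refine ((Real.continuous_exp.tendsto _).comp h1).congr' ?_
  filter_upwards [R.eventually_lt_add_width_mul |z| 0] with x hx
  exact (peakWeight_eq_exp_drop hc (hp _ (hx z le_rfl))).symm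

/-- A uniform exponential envelope for the rescaled tilted densities. Where the exponent is convex
this is its linear drop; on the remaining bounded range the density is bounded and the tilt is
monotone, so the value at the right end point of that range decides. -/
theorem exists_peakWeight_le (R : RegularExponent g h r K) (hc : 0 < c)
    (hp : ∀ x, 0 < x → p x = c * Real.exp (-(g x - q x))) (hp0 : ∀ x, x ≤ 0 → p x = 0)
    (hpM : ∀ x, p x ≤ M) (hq : Tendsto q atTop (𝓝 0)) :
    ∃ B : ℝ, 0 < B ∧ ∀ᶠ x in atTop, ∀ z,
      0 ≤ peakWeight g h r p c x z ∧
      peakWeight g h r p c x z ≤ B * Real.exp (-(1 / 8 * |z|)) := by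
  have hpn : ∀ y, 0 ≤ p y := by
    intro y
    rcases le_or_gt y 0 with hy | hy
    · rw [hp0 y hy]
    · rw [hp y hy]; positivity
  have hM : 0 ≤ M := (hpn 0).trans (hpM 0)
  have hq1 : ∀ᶠ x in atTop, q x ≤ 1 := hq.eventually_le_const one_pos
  obtain ⟨K₁, hK₁⟩ := eventually_atTop.1 (hq1.and (eventually_gt_atTop K))
  have hKK : K < K₁ := (hK₁ K₁ le_rfl).2
  have hK0 : 0 < K₁ := R.K_pos.trans hKK
  -- beyond `K₁` the drop and `q ≤ 1` give the constant `exp 2`, before it the bound `M` on `p`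
  -- gives the second summand
  refine ⟨Real.exp 2 + M / c * Real.exp (g K₁ + 1), by positivity, ?_⟩
  filter_upwards [R.eventually_le_drop, eventually_ge_atTop (2 * K₁)] with x hdrop hx z
  have hKx : K < x := by linarith
  set w := width h r x with hw
  have hw0 : 0 < w := R.width_pos hKx
  have hnn : 0 ≤ peakWeight g h r p c x z := by
    have := hpn (x + w * z)
    unfold peakWeight
    positivity
  refine ⟨hnn, ?_⟩
  have hz0 := abs_nonneg z
  rcases lt_or_ge K₁ (x + w * z) with hy | hy
  · rw [peakWeight_eq_exp_drop hc (hp _ (hK0.trans hy))]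
    have h1 := hdrop z (hKK.trans hy)
    have h2 := (hK₁ _ hy.le).1
    calc Real.exp (-drop g h r x z + q (x + w * z)) ≤ Real.exp (2 + -(1 / 8 * |z|)) :=
          Real.exp_le_exp.2 (by linarith)
      _ = Real.exp 2 * Real.exp (-(1 / 8 * |z|)) := Real.exp_add _ _
      _ ≤ _ := by
          gcongr
          have : 0 ≤ M / c * Real.exp (g K₁ + 1) := by positivity
          linarith
  · rcases le_or_gt (x + w * z) 0 with hy0 | hy0
    · rw [peakWeight, hp0 _ hy0, mul_zero]
      positivity
    · -- the comparison is with the point `z₁` that is sent to `K₁`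
      have hh : 0 < h x := R.h_pos x hKx
      set z₁ := (K₁ - x) / w with hz₁
      have hwz₁ : w * z₁ = K₁ - x := by rw [hz₁]; field_simp
      have h1 := hdrop z₁ (by rw [hwz₁]; linarith)
      have hd : drop g h r x z₁ = g K₁ - g x - h x * (K₁ - x) := by
        rw [drop, ← hw, hwz₁, add_sub_cancel]
      have hzle : |z| ≤ 2 * |z₁| := by
        have hzneg : z < 0 := by
          by_contra hcon
          have := mul_nonneg hw0.le (not_lt.1 hcon)
          linarith
        have hz₁neg : z₁ < 0 := div_neg_of_neg_of_pos (by linarith) hw0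
        rw [abs_of_neg hzneg, abs_of_neg hz₁neg]
        have : w * (-z) ≤ w * (2 * -z₁) := by
          rw [show w * (2 * -z₁) = -2 * (w * z₁) by ring, hwz₁]
          linarith
        exact le_of_mul_le_mul_left this hw0
      calc peakWeight g h r p c x z
          ≤ Real.exp (g x) / c * Real.exp (h x * (K₁ - x)) * M := by
            unfold peakWeight
            gcongr
            · exact hpn _
            · linarith
            · exact hpM _
        _ = M / c * Real.exp (g K₁ + -drop g h r x z₁) := by
            rw [hd, show g K₁ + -(g K₁ - g x - h x * (K₁ - x)) = g x + h x * (K₁ - x) by ring,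
              Real.exp_add]
            ring
        _ ≤ M / c * Real.exp ((g K₁ + 1) + -(1 / 8 * |z|)) := by
            gcongr ?_ * Real.exp ?_
            linarith
        _ = M / c * Real.exp (g K₁ + 1) * Real.exp (-(1 / 8 * |z|)) := by
            rw [Real.exp_add (g K₁ + 1)]; ring
        _ ≤ _ := by
            gcongr
            have := Real.exp_pos 2
            linarith

theorem measurable_peakWeight (hp : Measurable p) (x : ℝ) :
    Measurable (peakWeight g h r p c x) := by
  unfold peakWeight
  fun_prop

end Weight

section Density

variable {Ω : Type*} [MeasurableSpace Ω] {P : Measure Ω} {X : Ω → ℝ} {p : ℝ → ℝ}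

/-- Exponentially weighted expectations of the recentred and rescaled variable, in terms of the
tilted density `exp (t σ z) p (x + σ z)` multiplied by an arbitrary constant `a`. -/
theorem integral_exp_smul_eq_of_density {E : Type*} [NormedAddCommGroup E] [NormedSpace ℝ E]
    (hX : Measurable X) (hp : Measurable p) (hpn : ∀ y, 0 ≤ p y)
    (hlaw : P.map X = volume.withDensity fun y => ENNReal.ofReal (p y)) (t x : ℝ) {σ a : ℝ}
    (hσ : 0 < σ) (ha : 0 < a) {F : ℝ → E} (hF : StronglyMeasurable F) :
    ∫ ω, Real.exp (t * X ω) • F ((X ω - x) / σ) ∂P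
      = (σ * Real.exp (t * x) / a) •
        ∫ z, (a * Real.exp (t * (σ * z)) * p (x + σ * z)) • F z := by
  have hm : StronglyMeasurable fun y : ℝ => Real.exp (t * y) • F ((y - x) / σ) :=
    (by fun_prop : Measurable fun y : ℝ => Real.exp (t * y)).stronglyMeasurable.smul
      (hF.comp_measurable (by fun_prop))
  rw [← integral_map (φ := X) (f := fun y => Real.exp (t * y) • F ((y - x) / σ)) hX.aemeasurable
    hm.aestronglyMeasurable, hlaw, integral_withDensity_eq_integral_toReal_smul (by fun_prop)
    (ae_of_all _ fun _ => ENNReal.ofReal_lt_top)]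
  set G : ℝ → E := fun y => (ENNReal.ofReal (p y)).toReal • Real.exp (t * y) • F ((y - x) / σ)
    with hG
  have h1 : ∫ z, G (x + σ * z) = σ⁻¹ • ∫ y, G y := by
    rw [Measure.integral_comp_mul_left (fun y => G (x + y)) σ, integral_add_left_eq_self,
      abs_of_pos (by positivity)]
  have h2 : ∫ y, G y = σ • ∫ z, G (x + σ * z) := by
    rw [h1, smul_smul, mul_inv_cancel₀ hσ.ne', one_smul]
  rw [h2, ← integral_smul, ← integral_smul]
  refine integral_congr_ae (ae_of_all _ fun z => ?_)
  simp only [hG]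
  rw [ENNReal.toReal_ofReal (hpn _), smul_smul, smul_smul, smul_smul,
    show (x + σ * z - x) / σ = z by field_simp; ring]
  congr 1
  rw [mul_add, Real.exp_add]
  field_simp

theorem integrable_exp_mul_of_density
    (hX : Measurable X) (hp : Measurable p) (hpn : ∀ y, 0 ≤ p y)
    (hlaw : P.map X = volume.withDensity fun y => ENNReal.ofReal (p y)) (t x : ℝ) {σ a : ℝ}
    (hσ : 0 < σ) (ha : 0 < a)
    (hW : Integrable fun z => a * Real.exp (t * (σ * z)) * p (x + σ * z)) :
    Integrable (fun ω => Real.exp (t * X ω)) P := by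
  have hm : Measurable fun y : ℝ => Real.exp (t * y) := by fun_prop
  refine (integrable_map_measure (f := X) hm.aestronglyMeasurable hX.aemeasurable).1 ?_
  rw [hlaw, integrable_withDensity_iff_integrable_smul' (by fun_prop)
    (ae_of_all _ fun _ => ENNReal.ofReal_lt_top)]
  have h1 := ((hW.comp_sub_right (x / σ)).comp_div hσ.ne').const_mul (Real.exp (t * x) / a)
  refine h1.congr (ae_of_all _ fun y => ?_)
  dsimp only
  rw [ENNReal.toReal_ofReal (hpn _), show σ * (y / σ - x / σ) = y - x by field_simp,
    add_sub_cancel, mul_sub, Real.exp_sub, smul_eq_mul]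
  field_simp

theorem integral_tiltedLaw_of_density [IsProbabilityMeasure P] {E : Type*} [NormedAddCommGroup E]
    [NormedSpace ℝ E] (hX : Measurable X) (hp : Measurable p) (hpn : ∀ y, 0 ≤ p y)
    (hlaw : P.map X = volume.withDensity fun y => ENNReal.ofReal (p y)) (t x : ℝ) {σ a : ℝ}
    (hσ : 0 < σ) (ha : 0 < a) {F : ℝ → E} (hF : StronglyMeasurable F) :
    ∫ z, F z ∂(tiltedLaw P X t x σ)
      = (∫ z, a * Real.exp (t * (σ * z)) * p (x + σ * z))⁻¹ •
        ∫ z, (a * Real.exp (t * (σ * z)) * p (x + σ * z)) • F z := by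
  have h1 := integral_exp_smul_eq_of_density hX hp hpn hlaw t x hσ ha hF
  have h2 := integral_exp_smul_eq_of_density hX hp hpn hlaw t x hσ ha
    (F := fun _ => (1 : ℝ)) stronglyMeasurable_const
  simp only [smul_eq_mul, mul_one] at h2
  have h3 : mgf X P t
      = σ * Real.exp (t * x) / a * ∫ z, a * Real.exp (t * (σ * z)) * p (x + σ * z) := h2
  rw [integral_tiltedLaw hX t x σ hF]
  have h4 : ∀ ω, (Real.exp (t * X ω) / mgf X P t) • F ((X ω - x) / σ)
      = (mgf X P t)⁻¹ • (Real.exp (t * X ω) • F ((X ω - x) / σ)) := fun ω => by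
    rw [smul_smul, div_eq_inv_mul]
  simp_rw [h4]
  rw [integral_smul, h1, h3, smul_smul, mul_inv]
  congr 1
  have := Real.exp_pos (t * x)
  field_simp

/-- A pointwise bound on the density bounds the law by a multiple of Lebesgue measure. -/
theorem tiltedLaw_le_smul_volume [IsProbabilityMeasure P] (hX : Measurable X) (hp : Measurable p)
    (hpn : ∀ y, 0 ≤ p y) (hlaw : P.map X = volume.withDensity fun y => ENNReal.ofReal (p y))
    (t x : ℝ) {σ a : ℝ} (hσ : 0 < σ) (ha : 0 < a)
    (hW : Integrable fun z => a * Real.exp (t * (σ * z)) * p (x + σ * z)) {D : ℝ}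
    (hD : ∀ z, (∫ z, a * Real.exp (t * (σ * z)) * p (x + σ * z))⁻¹ *
      (a * Real.exp (t * (σ * z)) * p (x + σ * z)) ≤ D) :
    tiltedLaw P X t x σ ≤ ENNReal.ofReal D • volume := by
  have := isProbabilityMeasure_tiltedLaw hX
    (integrable_exp_mul_of_density hX hp hpn hlaw t x hσ ha hW) x σ
  refine Measure.le_iff.2 fun s hs => ?_
  have h1 := integral_tiltedLaw_of_density hX hp hpn hlaw t x hσ ha
    (F := s.indicator fun _ => (1 : ℝ)) (stronglyMeasurable_const.indicator hs)
  set W : ℝ → ℝ := fun z => a * Real.exp (t * (σ * z)) * p (x + σ * z) with hWdef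
  have hWn : ∀ z, 0 ≤ W z := fun z => by
    have := hpn (x + σ * z)
    simp only [hWdef]
    positivity
  have hA : 0 ≤ ∫ z, W z := integral_nonneg hWn
  rw [integral_indicator_const _ hs, smul_eq_mul, mul_one, smul_eq_mul, ← integral_const_mul] at h1
  rw [← ofReal_measureReal, h1, Measure.smul_apply, smul_eq_mul,
    ofReal_integral_eq_lintegral_ofReal]
  · calc ∫⁻ z, ENNReal.ofReal ((∫ z, W z)⁻¹ * (W z • s.indicator (fun _ => (1 : ℝ)) z))
        ≤ ∫⁻ z, s.indicator (fun _ => ENNReal.ofReal D) z := by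
          refine lintegral_mono fun z => ?_
          by_cases hz : z ∈ s
          · simp only [hz, indicator_of_mem, smul_eq_mul, mul_one]
            exact ENNReal.ofReal_le_ofReal (hD z)
          · simp [hz]
      _ = ENNReal.ofReal D * volume s := by
          rw [lintegral_indicator hs, lintegral_const, Measure.restrict_apply_univ]
  · refine Integrable.const_mul ?_ _
    refine (hW.indicator hs).congr (ae_of_all _ fun z => ?_)
    by_cases hz : z ∈ s <;> simp [hz, hWdef]
  · refine ae_of_all _ fun z => mul_nonneg (inv_nonneg.2 hA) (mul_nonneg (hWn z) ?_)
    exact indicator_nonneg (fun _ _ => zero_le_one) z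

end Density

/-! ### Standardization and Gaussian moments -/

section Standardize

variable {ζ : Measure ℝ}

theorem integral_pow_map_standardize (k : ℕ) (α τ : ℝ) :
    ∫ y, y ^ k ∂(ζ.map fun z => (z - α) / τ) = (∫ z, (z - α) ^ k ∂ζ) / τ ^ k := by
  rw [integral_map (by fun_prop) (by fun_prop), ← integral_div]
  simp_rw [div_pow]

theorem integrable_sub_pow_of_integrable_pow_four [IsProbabilityMeasure ζ]
    (h4 : Integrable (fun z => z ^ 4) ζ) (α : ℝ) {k : ℕ} (hk : k ≤ 4) :
    Integrable (fun z => (z - α) ^ k) ζ := by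
  have h : ∀ z : ℝ, (z - α) ^ k
      = ∑ j ∈ Finset.range (k + 1), z ^ j * ((-α) ^ (k - j) * (k.choose j : ℝ)) := by
    intro z
    rw [sub_eq_add_neg, add_pow]
    exact Finset.sum_congr rfl fun j _ => by ring
  simp_rw [h]
  refine integrable_finsetSum _ fun j hj => ?_
  refine (integrable_pow_of_integrable_pow_four h4 ?_).mul_const _
  have := Finset.mem_range.1 hj
  omega

theorem integral_sub_sq [IsProbabilityMeasure ζ] (h4 : Integrable (fun z => z ^ 4) ζ) (α : ℝ) :
    ∫ z, (z - α) ^ 2 ∂ζ = ∫ z, z ^ 2 ∂ζ - 2 * α * ∫ z, z ∂ζ + α ^ 2 := by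
  have i1 : Integrable (fun z : ℝ => z) ζ := by
    simpa using integrable_pow_of_integrable_pow_four h4 (k := 1) (by norm_num)
  have i2 := integrable_pow_of_integrable_pow_four h4 (k := 2) (by norm_num)
  have e : ∀ z : ℝ, (z - α) ^ 2 = z ^ 2 - 2 * α * z + α ^ 2 := fun z => by ring
  have j1 : Integrable (fun z : ℝ => z ^ 2 - 2 * α * z) ζ := i2.sub (i1.const_mul _)
  simp_rw [e]
  rw [integral_add j1 (integrable_const _), integral_sub i2 (i1.const_mul _), integral_const_mul]
  simp

theorem integral_sub_pow_three [IsProbabilityMeasure ζ] (h4 : Integrable (fun z => z ^ 4) ζ)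
    (α : ℝ) :
    ∫ z, (z - α) ^ 3 ∂ζ
      = ∫ z, z ^ 3 ∂ζ - 3 * α * ∫ z, z ^ 2 ∂ζ + 3 * α ^ 2 * ∫ z, z ∂ζ - α ^ 3 := by
  have i1 : Integrable (fun z : ℝ => z) ζ := by
    simpa using integrable_pow_of_integrable_pow_four h4 (k := 1) (by norm_num)
  have i2 := integrable_pow_of_integrable_pow_four h4 (k := 2) (by norm_num)
  have i3 := integrable_pow_of_integrable_pow_four h4 (k := 3) (by norm_num)
  have e : ∀ z : ℝ, (z - α) ^ 3 = z ^ 3 - 3 * α * z ^ 2 + 3 * α ^ 2 * z - α ^ 3 :=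
    fun z => by ring
  have j1 : Integrable (fun z : ℝ => z ^ 3 - 3 * α * z ^ 2) ζ := i3.sub (i2.const_mul _)
  have j2 : Integrable (fun z : ℝ => z ^ 3 - 3 * α * z ^ 2 + 3 * α ^ 2 * z) ζ :=
    j1.add (i1.const_mul _)
  simp_rw [e]
  rw [integral_sub j2 (integrable_const _), integral_add j1 (i1.const_mul _),
    integral_sub i3 (i2.const_mul _), integral_const_mul, integral_const_mul]
  simp

/-- Crude control of the centred fourth moment, by `(z - α)⁴ ≤ 8 (z⁴ + α⁴)`. -/
theorem integral_sub_pow_four_le [IsProbabilityMeasure ζ] (h4 : Integrable (fun z => z ^ 4) ζ)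
    (α : ℝ) :
    ∫ z, (z - α) ^ 4 ∂ζ ≤ 8 * (∫ z, z ^ 4 ∂ζ + α ^ 4) := by
  have h : ∀ z : ℝ, (z - α) ^ 4 ≤ 8 * z ^ 4 + 8 * α ^ 4 := by
    intro z
    nlinarith [sq_nonneg (z ^ 2 - α ^ 2), sq_nonneg ((z + α) ^ 2), sq_nonneg (z + α),
      mul_nonneg (sq_nonneg (z + α)) (sq_nonneg (z - α)),
      mul_nonneg (sq_nonneg (z + α)) (sq_nonneg z), mul_nonneg (sq_nonneg (z + α)) (sq_nonneg α)]
  refine (integral_mono (integrable_sub_pow_of_integrable_pow_four h4 α le_rfl)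
    ((h4.const_mul 8).add (integrable_const _)) h).trans (le_of_eq ?_)
  simp only [Pi.add_apply]
  rw [integral_add (h4.const_mul 8) (integrable_const _), integral_const_mul]
  simp
  ring

theorem norm_charFun_map_standardize (α τ v : ℝ) :
    ‖charFun (ζ.map fun z => (z - α) / τ) v‖ = ‖charFun ζ (v / τ)‖ := by
  have h : ∀ z : ℝ, Complex.exp (v * ((z - α) / τ : ℝ) * Complex.I)
      = Complex.exp ((-(v / τ * α) : ℝ) * Complex.I) *
        Complex.exp ((v / τ : ℝ) * z * Complex.I) := by
    intro z
    rw [← Complex.exp_add]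
    congr 1
    push_cast
    ring
  rw [charFun_apply_real, integral_map (by fun_prop) (by fun_prop)]
  simp_rw [h]
  rw [integral_const_mul, norm_mul, Complex.norm_exp_ofReal_mul_I, one_mul, charFun_apply_real]

end Standardize

section GaussianMoments

theorem integral_exp_neg_sq_div_two :
    ∫ z : ℝ, Real.exp (-(z ^ 2 / 2)) = Real.sqrt (2 * Real.pi) := by
  have h := integral_gaussian (1 / 2)
  rw [show Real.pi / (1 / 2) = 2 * Real.pi by ring] at h
  rw [← h]
  congr 1
  ext z
  congr 1
  ring

theorem integral_odd_pow_mul_exp_neg_sq_div_two {k : ℕ} (hk : Odd k) :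
    ∫ z : ℝ, Real.exp (-(z ^ 2 / 2)) * z ^ k = 0 := by
  have h := integral_neg_eq_self (fun z : ℝ => Real.exp (-(z ^ 2 / 2)) * z ^ k) volume
  simp_rw [neg_sq, hk.neg_pow, mul_neg] at h
  rw [integral_neg] at h
  linarith

theorem integral_sq_mul_exp_neg_sq_div_two :
    ∫ z : ℝ, Real.exp (-(z ^ 2 / 2)) * z ^ 2 = Real.sqrt (2 * Real.pi) := by
  have h := variance_fun_id_gaussianReal (μ := 0) (v := 1)
  rw [variance_eq_integral (by fun_prop), integral_id_gaussianReal,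
    integral_gaussianReal_eq_integral_smul one_ne_zero] at h
  have hpdf : ∀ z, gaussianPDFReal 0 1 z • (z - 0) ^ 2
      = (Real.sqrt (2 * Real.pi))⁻¹ * (Real.exp (-(z ^ 2 / 2)) * z ^ 2) := by
    intro z
    simp [gaussianPDFReal, neg_div, mul_assoc]
  simp_rw [hpdf] at h
  rw [integral_const_mul, inv_mul_eq_div, div_eq_iff (by positivity)] at h
  simpa using h

end GaussianMoments

section DominatedLimits

variable {w : ℝ → ℝ → ℝ} {B : ℝ}

theorem integrable_mul_pow_of_le_exp {f : ℝ → ℝ} (hm : Measurable f)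
    (hb : ∀ z, 0 ≤ f z ∧ f z ≤ B * Real.exp (-(1 / 8 * |z|))) (k : ℕ) :
    Integrable fun z => f z * z ^ k := by
  refine ((integrable_abs_pow_mul_exp_neg_mul_abs k (a := 1 / 8) (by norm_num)).const_mul B).mono'
    (by fun_prop) (ae_of_all _ fun z => ?_)
  rw [norm_mul, Real.norm_of_nonneg (hb z).1, norm_pow, Real.norm_eq_abs]
  calc f z * |z| ^ k ≤ B * Real.exp (-(1 / 8 * |z|)) * |z| ^ k := by
        gcongr; exact (hb z).2
    _ = _ := by ring

/-- Convergence of all moments of weights that converge pointwise to the Gaussian one under a common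
exponential envelope. -/
theorem tendsto_integral_mul_pow (hm : ∀ x, Measurable (w x))
    (hb : ∀ᶠ x in atTop, ∀ z, 0 ≤ w x z ∧ w x z ≤ B * Real.exp (-(1 / 8 * |z|)))
    (hlim : ∀ z, Tendsto (fun x => w x z) atTop (𝓝 (Real.exp (-(z ^ 2 / 2))))) (k : ℕ) :
    Tendsto (fun x => ∫ z, w x z * z ^ k) atTop
      (𝓝 (∫ z : ℝ, Real.exp (-(z ^ 2 / 2)) * z ^ k)) := by
  refine tendsto_integral_filter_of_dominated_convergence
    (fun z => B * (|z| ^ k * Real.exp (-(1 / 8 * |z|))))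
    (Eventually.of_forall fun x => ?_) ?_
    ((integrable_abs_pow_mul_exp_neg_mul_abs k (by norm_num)).const_mul B)
    (ae_of_all _ fun z => (hlim z).mul_const _)
  · exact ((hm x).mul (by fun_prop)).aestronglyMeasurable
  · filter_upwards [hb] with x hx
    refine ae_of_all _ fun z => ?_
    rw [norm_mul, Real.norm_of_nonneg (hx z).1, norm_pow, Real.norm_eq_abs]
    calc w x z * |z| ^ k ≤ B * Real.exp (-(1 / 8 * |z|)) * |z| ^ k := by
          gcongr; exact (hx z).2
      _ = _ := by ring

/-- Convergence of the normalized weights to the Gaussian density in `L¹`. -/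
theorem tendsto_integral_abs_sub_gaussian (hm : ∀ x, Measurable (w x))
    (hb : ∀ᶠ x in atTop, ∀ z, 0 ≤ w x z ∧ w x z ≤ B * Real.exp (-(1 / 8 * |z|)))
    (hlim : ∀ z, Tendsto (fun x => w x z) atTop (𝓝 (Real.exp (-(z ^ 2 / 2))))) :
    Tendsto (fun x => ∫ z, |(∫ z, w x z)⁻¹ * w x z -
      (Real.sqrt (2 * Real.pi))⁻¹ * Real.exp (-(z ^ 2 / 2))|) atTop (𝓝 0) := by
  have h0 : Tendsto (fun x => ∫ z, w x z) atTop (𝓝 (Real.sqrt (2 * Real.pi))) := by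
    have := tendsto_integral_mul_pow hm hb hlim 0
    simpa only [pow_zero, mul_one, integral_exp_neg_sq_div_two] using this
  have hS : 1 < Real.sqrt (2 * Real.pi) := by
    rw [Real.lt_sqrt zero_le_one]
    linarith [Real.two_le_pi]
  have hg : Integrable fun z : ℝ => Real.exp (-(z ^ 2 / 2)) := by
    have := integrable_exp_neg_mul_sq (b := 1 / 2) (by norm_num)
    refine this.congr (ae_of_all _ fun z => ?_)
    dsimp only
    congr 1
    ring
  have he : Integrable fun z : ℝ => Real.exp (-(1 / 8 * |z|)) := by
    simpa using integrable_abs_pow_mul_exp_neg_mul_abs 0 (a := 1 / 8) (by norm_num)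
  have hz : ∫ _ : ℝ, (0 : ℝ) = 0 := integral_zero _ _
  rw [← hz]
  refine tendsto_integral_filter_of_dominated_convergence
    (fun z => B * Real.exp (-(1 / 8 * |z|)) + (Real.sqrt (2 * Real.pi))⁻¹ *
      Real.exp (-(z ^ 2 / 2))) (Eventually.of_forall fun x => ?_) ?_
    ((he.const_mul _).add (hg.const_mul _)) (ae_of_all _ fun z => ?_)
  · have := hm x
    exact (by fun_prop : Measurable fun z => |(∫ z, w x z)⁻¹ * w x z -
      (Real.sqrt (2 * Real.pi))⁻¹ * Real.exp (-(z ^ 2 / 2))|).aestronglyMeasurable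
  · filter_upwards [hb, h0.eventually_const_lt hS] with x hx hJ
    refine ae_of_all _ fun z => ?_
    rw [Real.norm_eq_abs, abs_abs]
    have hinv : (∫ z, w x z)⁻¹ ≤ 1 := inv_le_one_of_one_le₀ hJ.le
    have hinv0 : 0 ≤ (∫ z, w x z)⁻¹ := inv_nonneg.2 (by linarith)
    refine (abs_sub _ _).trans (add_le_add ?_ ?_)
    · rw [abs_of_nonneg (mul_nonneg hinv0 (hx z).1)]
      exact (mul_le_of_le_one_left (hx z).1 hinv).trans (hx z).2
    · rw [abs_of_nonneg (by positivity)]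
  · have h1 := (h0.inv₀ (by linarith)).mul (hlim z)
    have h2 := (h1.sub_const ((Real.sqrt (2 * Real.pi))⁻¹ * Real.exp (-(z ^ 2 / 2)))).abs
    simpa using h2

end DominatedLimits

/-! ### Asymptotic normality of the recentred tilted laws -/

section TiltedMoments

variable {Ω : Type*} [MeasurableSpace Ω] {P : Measure Ω} {X : Ω → ℝ}

theorem interior_integrableExpSet_eq_univ
    (hexp : ∀ t, Integrable (fun ω => Real.exp (t * X ω)) P) :
    interior (integrableExpSet X P) = univ := by
  have : integrableExpSet X P = univ := eq_univ_of_forall hexp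
  rw [this, interior_univ]

theorem tiltMean_eq_integral (hexp : ∀ t, Integrable (fun ω => Real.exp (t * X ω)) P) (t : ℝ) :
    tiltMean X P t = ∫ ω, X ω ∂(P.tilted (t * X ·)) :=
  (integral_tilted_mul_self (by rw [interior_integrableExpSet_eq_univ hexp]; trivial)).symm

theorem deriv_tiltMean_eq_variance (hexp : ∀ t, Integrable (fun ω => Real.exp (t * X ω)) P)
    (t : ℝ) : deriv (tiltMean X P) t = Var[X; P.tilted (t * X ·)] := by
  rw [variance_tilted_mul (by rw [interior_integrableExpSet_eq_univ hexp]; trivial),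
    iteratedDeriv_succ, iteratedDeriv_one]
  rfl

theorem differentiable_tiltMean (hexp : ∀ t, Integrable (fun ω => Real.exp (t * X ω)) P) :
    Differentiable ℝ (tiltMean X P) := fun t =>
  (analyticAt_cgf (by rw [interior_integrableExpSet_eq_univ hexp]; trivial :
    t ∈ interior (integrableExpSet X P))).deriv.differentiableAt

theorem monotone_tiltMean (hexp : ∀ t, Integrable (fun ω => Real.exp (t * X ω)) P) :
    Monotone (tiltMean X P) :=
  monotone_of_deriv_nonneg (differentiable_tiltMean hexp) fun t => by
    rw [deriv_tiltMean_eq_variance hexp]; exact variance_nonneg _ _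

theorem integrable_pow_tiltedLaw (hX : Measurable X)
    (hexp : ∀ t, Integrable (fun ω => Real.exp (t * X ω)) P) [IsProbabilityMeasure P]
    (t x σ : ℝ) : Integrable (fun z => z ^ 4) (tiltedLaw P X t x σ) := by
  have := isProbabilityMeasure_tilted (hexp t)
  have h1 : MemLp X 4 (P.tilted (t * X ·)) := by
    have := memLp_tilted_mul (X := X) (μ := P) (t := t)
      (by rw [interior_integrableExpSet_eq_univ hexp]; trivial) 4
    exact_mod_cast this
  have h2 : MemLp (fun ω => (X ω - x) / σ) 4 (P.tilted (t * X ·)) := by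
    have := (h1.sub (memLp_const x)).const_mul σ⁻¹
    refine this.ae_eq (ae_of_all _ fun ω => ?_)
    simp only [Pi.sub_apply]
    rw [inv_mul_eq_div]
  rw [tiltedLaw, integrable_map_measure (by fun_prop) (by fun_prop)]
  have h3 := h2.integrable_norm_pow (p := 4) (by norm_num)
  refine h3.congr (ae_of_all _ fun ω => ?_)
  simp only [Function.comp, Real.norm_eq_abs]
  rw [← abs_pow, abs_of_nonneg (by positivity)]

theorem tiltMean_eq_add_mul (hX : Measurable X)
    (hexp : ∀ t, Integrable (fun ω => Real.exp (t * X ω)) P) [IsProbabilityMeasure P]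
    (t x : ℝ) {σ : ℝ} (hσ : 0 < σ) :
    tiltMean X P t = x + σ * ∫ z, z ∂(tiltedLaw P X t x σ) := by
  have := isProbabilityMeasure_tilted (hexp t)
  have hi : Integrable X (P.tilted (t * X ·)) := by
    have := memLp_tilted_mul (X := X) (μ := P) (t := t)
      (by rw [interior_integrableExpSet_eq_univ hexp]; trivial) 1
    exact memLp_one_iff_integrable.1 (by exact_mod_cast this)
  rw [tiltMean_eq_integral hexp, tiltedLaw, integral_map (by fun_prop) (by fun_prop),
    integral_div, integral_sub hi (integrable_const _)]
  simp
  field_simp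
  ring

theorem tiltSd_eq_mul_sqrt (hX : Measurable X)
    (hexp : ∀ t, Integrable (fun ω => Real.exp (t * X ω)) P) [IsProbabilityMeasure P]
    (t x : ℝ) {σ : ℝ} (hσ : 0 < σ) :
    tiltSd X P t = σ * Real.sqrt (∫ z, z ^ 2 ∂(tiltedLaw P X t x σ)
      - (∫ z, z ∂(tiltedLaw P X t x σ)) ^ 2) := by
  have := isProbabilityMeasure_tilted (hexp t)
  have := isProbabilityMeasure_tiltedLaw hX (hexp t) x σ
  set α := ∫ z, z ∂(tiltedLaw P X t x σ) with hα
  have hmean : ∫ ω, X ω ∂(P.tilted (t * X ·)) = x + σ * α := by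
    rw [← tiltMean_eq_integral hexp]; exact tiltMean_eq_add_mul hX hexp t x hσ
  have h1 := integral_sub_sq (integrable_pow_tiltedLaw hX hexp t x σ) α
  rw [← hα, show ∀ b : ℝ, b - 2 * α * α + α ^ 2 = b - α ^ 2 from fun b => by ring] at h1
  have h2 : Var[X; P.tilted (t * X ·)] = σ ^ 2 * ∫ z, (z - α) ^ 2 ∂(tiltedLaw P X t x σ) := by
    rw [variance_eq_integral hX.aemeasurable, hmean, tiltedLaw,
      integral_map (by fun_prop) (by fun_prop), ← integral_const_mul (σ ^ 2)]
    refine integral_congr_ae (ae_of_all _ fun ω => ?_)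
    dsimp only
    field_simp
    ring
  rw [tiltSd, deriv_tiltMean_eq_variance hexp, h2, h1, Real.sqrt_mul (sq_nonneg σ),
    Real.sqrt_sq hσ.le]

theorem tiltedLaw_eq_map_standardize (hX : Measurable X) (t x α τ : ℝ) {σ : ℝ} (hσ : 0 < σ) :
    tiltedLaw P X t (x + σ * α) (σ * τ)
      = (tiltedLaw P X t x σ).map fun z => (z - α) / τ := by
  rw [tiltedLaw, tiltedLaw, Measure.map_map (by fun_prop) (by fun_prop)]
  congr 1
  ext ω
  simp only [Function.comp]
  rw [← div_div]
  congr 1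
  field_simp
  ring

end TiltedMoments

/-- A bounded density `p = c exp (-(g - q))` on the positive half-line, vanishing elsewhere, whose
exponent `g` is regular and whose perturbation `q` vanishes at infinity. -/
structure LightTailDensity (p g h r q : ℝ → ℝ) (K c M : ℝ) : Prop where
  reg : RegularExponent g h r K
  meas : Measurable p
  c_pos : 0 < c
  eq_of_pos : ∀ x, 0 < x → p x = c * Real.exp (-(g x - q x))
  eq_zero : ∀ x, x ≤ 0 → p x = 0
  le : ∀ x, p x ≤ M
  q_zero : Tendsto q atTop (𝓝 0)

namespace LightTailDensity

open RegularExponent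

variable {p g h r q : ℝ → ℝ} {K c M : ℝ}
variable {Ω : Type*} [MeasurableSpace Ω] {P : Measure Ω} {X : Ω → ℝ}

theorem nonneg (L : LightTailDensity p g h r q K c M) (y : ℝ) : 0 ≤ p y := by
  rcases le_or_gt y 0 with hy | hy
  · rw [L.eq_zero y hy]
  · rw [L.eq_of_pos y hy]
    have := L.c_pos
    positivity

/-- All exponential moments are finite: tilts at the large values of `h` are controlled by the
envelope of the tilted densities, and smaller tilts by larger ones, the law being carried by the
positive half-line. -/
theorem integrable_exp_mul (L : LightTailDensity p g h r q K c M) [IsProbabilityMeasure P]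
    (hX : Measurable X) (hlaw : P.map X = volume.withDensity fun y => ENNReal.ofReal (p y))
    (t : ℝ) : Integrable (fun ω => Real.exp (t * X ω)) P := by
  obtain ⟨B, -, hb⟩ := exists_peakWeight_le L.reg L.c_pos L.eq_of_pos L.eq_zero L.le L.q_zero
  obtain ⟨x, ⟨hbx, hKx⟩, htx⟩ := ((hb.and (eventually_gt_atTop K)).and
    (L.reg.h_top.eventually_ge_atTop t)).exists
  have hW : Integrable (peakWeight g h r p c x) := by
    simpa using integrable_mul_pow_of_le_exp (measurable_peakWeight L.meas x) hbx 0
  have hc := L.c_pos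
  have hbig := integrable_exp_mul_of_density hX L.meas L.nonneg hlaw (h x) x
    (L.reg.width_pos hKx) (show 0 < Real.exp (g x) / c by positivity) hW
  have hpos : ∀ᵐ ω ∂P, 0 ≤ X ω := by
    have h0 : P.map X (Iio 0) = 0 := by
      rw [hlaw, withDensity_apply _ measurableSet_Iio]
      rw [setLIntegral_congr_fun (g := fun _ => 0) measurableSet_Iio fun y hy => ?_, lintegral_zero]
      dsimp only
      rw [L.eq_zero y (le_of_lt hy), ENNReal.ofReal_zero]
    rw [Measure.map_apply hX measurableSet_Iio] at h0
    rw [ae_iff]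
    convert! h0 using 2
    ext ω
    simp
  refine hbig.mono' (by fun_prop) ?_
  filter_upwards [hpos] with ω hω
  rw [Real.norm_of_nonneg (Real.exp_pos _).le]
  exact Real.exp_le_exp.2 (mul_le_mul_of_nonneg_right htx hω)

/-- The moments of the tilted law, recentred at its mode and rescaled by its width, converge to
those of the standard Gaussian law. -/
theorem tendsto_moment (L : LightTailDensity p g h r q K c M) [IsProbabilityMeasure P]
    (hX : Measurable X) (hlaw : P.map X = volume.withDensity fun y => ENNReal.ofReal (p y))
    (k : ℕ) :
    Tendsto (fun x => ∫ z, z ^ k ∂(tiltedLaw P X (h x) x (width h r x))) atTop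
      (𝓝 ((Real.sqrt (2 * Real.pi))⁻¹ * ∫ z : ℝ, Real.exp (-(z ^ 2 / 2)) * z ^ k)) := by
  obtain ⟨B, -, hb⟩ := exists_peakWeight_le L.reg L.c_pos L.eq_of_pos L.eq_zero L.le L.q_zero
  have hlim := tendsto_peakWeight L.reg L.c_pos L.eq_of_pos L.q_zero
  have hm : ∀ x, Measurable (peakWeight g h r p c x) := measurable_peakWeight L.meas
  have h0 := tendsto_integral_mul_pow hm hb hlim 0
  simp only [pow_zero, mul_one, integral_exp_neg_sq_div_two] at h0
  have hk := (h0.inv₀ (by positivity)).mul (tendsto_integral_mul_pow hm hb hlim k)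
  refine hk.congr' ?_
  filter_upwards [eventually_gt_atTop K] with x hx
  have hc := L.c_pos
  rw [integral_tiltedLaw_of_density hX L.meas L.nonneg hlaw (h x) x (L.reg.width_pos hx)
    (show 0 < Real.exp (g x) / c by positivity)
    (Measurable.stronglyMeasurable (by fun_prop : Measurable fun z : ℝ => z ^ k))]
  rfl

/-- Uniform convergence of the characteristic functions of the recentred tilted laws, from the
`L¹` convergence of their densities. -/
theorem exists_charFun_sub_gaussian_le (L : LightTailDensity p g h r q K c M)
    [IsProbabilityMeasure P] (hX : Measurable X)
    (hlaw : P.map X = volume.withDensity fun y => ENNReal.ofReal (p y)) :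
    ∃ E : ℝ → ℝ, Tendsto E atTop (𝓝 0) ∧ ∀ᶠ x in atTop, ∀ u : ℝ,
      ‖charFun (tiltedLaw P X (h x) x (width h r x)) u - (Real.exp (-u ^ 2 / 2) : ℂ)‖ ≤ E x := by
  obtain ⟨B, -, hb⟩ := exists_peakWeight_le L.reg L.c_pos L.eq_of_pos L.eq_zero L.le L.q_zero
  have hlim := tendsto_peakWeight L.reg L.c_pos L.eq_of_pos L.q_zero
  have hm : ∀ x, Measurable (peakWeight g h r p c x) := measurable_peakWeight L.meas
  refine ⟨_, tendsto_integral_abs_sub_gaussian hm hb hlim, ?_⟩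
  filter_upwards [hb, eventually_gt_atTop K] with x hbx hx u
  have hc := L.c_pos
  have hW : Integrable (peakWeight g h r p c x) := by
    simpa using integrable_mul_pow_of_le_exp (hm x) hbx 0
  have hgi : Integrable fun z : ℝ => Real.exp (-(z ^ 2 / 2)) := by
    have := integrable_exp_neg_mul_sq (b := 1 / 2) (by norm_num)
    refine this.congr (ae_of_all _ fun z => ?_)
    dsimp only
    congr 1
    ring
  set J := ∫ z, peakWeight g h r p c x z
  have e1 : charFun (tiltedLaw P X (h x) x (width h r x)) u
      = ∫ z, ((J⁻¹ * peakWeight g h r p c x z : ℝ) : ℂ) * Complex.exp (u * z * Complex.I) := by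
    rw [charFun_apply_real, integral_tiltedLaw_of_density hX L.meas L.nonneg hlaw (h x) x
      (L.reg.width_pos hx) (show 0 < Real.exp (g x) / c by positivity)
      (Measurable.stronglyMeasurable
        (by fun_prop : Measurable fun z : ℝ => Complex.exp (u * z * Complex.I))), ← integral_smul]
    congr 1
    ext z
    rw [smul_smul, Complex.real_smul]
    rfl
  have e2 : (Real.exp (-u ^ 2 / 2) : ℂ) = ∫ z : ℝ,
      (((Real.sqrt (2 * Real.pi))⁻¹ * Real.exp (-(z ^ 2 / 2)) : ℝ) : ℂ) *
        Complex.exp (u * z * Complex.I) := by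
    have hcf : charFun (gaussianReal 0 1) u = (Real.exp (-u ^ 2 / 2) : ℂ) := by
      rw [charFun_gaussianReal]
      push_cast
      congr 1
      simp [neg_div]
    rw [← hcf, charFun_apply_real, integral_gaussianReal_eq_integral_smul one_ne_zero]
    congr 1
    ext z
    rw [Complex.real_smul]
    congr 2
    simp [gaussianPDFReal, neg_div]
  have hexpb : ∀ z : ℝ, ‖Complex.exp (u * z * Complex.I)‖ = 1 := fun z => by
    rw [← Complex.ofReal_mul, Complex.norm_exp_ofReal_mul_I]
  have i1 : Integrable fun z : ℝ => ((J⁻¹ * peakWeight g h r p c x z : ℝ) : ℂ) *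
      Complex.exp (u * z * Complex.I) :=
    (hW.const_mul _).ofReal.mul_bdd (c := 1) (by fun_prop) (ae_of_all _ fun z => (hexpb z).le)
  have i2 : Integrable fun z : ℝ =>
      (((Real.sqrt (2 * Real.pi))⁻¹ * Real.exp (-(z ^ 2 / 2)) : ℝ) : ℂ) *
        Complex.exp (u * z * Complex.I) :=
    (hgi.const_mul _).ofReal.mul_bdd (c := 1) (by fun_prop) (ae_of_all _ fun z => (hexpb z).le)
  rw [e1, e2, ← integral_sub i1 i2]
  refine (norm_integral_le_integral_norm _).trans (le_of_eq ?_)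
  congr 1
  ext z
  rw [← sub_mul, norm_mul, hexpb, mul_one, ← Complex.ofReal_sub, Complex.norm_real,
    Real.norm_eq_abs]

/-- The recentred tilted laws have uniformly bounded densities. The bound is expressed as a
comparison with Lebesgue measure. -/
theorem exists_tiltedLaw_le_smul_volume (L : LightTailDensity p g h r q K c M)
    [IsProbabilityMeasure P] (hX : Measurable X)
    (hlaw : P.map X = volume.withDensity fun y => ENNReal.ofReal (p y)) :
    ∃ D : ℝ, 0 ≤ D ∧ ∀ᶠ x in atTop,
      tiltedLaw P X (h x) x (width h r x) ≤ ENNReal.ofReal D • volume := by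
  obtain ⟨B, hB, hb⟩ := exists_peakWeight_le L.reg L.c_pos L.eq_of_pos L.eq_zero L.le L.q_zero
  have hlim := tendsto_peakWeight L.reg L.c_pos L.eq_of_pos L.q_zero
  have hm : ∀ x, Measurable (peakWeight g h r p c x) := measurable_peakWeight L.meas
  have h0 := tendsto_integral_mul_pow hm hb hlim 0
  simp only [pow_zero, mul_one, integral_exp_neg_sq_div_two] at h0
  have hS : 1 < Real.sqrt (2 * Real.pi) := by
    rw [Real.lt_sqrt zero_le_one]
    linarith [Real.two_le_pi]
  refine ⟨B, hB.le, ?_⟩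
  filter_upwards [hb, eventually_gt_atTop K, h0.eventually_const_lt hS] with x hbx hx hJ
  have hc := L.c_pos
  have hW : Integrable (peakWeight g h r p c x) := by
    simpa using integrable_mul_pow_of_le_exp (hm x) hbx 0
  refine tiltedLaw_le_smul_volume hX L.meas L.nonneg hlaw (h x) x (L.reg.width_pos hx)
    (show 0 < Real.exp (g x) / c by positivity) hW fun z => ?_
  have h1 : (∫ z, peakWeight g h r p c x z)⁻¹ ≤ 1 := inv_le_one_of_one_le₀ hJ.le
  have h2 : peakWeight g h r p c x z ≤ B := (hbx z).2.trans
    (mul_le_of_le_one_right hB.le (Real.exp_le_one_iff.2 (by linarith [abs_nonneg z])))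
  exact (mul_le_of_le_one_left (hbx z).1 h1).trans h2

end LightTailDensity

/-! ### Standardized tilted laws -/

/-- The law of `X` under the tilt by `exp (t X)`, normalized to mean `0` and variance `1`. -/
noncomputable def standardTiltedLaw {Ω : Type*} [MeasurableSpace Ω] (P : Measure Ω) (X : Ω → ℝ)
    (t : ℝ) : Measure ℝ :=
  tiltedLaw P X t (tiltMean X P t) (tiltSd X P t)

/-- Every large `t` is a value of `h` at a large point, so that limits along the values of `h` are
limits in `t`. -/
theorem RegularExponent.atTop_le_map {g h r : ℝ → ℝ} {K : ℝ} (R : RegularExponent g h r K) :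
    atTop ≤ map h atTop := by
  obtain ⟨x, hx, hxt⟩ := R.exists_mode
  intro s hs
  filter_upwards [hx.eventually (mem_map.1 hs), hxt] with t h1 h2
  rwa [h2] at h1

namespace LightTailDensity

open RegularExponent

variable {p g h r q : ℝ → ℝ} {K c M : ℝ}
variable {Ω : Type*} [MeasurableSpace Ω] {P : Measure Ω} {X : Ω → ℝ}

theorem tendsto_moment_one (L : LightTailDensity p g h r q K c M) [IsProbabilityMeasure P]
    (hX : Measurable X) (hlaw : P.map X = volume.withDensity fun y => ENNReal.ofReal (p y)) :
    Tendsto (fun x => ∫ z, z ∂(tiltedLaw P X (h x) x (width h r x))) atTop (𝓝 0) := by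
  have := L.tendsto_moment hX hlaw 1
  rw [integral_odd_pow_mul_exp_neg_sq_div_two odd_one, mul_zero] at this
  simpa using this

theorem tendsto_moment_two (L : LightTailDensity p g h r q K c M) [IsProbabilityMeasure P]
    (hX : Measurable X) (hlaw : P.map X = volume.withDensity fun y => ENNReal.ofReal (p y)) :
    Tendsto (fun x => ∫ z, z ^ 2 ∂(tiltedLaw P X (h x) x (width h r x))) atTop (𝓝 1) := by
  have := L.tendsto_moment hX hlaw 2
  rwa [integral_sq_mul_exp_neg_sq_div_two, inv_mul_cancel₀ (by positivity)] at this

theorem tendsto_moment_three (L : LightTailDensity p g h r q K c M) [IsProbabilityMeasure P]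
    (hX : Measurable X) (hlaw : P.map X = volume.withDensity fun y => ENNReal.ofReal (p y)) :
    Tendsto (fun x => ∫ z, z ^ 3 ∂(tiltedLaw P X (h x) x (width h r x))) atTop (𝓝 0) := by
  have := L.tendsto_moment hX hlaw 3
  rwa [integral_odd_pow_mul_exp_neg_sq_div_two (by decide), mul_zero] at this

/-- The ratio `√(α₂ - α₁²)` of the standard deviation of the tilted law to its width. -/
theorem tendsto_sqrt_variance (L : LightTailDensity p g h r q K c M) [IsProbabilityMeasure P]
    (hX : Measurable X) (hlaw : P.map X = volume.withDensity fun y => ENNReal.ofReal (p y)) :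
    Tendsto (fun x => Real.sqrt (∫ z, z ^ 2 ∂(tiltedLaw P X (h x) x (width h r x))
      - (∫ z, z ∂(tiltedLaw P X (h x) x (width h r x))) ^ 2)) atTop (𝓝 1) := by
  have := ((L.tendsto_moment_two hX hlaw).sub ((L.tendsto_moment_one hX hlaw).pow 2)).sqrt
  simpa using this

/-- The standardized tilted law is an affine image, with coefficients tending to `0` and `1`, of
the tilted law recentred at its mode. -/
theorem standardTiltedLaw_eq (L : LightTailDensity p g h r q K c M) [IsProbabilityMeasure P]
    (hX : Measurable X) (hlaw : P.map X = volume.withDensity fun y => ENNReal.ofReal (p y)) {x : ℝ}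
    (hx : K < x) : standardTiltedLaw P X (h x)
      = (tiltedLaw P X (h x) x (width h r x)).map fun z =>
        (z - ∫ z, z ∂(tiltedLaw P X (h x) x (width h r x))) /
          Real.sqrt (∫ z, z ^ 2 ∂(tiltedLaw P X (h x) x (width h r x))
            - (∫ z, z ∂(tiltedLaw P X (h x) x (width h r x))) ^ 2) := by
  have hexp := L.integrable_exp_mul hX hlaw
  rw [standardTiltedLaw, tiltMean_eq_add_mul hX hexp (h x) x (L.reg.width_pos hx),
    tiltSd_eq_mul_sqrt hX hexp (h x) x (L.reg.width_pos hx),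
    tiltedLaw_eq_map_standardize hX _ _ _ _ (L.reg.width_pos hx)]

theorem eventually_tiltSd_pos (L : LightTailDensity p g h r q K c M) [IsProbabilityMeasure P]
    (hX : Measurable X) (hlaw : P.map X = volume.withDensity fun y => ENNReal.ofReal (p y)) :
    ∀ᶠ t in atTop, 0 < tiltSd X P t := by
  refine L.reg.atTop_le_map (mem_map.2 ?_)
  filter_upwards [(L.tendsto_sqrt_variance hX hlaw).eventually_const_lt zero_lt_one,
    eventually_gt_atTop K] with x hτ hx
  rw [mem_preimage, mem_ofPred_eq, tiltSd_eq_mul_sqrt hX (L.integrable_exp_mul hX hlaw) (h x) x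
    (L.reg.width_pos hx)]
  exact mul_pos (L.reg.width_pos hx) hτ

/-- The standard deviation is of the order of the width `√(r/h)`, and `h · √(r/h) = √(h r)`. -/
theorem tendsto_mul_tiltSd (L : LightTailDensity p g h r q K c M) [IsProbabilityMeasure P]
    (hX : Measurable X) (hlaw : P.map X = volume.withDensity fun y => ENNReal.ofReal (p y)) :
    Tendsto (fun t => t * tiltSd X P t) atTop atTop := by
  refine Tendsto.mono_left (tendsto_map'_iff.2 ?_) L.reg.atTop_le_map
  have h1 := (Real.tendsto_sqrt_atTop.comp L.reg.hr_top).atTop_mul_pos one_pos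
    (L.tendsto_sqrt_variance hX hlaw)
  refine h1.congr' ?_
  filter_upwards [eventually_gt_atTop K] with x hx
  have hh := L.reg.h_pos x hx
  have hr := L.reg.r_pos x hx
  simp only [Function.comp]
  rw [tiltSd_eq_mul_sqrt hX (L.integrable_exp_mul hX hlaw) (h x) x (L.reg.width_pos hx),
    ← mul_assoc]
  congr 1
  rw [Real.sqrt_eq_iff_mul_self_eq (by positivity)
    (mul_nonneg hh.le (L.reg.width_pos hx).le)]
  have := L.reg.width_sq hx
  rw [mul_mul_mul_comm, ← sq (width h r x), this]
  field_simp

theorem eventually_moments_standardTiltedLaw (L : LightTailDensity p g h r q K c M)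
    [IsProbabilityMeasure P] (hX : Measurable X)
    (hlaw : P.map X = volume.withDensity fun y => ENNReal.ofReal (p y)) :
    ∀ᶠ t in atTop, Integrable (fun y => y ^ 4) (standardTiltedLaw P X t) ∧
      ∫ y, y ∂(standardTiltedLaw P X t) = 0 ∧ ∫ y, y ^ 2 ∂(standardTiltedLaw P X t) = 1 := by
  refine L.reg.atTop_le_map (mem_map.2 ?_)
  have hexp := L.integrable_exp_mul hX hlaw
  filter_upwards [(L.tendsto_sqrt_variance hX hlaw).eventually_const_lt zero_lt_one,
    eventually_gt_atTop K] with x hτ hx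
  rw [mem_preimage, mem_ofPred_eq]
  refine ⟨integrable_pow_tiltedLaw hX hexp _ _ _, ?_⟩
  rw [L.standardTiltedLaw_eq hX hlaw hx]
  have := isProbabilityMeasure_tiltedLaw hX (hexp (h x)) x (width h r x)
  have i4 := integrable_pow_tiltedLaw hX hexp (h x) x (width h r x)
  set ζ := tiltedLaw P X (h x) x (width h r x)
  set α := ∫ z, z ∂ζ with hα
  have h2 := integral_sub_sq i4 α
  rw [← hα] at h2
  constructor
  · have := integral_pow_map_standardize (ζ := ζ) 1 α
      (Real.sqrt (∫ z, z ^ 2 ∂ζ - α ^ 2))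
    simp only [pow_one] at this
    have i1 : Integrable (fun z : ℝ => z) ζ := by
      simpa using integrable_pow_of_integrable_pow_four i4 (k := 1) (by norm_num)
    rw [this, integral_sub i1 (integrable_const _)]
    simp [hα]
  · rw [integral_pow_map_standardize, h2, Real.sq_sqrt (Real.sqrt_pos.1 hτ).le,
      div_eq_one_iff_eq (Real.sqrt_pos.1 hτ).ne']
    ring

theorem tendsto_moment_three_standardTiltedLaw (L : LightTailDensity p g h r q K c M)
    [IsProbabilityMeasure P] (hX : Measurable X)
    (hlaw : P.map X = volume.withDensity fun y => ENNReal.ofReal (p y)) :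
    Tendsto (fun t => ∫ y, y ^ 3 ∂(standardTiltedLaw P X t)) atTop (𝓝 0) := by
  refine Tendsto.mono_left (tendsto_map'_iff.2 ?_) L.reg.atTop_le_map
  have hexp := L.integrable_exp_mul hX hlaw
  have a1 := L.tendsto_moment_one hX hlaw
  have hlim := ((((L.tendsto_moment_three hX hlaw).sub ((a1.const_mul 3).mul
    (L.tendsto_moment_two hX hlaw))).add (((a1.pow 2).const_mul 3).mul a1)).sub (a1.pow 3)).div
    ((L.tendsto_sqrt_variance hX hlaw).pow 3) (by norm_num)
  norm_num at hlim
  refine hlim.congr' ?_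
  filter_upwards [eventually_gt_atTop K] with x hx
  have := isProbabilityMeasure_tiltedLaw hX (hexp (h x)) x (width h r x)
  simp only [Function.comp, Pi.div_apply]
  rw [L.standardTiltedLaw_eq hX hlaw hx, integral_pow_map_standardize,
    integral_sub_pow_three (integrable_pow_tiltedLaw hX hexp (h x) x (width h r x))]

theorem exists_moment_four_standardTiltedLaw_le (L : LightTailDensity p g h r q K c M)
    [IsProbabilityMeasure P] (hX : Measurable X)
    (hlaw : P.map X = volume.withDensity fun y => ENNReal.ofReal (p y)) :
    ∃ B : ℝ, ∀ᶠ t in atTop, ∫ y, y ^ 4 ∂(standardTiltedLaw P X t) ≤ B := by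
  have hexp := L.integrable_exp_mul hX hlaw
  have hlim := (((L.tendsto_moment hX hlaw 4).add
    ((L.tendsto_moment_one hX hlaw).pow 4)).const_mul 8).div
    ((L.tendsto_sqrt_variance hX hlaw).pow 4) (by norm_num)
  obtain ⟨B, hB⟩ := hlim.isBoundedUnder_le.eventually_le
  refine ⟨B, L.reg.atTop_le_map (mem_map.2 ?_)⟩
  filter_upwards [hB, eventually_gt_atTop K] with x hBx hx
  have := isProbabilityMeasure_tiltedLaw hX (hexp (h x)) x (width h r x)
  rw [mem_preimage, mem_ofPred_eq, L.standardTiltedLaw_eq hX hlaw hx, integral_pow_map_standardize]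
  refine le_trans ?_ hBx
  exact div_le_div_of_nonneg_right (integral_sub_pow_four_le
    (integrable_pow_tiltedLaw hX hexp (h x) x (width h r x)) _) (by positivity)

theorem exists_integral_sq_charFun_standardTiltedLaw_le (L : LightTailDensity p g h r q K c M)
    [IsProbabilityMeasure P] (hX : Measurable X)
    (hlaw : P.map X = volume.withDensity fun y => ENNReal.ofReal (p y)) :
    ∃ C : ℝ, ∀ᶠ t in atTop, Integrable (fun v => ‖charFun (standardTiltedLaw P X t) v‖ ^ 2) ∧
      ∫ v, ‖charFun (standardTiltedLaw P X t) v‖ ^ 2 ≤ C := by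
  have hexp := L.integrable_exp_mul hX hlaw
  obtain ⟨D, hD, hDx⟩ := L.exists_tiltedLaw_le_smul_volume hX hlaw
  have hτ := L.tendsto_sqrt_variance hX hlaw
  refine ⟨2 * (2 * Real.pi * D), L.reg.atTop_le_map (mem_map.2 ?_)⟩
  filter_upwards [hDx, eventually_gt_atTop K, hτ.eventually_const_lt zero_lt_one,
    hτ.eventually_le_const one_lt_two] with x hle hx h0 h2
  have := isProbabilityMeasure_tiltedLaw hX (hexp (h x)) x (width h r x)
  rw [mem_preimage, mem_ofPred_eq, L.standardTiltedLaw_eq hX hlaw hx]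
  simp_rw [norm_charFun_map_standardize]
  obtain ⟨i1, i2⟩ := integrable_charFun_sq_of_le_smul_volume hD hle
  refine ⟨i1.comp_div h0.ne', ?_⟩
  rw [Measure.integral_comp_div (fun v => ‖charFun (tiltedLaw P X (h x) x (width h r x)) v‖ ^ 2),
    smul_eq_mul, abs_of_pos h0]
  exact mul_le_mul h2 i2 (integral_nonneg fun _ => by positivity) zero_le_two

/-- Away from the origin, the characteristic functions of the standardized tilted laws stay
away from `1` in modulus, uniformly over large tilts. -/
theorem exists_norm_charFun_standardTiltedLaw_le (L : LightTailDensity p g h r q K c M)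
    [IsProbabilityMeasure P] (hX : Measurable X)
    (hlaw : P.map X = volume.withDensity fun y => ENNReal.ofReal (p y)) {δ : ℝ} (hδ : 0 < δ) :
    ∃ θ : ℝ, 0 ≤ θ ∧ θ < 1 ∧
      ∀ᶠ t in atTop, ∀ v, δ ≤ |v| → ‖charFun (standardTiltedLaw P X t) v‖ ≤ θ := by
  obtain ⟨E, hE, hEx⟩ := L.exists_charFun_sub_gaussian_le hX hlaw
  have hτ := L.tendsto_sqrt_variance hX hlaw
  -- eventually the rescaling factor `τ` is at most `2`, so that `|v / τ| ≥ δ / 2`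
  have hlt : Real.exp (-(δ / 2) ^ 2 / 2) < 1 :=
    Real.exp_lt_one_iff.2 (by have : 0 < (δ / 2) ^ 2 := by positivity
                              linarith)
  obtain ⟨θ, hθ, hθ1⟩ := exists_between hlt
  refine ⟨θ, ((Real.exp_pos _).trans hθ).le, hθ1, L.reg.atTop_le_map (mem_map.2 ?_)⟩
  filter_upwards [hEx, eventually_gt_atTop K, hτ.eventually_const_lt zero_lt_one,
    hτ.eventually_le_const one_lt_two, hE.eventually_lt_const (sub_pos.2 hθ)]
    with x hE1 hx h0 h2 hE2 v hv
  rw [L.standardTiltedLaw_eq hX hlaw hx, norm_charFun_map_standardize]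
  set τ := Real.sqrt _
  have h3 := norm_le_norm_add_norm_sub' (charFun (tiltedLaw P X (h x) x (width h r x)) (v / τ))
    (Real.exp (-(v / τ) ^ 2 / 2) : ℂ)
  have h4 : ‖(Real.exp (-(v / τ) ^ 2 / 2) : ℂ)‖ ≤ Real.exp (-(δ / 2) ^ 2 / 2) := by
    rw [Complex.norm_real, Real.norm_of_nonneg (Real.exp_pos _).le, Real.exp_le_exp]
    have : (δ / 2) ^ 2 ≤ (v / τ) ^ 2 := by
      refine sq_le_sq.2 ?_
      rw [abs_of_pos (by positivity), abs_div, abs_of_pos h0]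
      exact div_le_div₀ (abs_nonneg v) hv h0 h2
    linarith
  linarith [hE1 (v / τ)]

/-- Sums of `n` independent variables with a standardized tilted law have characteristic functions
within `o(1/√n)` of the Gaussian one in `L¹`: the skewness, which is the coefficient of the
`1/√n` term, vanishes along tilts that tend to infinity. -/
theorem tendsto_sqrt_mul_integral_charFun (L : LightTailDensity p g h r q K c M)
    [IsProbabilityMeasure P] (hX : Measurable X)
    (hlaw : P.map X = volume.withDensity fun y => ENNReal.ofReal (p y)) {t : ℕ → ℝ}
    (ht : Tendsto t atTop atTop) :
    (∀ᶠ n : ℕ in atTop, Integrable (fun u : ℝ =>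
      charFun (standardTiltedLaw P X (t n)) (u / Real.sqrt n) ^ n
        - (Real.exp (-u ^ 2 / 2) : ℂ))) ∧
    Tendsto (fun n : ℕ => Real.sqrt n * ∫ u : ℝ,
      ‖charFun (standardTiltedLaw P X (t n)) (u / Real.sqrt n) ^ n
        - (Real.exp (-u ^ 2 / 2) : ℂ)‖) atTop (𝓝 0) := by
  have : ∀ n, IsProbabilityMeasure (standardTiltedLaw P X (t n)) := fun n =>
    isProbabilityMeasure_tiltedLaw hX (L.integrable_exp_mul hX hlaw (t n)) _ _
  have hm := ht.eventually (L.eventually_moments_standardTiltedLaw hX hlaw)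
  obtain ⟨B, hB⟩ := L.exists_moment_four_standardTiltedLaw_le hX hlaw
  obtain ⟨C, hC⟩ := L.exists_integral_sq_charFun_standardTiltedLaw_le hX hlaw
  refine tendsto_sqrt_mul_integral_charFun_pow_sub_gaussian
    (fun n => standardTiltedLaw P X (t n)) (M := B) (C := C)
    ((L.tendsto_moment_three_standardTiltedLaw hX hlaw).comp ht) (hm.mono fun _ h => h.1)
    (hm.mono fun _ h => h.2.1) (hm.mono fun _ h => h.2.2) (Eventually.of_forall fun _ => rfl)
    (ht.eventually hB) (ht.eventually hC) fun δ hδ => ?_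
  obtain ⟨θ, h0, h1, hθ⟩ := L.exists_norm_charFun_standardTiltedLaw_le hX hlaw hδ
  exact ⟨θ, h0, h1, ht.eventually hθ⟩

end LightTailDensity

/-! ### The tail asymptotics -/

/-- Tilts at which `m` takes values tending to infinity tend to infinity, `m` being increasing. -/
theorem tendsto_atTop_of_tiltMean {Ω : Type*} [MeasurableSpace Ω] {P : Measure Ω} {X : Ω → ℝ}
    (hexp : ∀ t, Integrable (fun ω => Real.exp (t * X ω)) P) {a t : ℕ → ℝ}
    (ha : Tendsto a atTop atTop) (ht : ∀ᶠ n in atTop, tiltMean X P (t n) = a n) :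
    Tendsto t atTop atTop := by
  refine tendsto_atTop.2 fun T => ?_
  filter_upwards [ht, ha.eventually_gt_atTop (tiltMean X P T)] with n h1 h2
  exact ((monotone_tiltMean hexp).reflect_lt (h2.trans_eq h1.symm)).le

/-- Where `s` is positive, `m` is strictly increasing, so that `m⁻¹` is a genuine inverse at
large values. -/
theorem eventually_invFun_tiltMean_eq {Ω : Type*} [MeasurableSpace Ω] {P : Measure Ω} {X : Ω → ℝ}
    (hexp : ∀ t, Integrable (fun ω => Real.exp (t * X ω)) P)
    (hs : ∀ᶠ t in atTop, 0 < tiltSd X P t) :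
    ∀ᶠ y in atTop, ∀ t, tiltMean X P t = y → Function.invFun (tiltMean X P) y = t := by
  obtain ⟨T, hT⟩ := eventually_atTop.1 hs
  have hmono : StrictMonoOn (tiltMean X P) (Ici T) := by
    refine strictMonoOn_of_deriv_pos (convex_Ici T)
      (differentiable_tiltMean hexp).continuous.continuousOn fun t ht => ?_
    rw [interior_Ici] at ht
    exact Real.sqrt_pos.1 (hT t (le_of_lt ht))
  have hge : ∀ y, tiltMean X P T < y → ∀ t, tiltMean X P t = y → t ∈ Ici T := fun y hy t ht =>
    ((monotone_tiltMean hexp).reflect_lt (hy.trans_eq ht.symm)).le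
  filter_upwards [eventually_gt_atTop (tiltMean X P T)] with y hy t ht
  have h := Function.invFun_eq (f := tiltMean X P) ⟨t, ht⟩
  exact hmono.injOn (hge y hy _ h) (hge y hy _ ht) (h.trans ht.symm)

theorem mainTheorem6 {Ω : Type*} [MeasurableSpace Ω] (P : Measure Ω) [IsProbabilityMeasure P]
    (X : ℕ → Ω → ℝ) (hX : ∀ i, Measurable (X i)) (hindep : iIndepFun X P)
    -- the common density `p = c exp(-(g - q))` on the positive half-line
    (p g q : ℝ → ℝ) (c : ℝ)
    (hlaw : ∀ i, P.map (X i) = volume.withDensity (fun x => ENNReal.ofReal (p x)))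
    (hp_meas : Measurable p)
    (hp_bdd : ∃ M : ℝ, ∀ x, p x ≤ M)
    (hc : 0 < c)
    (hp_pos : ∀ x, 0 < x → p x = c * Real.exp (-(g x - q x)))
    (hp_neg : ∀ x, x < 0 → p x = 0)
    (hg_diff : ∀ x, 0 < x → DifferentiableAt ℝ g x)
    (hg_pos : ∀ x, 0 < x → 0 < g x)
    (hg_lim : Tendsto (fun x => g x / x) atTop atTop)
    (hq : ∃ ϑ : ℝ, 0 < ϑ ∧ ∀ᶠ x in atTop, ∀ v : ℝ, 0 < v → |v - x| < ϑ * x →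
      |q v| ≤ 1 / Real.sqrt (x * deriv g x))
    (hh : (∃ β : ℝ, MemRBeta β (deriv g)) ∨ MemRInfty (deriv g))
    (a t : ℕ → ℝ) (ha : Tendsto a atTop atTop)
    (ht : ∀ᶠ n in atTop, tiltMean (X 0) P (t n) = a n)
    (hgrowth : Tendsto (fun n : ℕ =>
      leftInv (deriv g) (t n) ^ 2 / (Real.sqrt n * deriv (leftInv (deriv g)) (t n)))
      atTop (𝓝 0)) :
    ∃ r : ℕ → ℝ, r =o[atTop] (fun n : ℕ => 1 / Real.sqrt n) ∧
      ∀ᶠ n : ℕ in atTop,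
        P.real {ω | n * a n ≤ ∑ i ∈ Finset.range n, X i ω} =
          Real.exp (-n * rateFun (X 0) P (a n)) /
            (Real.sqrt (2 * Real.pi) * Real.sqrt n * t n * tiltSd (X 0) P (t n)) * (1 + r n) := by
  obtain ⟨r, K, R⟩ : ∃ r K, RegularExponent g (deriv g) r K := by
    rcases hh with ⟨β, H⟩ | H
    · exact H.regularExponent hg_diff hg_lim
    · exact H.regularExponent hg_diff hg_lim
  obtain ⟨M, hM⟩ := hp_bdd
  have hq0 : Tendsto q atTop (𝓝 0) := by
    obtain ⟨ϑ, hϑ, hqx⟩ := hq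
    have h1 : Tendsto (fun x => 1 / Real.sqrt (x * deriv g x)) atTop (𝓝 0) :=
      (Real.tendsto_sqrt_atTop.comp (tendsto_id.atTop_mul_atTop₀ R.h_top)).const_div_atTop 1
    refine squeeze_zero_norm' ?_ h1
    filter_upwards [hqx, eventually_gt_atTop 0] with x hx hx0
    exact hx x hx0 (by simpa using mul_pos hϑ hx0)
  -- The value of the density at the origin is immaterial.
  have L : LightTailDensity ((Ioi 0).indicator p) g (deriv g) r q K c (max M 0) :=
    { reg := R
      meas := hp_meas.indicator measurableSet_Ioi
      c_pos := hc
      eq_of_pos := fun x hx => by rw [indicator_of_mem (mem_Ioi.2 hx), hp_pos x hx]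
      eq_zero := fun x hx => indicator_of_notMem (notMem_Ioi.2 hx) _
      le := fun x => indicator_apply_le' (fun _ => (hM x).trans (le_max_left _ _))
        fun _ => le_max_right _ _
      q_zero := hq0 }
  have hlaw0 : P.map (X 0)
      = volume.withDensity fun y => ENNReal.ofReal ((Ioi 0).indicator p y) := by
    rw [hlaw 0]
    refine withDensity_congr_ae ?_
    filter_upwards [volume.ae_ne 0] with x hx
    rcases lt_or_gt_of_ne hx with h | h
    · rw [indicator_of_notMem (notMem_Ioi.2 h.le), hp_neg x h]
    · rw [indicator_of_mem (mem_Ioi.2 h)]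
  have hexp := L.integrable_exp_mul (hX 0) hlaw0
  have ht_top := tendsto_atTop_of_tiltMean hexp ha ht
  have hs := L.eventually_tiltSd_pos (hX 0) hlaw0
  obtain ⟨hcf, hlim⟩ := L.tendsto_sqrt_mul_integral_charFun (hX 0) hlaw0 ht_top
  have hts := (L.tendsto_mul_tiltSd (hX 0) hlaw0).comp ht_top
  set A : ℕ → ℝ := fun n => Real.exp (-n * rateFun (X 0) P (a n)) /
    (Real.sqrt (2 * Real.pi) * Real.sqrt n * t n * tiltSd (X 0) P (t n)) with hA
  have hn0 : ∀ᶠ n : ℕ in atTop, 0 < n := eventually_gt_atTop 0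
  refine ⟨fun n => P.real {ω | n * a n ≤ ∑ i ∈ Finset.range n, X i ω} / A n - 1, ?_, ?_⟩
  · refine (isLittleO_iff_tendsto' ?_).2 ?_
    · filter_upwards [hn0] with n hn h0
      have : 0 < 1 / Real.sqrt (n : ℝ) := by positivity
      exact absurd h0 this.ne'
    have hbound : Tendsto (fun n : ℕ => (Real.sqrt n)⁻¹ * ((t n * tiltSd (X 0) P (t n))⁻¹) ^ 2 +
        Real.sqrt n * ∫ u : ℝ, ‖charFun (standardTiltedLaw P (X 0) (t n)) (u / Real.sqrt n) ^ n
          - (Real.exp (-u ^ 2 / 2) : ℂ)‖) atTop (𝓝 0) := by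
      have h1 : Tendsto (fun n : ℕ => (Real.sqrt (n : ℝ))⁻¹) atTop (𝓝 0) :=
        (Real.tendsto_sqrt_atTop.comp tendsto_natCast_atTop_atTop).inv_tendsto_atTop
      simpa using (h1.mul (hts.inv_tendsto_atTop.pow 2)).add hlim
    refine squeeze_zero_norm' ?_ hbound
    filter_upwards [hn0, hcf, ht, ht_top.eventually_gt_atTop 0, ht_top.eventually hs,
      ha.eventually (eventually_invFun_tiltMean_eq hexp hs)] with n hn hcfn htn htn0 hsn hinv
    have hrate : rateFun (X 0) P (a n) = a n * t n - cgf (X 0) P (t n) := by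
      rw [rateFun, hinv _ htn]
    have key := abs_tail_ratio_sub_one_le hX hindep (fun i => (hlaw i).trans (hlaw 0).symm)
      (hexp (t n)) htn0 hsn hn hcfn
    rw [htn, ← hrate] at key
    have hsq : 0 < Real.sqrt (n : ℝ) := Real.sqrt_pos.2 (Nat.cast_pos.2 hn)
    rw [div_div_eq_mul_div, div_one, norm_mul, Real.norm_eq_abs, Real.norm_of_nonneg hsq.le,
      mul_comm]
    refine (mul_le_mul_of_nonneg_left key hsq.le).trans (le_of_eq ?_)
    rw [mul_add]
    congr 1
    · field_simp
    · rw [← htn]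
      rfl
  · filter_upwards [hn0, ht_top.eventually_gt_atTop 0, ht_top.eventually hs] with n hn htn0 hsn
    have hA0 : A n ≠ 0 := by
      have : 0 < A n := by
        simp only [hA]
        positivity
      exact this.ne'
    rw [add_sub_cancel, mul_div_cancel₀ _ hA0]
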